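/- **Peer triplets.** Let $s\in\mathbb N$. An $s$-stage Peer triplet consists of nodes $c=(c_1,\dots,c_s)^{\sf T}$ with $c_i\ge 0$, vectors $a,w\in\mathbb R^s$, a start method $(A_0,K_0)$, a standard method $(A,B,K)$ with $A$ lower triangular and $K$ diagonal, and an end method $(A_N,B_N,K_N)$, all matrices in $\mathbb R^{s\times s}$ and $A_0,A,A_N$ non-singular. Put $(A_n,B_n,K_n)=(A,B,K)$ for $1\le n\le N-1$ and $K_n=(\kappa^{[n]}_{ij})$. Let $\mathbf 1=(1,\dots,1)^{\sf T}$ (of the fitting length), $c^k=(c_i^k)_i$, $V_k=(\mathbf 1,c,\dots,c^{k-1})\in\mathbb R^{s\times k}$, $\mathcal P_k=\big(\binom{j-1}{i-1}\big)_{i,j=1}^k$, $\tilde E_k=(i\,\delta_{i+1,j})_{i,j=1}^k$, $C=\operatorname{diag}(c_i)$, and let $e_1$ be the first unit vector. Let $2\le q\le r\le s$ and assume the order conditions - start: $A_0V_r=a e_1^{\sf T}+K_0V_r\tilde E_r$ and $A_0^{\sf T}V_q=B^{\sf T}V_q\mathcal P_q-K_0^{\sf T}V_q\tilde E_q$; -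 standard method: $AV_r=BV_r\mathcal P_r^{-1}+KV_r\tilde E_r$ and $A^{\sf T}V_q=B^{\sf T}V_q\mathcal P_q-K^{\sf T}V_q\tilde E_q$; - last step: $A_NV_r=B_NV_r\mathcal P_r^{-1}+K_NV_r\tilde E_r$ and $A^{\sf T}V_q=B_N^{\sf T}V_q\mathcal P_q-K^{\sf T}V_q\tilde E_q$; - end point: $w^{\sf T}V_r=\mathbf 1^{\sf T}$ and $A_N^{\sf T}V_q=w\mathbf 1^{\sf T}-K_N^{\sf T}V_q\tilde E_q$; - one-leg conditions: $(c^{l-1})^{\sf T}K_n=\mathbf 1^{\sf T}K_nC^{l-1}$ for $l=2,\dots,q$ and $n\in\{0,N\}$; - positivity: $\mathbf 1^{\sf T}K_0>0$, $\mathbf 1^{\sf T}K_N>0$, $\mathbf 1^{\sf T}K\ge 0$ (componentwise), and the eigenvalue conditions: $|\lambda_2(A^{-1}B)|\le\gamma<1$ for the absolutely second largest eigenvalue $\lambda_2$ (with multiplicities), and $K_0,K_N$ are non-singular and all eigenvalues of $K_0^{-1}A_0$ and $K_N^{-1}A_N$ have positive real part. **Continuous problem.** Let $f:\mathbb R^m\times\mathbb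 R^d\to\mathbb R^m$, $y_0\in\mathbb R^m$, $T>0$, and let $\mathcal C:\mathbb R^m\to\mathbb R$ be a polynomial of degree at most two, with constant Hessian $\nabla_{yy}\mathcal C$ and $\Gamma:=\|\nabla_{yy}\mathcal C\|$. Let $T^*>T$; if all $c_i\le1$, also $T^*=T$ is allowed. Let $z^\star=(y^\star,p^\star,u^\star)$ with $y^\star,p^\star,u^\star\in C^q[0,T^*]$ satisfy on $[0,T^*]$ $$y'=f(y,u),\qquad p'=-\nabla_yf(y,u)^{\sf T}p,\qquad \nabla_uf(y,u)^{\sf T}p=0,$$ together with $y(0)=y_0$ and $p(T)=\nabla_y\mathcal C(y(T))^{\sf T}$. These are the first-order optimality conditions of minimizing $\mathcal C(y(T))$ subject to $y'=f(y,u)$, $y(0)=y_0$, without control constraints. Assume: 1. there are $\omega$ and $\epsilon\in(0,1)$ such that $\langle\tilde p,\nabla_{uu}f(y^\star(t),u^\star(t))\rangle:=\sum_i\tilde p_i\nabla_{uu}f_i(y^\star(t),u^\star(t))$ is invertible, with inverse of norm at most $\omega$, for all $t\in[0,T^*]$ and all $\tilde p$ with $\|\tilde p-p^\star(t)\|\le\epsilon$;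 2. for some $\rho>0$ and all $z=(y,p,u)$ for which there is a $t\in[0,T^*]$ such that each of the three components of $z$ has distance at most $\rho$ from that of $z^\star(t)$, both $f$ and $\nabla_uf$ are $C^2$ near $(y,u)$, and with $\nabla_z$ denoting the derivative with respect to $(y,u)$ $$\|\nabla_zf\|\le\Lambda_1,\qquad(1+\|z\|)\,\|\nabla_{zz}f\|\le\Lambda_2,\qquad\|\langle p,\nabla_{uzz}f\rangle\|\le\Lambda_3 .$$ Here $\mathbb R^m,\mathbb R^d$ carry Euclidean norms, products of them the maximum norm, and linear maps operator norms. **Discrete problem.** For $N\in\mathbb N$ let $h=T/(N+1)$, $t_{ni}=(n+c_i)h$. With $F(Y_n,U_n)=(f(Y_{ni},U_{ni}))_{i=1}^s$ and $A_n$ etc. also denoting $A_n\otimes I$, the discrete optimality conditions for $Y_{ni},P_{ni}\in\mathbb R^m$, $U_{ni}\in\mathbb R^d$, $0\le n\le N$, $1\le i\le s$, are $$\begin{aligned} A_0Y_0&=a\otimes y_0+hK_0F(Y_0,U_0),\\ A_nY_n&=B_nY_{n-1}+hK_nF(Y_n,U_n),&&1\le n\le N,\\ A_N^{\sf T}P_N&=w\otimes\nabla_y\mathcal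 C\big((w^{\sf T}\otimes I)Y_N\big)^{\sf T}+h\nabla_YF(Y_N,U_N)^{\sf T}K_N^{\sf T}P_N,\\ A_n^{\sf T}P_n&=B_{n+1}^{\sf T}P_{n+1}+h\nabla_YF(Y_n,U_n)^{\sf T}K_n^{\sf T}P_n,&&0\le n\le N-1,\\ 0&=\nabla_uf(Y_{nj},U_{nj})^{\sf T}\sum_{i=1}^s\kappa^{[n]}_{ij}P_{ni},&&0\le n\le N,\ 1\le j\le s. \end{aligned}$$ At blind stages, where column $j$ of $K_n$ vanishes, $U_{nj}$ enters no equation and is discarded. Write $$\|\check Z\|:=\max_{n,i}\{\|Y_{ni}-y^\star(t_{ni})\|,\ \|P_{ni}-p^\star(t_{ni})\|,\ \|U_{ni}-u^\star(t_{ni})\|\},$$ blind stages being left out for $U$. **Theorem.** For every such Peer triplet there are constants $\zeta_1^P,\zeta_2^P,\zeta_c^P,\zeta_1^U,\zeta_2^U>0$, determined by the triplet only (and independent of the grid and of the control problem), such that for every control problem and solution $z^\star$ as above with $$(\zeta_1^P\Lambda_1+\zeta_2^P\Lambda_2+\zeta_c^P\Gamma\Lambda_1)\,T\le\tfrac23,\qquad\big(\zeta_1^U(1+\Gamma)\Lambda_1+\zeta_2^U\Lambda_2\big)\Lambda_1\,T\,\omega\le\tfrac13$$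 the following holds: there are $\delta>0$, $h_0>0$ and $M$ such that for every $N$ with $h=T/(N+1)\le h_0$ the discrete optimality conditions have exactly one solution $(Y,P,U)$ with $\|\check Z\|\le\delta$, and it satisfies $\|\check Z\|\le M\,h^{q-1}$. -/

import Mathlib

open scoped Matrix BigOperators

noncomputable section

/-- `ℝⁿ` with the Euclidean norm. -/
abbrev Vec (n : ℕ) : Type := EuclideanSpace ℝ (Fin n)

/-! ### Peer triplets and their order conditions -/

/-- The coefficients of an `s`-stage Peer triplet: the nodes `c`, the start method `(A₀, K₀)` with
the vector `a`, the standard method `(A, B, K)` with `A` lower triangular and `K` diagonal, and the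
end method `(A_N, B_N, K_N)` with the vector `w`. The matrices `A₀, A, A_N` are non-singular. -/
structure PeerTriplet (s : ℕ) where
  c : Fin s → ℝ
  a : Fin s → ℝ
  w : Fin s → ℝ
  A₀ : Matrix (Fin s) (Fin s) ℝ
  K₀ : Matrix (Fin s) (Fin s) ℝ
  A : Matrix (Fin s) (Fin s) ℝ
  B : Matrix (Fin s) (Fin s) ℝ
  K : Matrix (Fin s) (Fin s) ℝ
  A_N : Matrix (Fin s) (Fin s) ℝ
  B_N : Matrix (Fin s) (Fin s) ℝ
  K_N : Matrix (Fin s) (Fin s) ℝ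
  c_nonneg : ∀ i, 0 ≤ c i
  A_lower : ∀ i j, i < j → A i j = 0
  K_diag : K.IsDiag
  A₀_unit : IsUnit A₀.det
  A_unit : IsUnit A.det
  A_N_unit : IsUnit A_N.det

/-- The Vandermonde matrix `V_k = (𝟙, c, c², …, c^{k-1}) ∈ ℝ^{s×k}`. -/
def vandermondeCols {s : ℕ} (c : Fin s → ℝ) (k : ℕ) : Matrix (Fin s) (Fin k) ℝ :=
  Matrix.of fun i j => c i ^ (j : ℕ)

/-- The Pascal matrix `𝒫_k`, in one-based notation with entries `binom (j-1) (i-1)`. -/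
def pascal (k : ℕ) : Matrix (Fin k) (Fin k) ℝ :=
  Matrix.of fun i j => (Nat.choose (j : ℕ) (i : ℕ) : ℝ)

/-- The nilpotent matrix `Ẽ_k`, in one-based notation with entries `i δ_{i+1,j}`. -/
def tildeE (k : ℕ) : Matrix (Fin k) (Fin k) ℝ :=
  Matrix.of fun i j => if (j : ℕ) = (i : ℕ) + 1 then ((i : ℕ) : ℝ) + 1 else 0

/-- The first cardinal basis vector of `ℝᵏ`. -/
def firstUnit (k : ℕ) : Fin k → ℝ := fun j => if (j : ℕ) = 0 then 1 else 0

/-- The one-leg conditions `(c^{l-1})ᵀ K = 𝟙ᵀ K C^{l-1}`, `l = 2, …, q`, with `C = diag c`. -/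
def OneLeg {s : ℕ} (c : Fin s → ℝ) (K : Matrix (Fin s) (Fin s) ℝ) (q : ℕ) : Prop :=
  ∀ l : ℕ, 2 ≤ l → l ≤ q → ∀ j, ∑ i, c i ^ (l - 1) * K i j = (∑ i, K i j) * c j ^ (l - 1)

/-- The order conditions of the triplet for the forward order `r` and the adjoint order `q`,
including the one-leg and the positivity conditions on the column sums. -/
structure PeerTriplet.OrderConditions {s : ℕ} (𝒯 : PeerTriplet s) (r q : ℕ) : Prop where
  start_forward : 𝒯.A₀ * vandermondeCols 𝒯.c r
    = Matrix.vecMulVec 𝒯.a (firstUnit r) + 𝒯.K₀ * vandermondeCols 𝒯.c r * tildeE r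
  start_adjoint : 𝒯.A₀ᵀ * vandermondeCols 𝒯.c q
    = 𝒯.Bᵀ * vandermondeCols 𝒯.c q * pascal q - 𝒯.K₀ᵀ * vandermondeCols 𝒯.c q * tildeE q
  start_oneLeg : OneLeg 𝒯.c 𝒯.K₀ q
  start_pos : ∀ j, 0 < ∑ i, 𝒯.K₀ i j
  standard_forward : 𝒯.A * vandermondeCols 𝒯.c r
    = 𝒯.B * vandermondeCols 𝒯.c r * (pascal r)⁻¹ + 𝒯.K * vandermondeCols 𝒯.c r * tildeE r
  standard_adjoint : 𝒯.Aᵀ * vandermondeCols 𝒯.c q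
    = 𝒯.Bᵀ * vandermondeCols 𝒯.c q * pascal q - 𝒯.Kᵀ * vandermondeCols 𝒯.c q * tildeE q
  standard_nonneg : ∀ j, 0 ≤ ∑ i, 𝒯.K i j
  last_forward : 𝒯.A_N * vandermondeCols 𝒯.c r
    = 𝒯.B_N * vandermondeCols 𝒯.c r * (pascal r)⁻¹ + 𝒯.K_N * vandermondeCols 𝒯.c r * tildeE r
  last_adjoint : 𝒯.Aᵀ * vandermondeCols 𝒯.c q
    = 𝒯.B_Nᵀ * vandermondeCols 𝒯.c q * pascal q - 𝒯.Kᵀ * vandermondeCols 𝒯.c q * tildeE q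
  end_forward : 𝒯.w ᵥ* vandermondeCols 𝒯.c r = fun _ => 1
  end_adjoint : 𝒯.A_Nᵀ * vandermondeCols 𝒯.c q
    = Matrix.vecMulVec 𝒯.w (fun _ => 1) - 𝒯.K_Nᵀ * vandermondeCols 𝒯.c q * tildeE q
  end_oneLeg : OneLeg 𝒯.c 𝒯.K_N q
  end_pos : ∀ j, 0 < ∑ i, 𝒯.K_N i j

/-- The complex eigenvalues of a real square matrix, with algebraic multiplicity. -/
def eigs {s : ℕ} (M : Matrix (Fin s) (Fin s) ℝ) : Multiset ℂ :=
  (M.map (algebraMap ℝ ℂ)).charpoly.roots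

/-- `|λ₂(M)| ≤ γ` for the absolutely second largest eigenvalue `λ₂(M)`: some eigenvalue `μ` of
largest modulus can be removed (once) such that all the remaining ones have modulus at most `γ`. -/
def SecondEigLE {s : ℕ} (M : Matrix (Fin s) (Fin s) ℝ) (γ : ℝ) : Prop :=
  ∃ (μ : ℂ) (rest : Multiset ℂ), eigs M = μ ::ₘ rest ∧ ∀ ν ∈ rest, ‖ν‖ ≤ ‖μ‖ ∧ ‖ν‖ ≤ γ

/-- `K` is non-singular and all eigenvalues of `K⁻¹ A` have positive real part. -/
def PosRealEigs {s : ℕ} (K A : Matrix (Fin s) (Fin s) ℝ) : Prop :=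
  IsUnit K.det ∧ ∀ ν ∈ eigs (K⁻¹ * A), 0 < ν.re

/-- `A_n` on the grid `n = 0, …, N`. -/
def PeerTriplet.An {s : ℕ} (𝒯 : PeerTriplet s) (N n : ℕ) : Matrix (Fin s) (Fin s) ℝ :=
  if n = 0 then 𝒯.A₀ else if n = N then 𝒯.A_N else 𝒯.A

/-- `B_n` for `n = 1, …, N`. -/
def PeerTriplet.Bn {s : ℕ} (𝒯 : PeerTriplet s) (N n : ℕ) : Matrix (Fin s) (Fin s) ℝ :=
  if n = N then 𝒯.B_N else 𝒯.B

/-- `K_n` on the grid `n = 0, …, N`. -/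
def PeerTriplet.Kn {s : ℕ} (𝒯 : PeerTriplet s) (N n : ℕ) : Matrix (Fin s) (Fin s) ℝ :=
  if n = 0 then 𝒯.K₀ else if n = N then 𝒯.K_N else 𝒯.K

/-- Stage `j` of step `n` is active if column `j` of `K_n` is not zero. At the other ("blind")
stages the control `U_{nj}` does not enter any equation and is not an unknown. -/
def PeerTriplet.Active {s : ℕ} (𝒯 : PeerTriplet s) (N n : ℕ) (j : Fin s) : Prop :=
  ∃ i, 𝒯.Kn N n i j ≠ 0

/-! ### Derivatives of the right-hand side -/

section Derivatives

variable {m d : ℕ}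

/-- `∇_y f`. -/
def gradY (f : Vec m × Vec d → Vec m) (z : Vec m × Vec d) : Vec m →L[ℝ] Vec m :=
  (fderiv ℝ f z).comp (ContinuousLinearMap.inl ℝ (Vec m) (Vec d))

/-- `∇_u f`. -/
def gradU (f : Vec m × Vec d → Vec m) (z : Vec m × Vec d) : Vec d →L[ℝ] Vec m :=
  (fderiv ℝ f z).comp (ContinuousLinearMap.inr ℝ (Vec m) (Vec d))

/-- The vector `∇_y f(z)ᵀ p`. -/
def gradYT (f : Vec m × Vec d → Vec m) (z : Vec m × Vec d) (p : Vec m) : Vec m :=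
  ContinuousLinearMap.adjoint (gradY f z) p

/-- The vector `∇_u f(z)ᵀ p`. -/
def gradUT (f : Vec m × Vec d → Vec m) (z : Vec m × Vec d) (p : Vec m) : Vec d :=
  ContinuousLinearMap.adjoint (gradU f z) p

/-- The control Hessian `⟨p, ∇_uu f(y,u)⟩`, as a linear map of `ℝᵈ`. -/
def hessU (f : Vec m × Vec d → Vec m) (p : Vec m) (y : Vec m) (u : Vec d) : Vec d →L[ℝ] Vec d :=
  fderiv ℝ (fun v => gradUT f (y, v) p) u

/-! ### The continuous problem -/

/-- `(y, p, u)` solves the first-order optimality conditions without control constraints, with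
initial value `y(0) = y₀`, end condition `p(T) = ∇C(y(T))`, and with its equations valid on
`[0, T']`. -/
structure IsKKTSolution (f : Vec m × Vec d → Vec m) (C : Vec m → ℝ) (y₀ : Vec m) (T T' : ℝ)
    (y p : ℝ → Vec m) (u : ℝ → Vec d) : Prop where
  state : ∀ t ∈ Set.Icc 0 T', HasDerivWithinAt y (f (y t, u t)) (Set.Icc 0 T') t
  init : y 0 = y₀
  adjoint : ∀ t ∈ Set.Icc 0 T',
    HasDerivWithinAt p (-gradYT f (y t, u t) (p t)) (Set.Icc 0 T') t
  final : p T = gradient C (y T)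
  control : ∀ t ∈ Set.Icc 0 T', gradUT f (y t, u t) (p t) = 0

/-- In the tube of radius `ρ` around the curve `(y, p, u)` on `[0, T']` the functions `f` and
`∇_u f` are twice continuously differentiable, and there
`‖∇_z f‖ ≤ Λ₁`, `(1 + ‖z‖) ‖∇_zz f‖ ≤ Λ₂`, `‖⟨p, ∇_uzz f⟩‖ ≤ Λ₃`. -/
def SmoothnessBounds (f : Vec m × Vec d → Vec m) (T' : ℝ) (y p : ℝ → Vec m) (u : ℝ → Vec d)
    (ρ Λ₁ Λ₂ Λ₃ : ℝ) : Prop :=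
  ∀ t ∈ Set.Icc 0 T', ∀ (y' p' : Vec m) (u' : Vec d),
    ‖y' - y t‖ ≤ ρ → ‖p' - p t‖ ≤ ρ → ‖u' - u t‖ ≤ ρ →
      ContDiffAt ℝ 2 f (y', u') ∧ ContDiffAt ℝ 2 (gradU f) (y', u') ∧
      ‖fderiv ℝ f (y', u')‖ ≤ Λ₁ ∧
      (1 + ‖(y', p', u')‖) * ‖fderiv ℝ (fderiv ℝ f) (y', u')‖ ≤ Λ₂ ∧
      ‖fderiv ℝ (fderiv ℝ (fun z => gradUT f z p')) (y', u')‖ ≤ Λ₃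

/-- `⟨p̃, ∇_uu f(y(t), u(t))⟩` is invertible with `‖⟨p̃, ∇_uu f(y(t), u(t))⟩⁻¹‖ ≤ ω` for all
`t ∈ [0, T']` and all `p̃` with `‖p̃ - p(t)‖ ≤ ε`. -/
def ControlHessianBound (f : Vec m × Vec d → Vec m) (T' : ℝ) (y p : ℝ → Vec m) (u : ℝ → Vec d)
    (ε ω : ℝ) : Prop :=
  ∀ t ∈ Set.Icc 0 T', ∀ p' : Vec m, ‖p' - p t‖ ≤ ε →
    ∃ L : Vec d ≃L[ℝ] Vec d, (L : Vec d →L[ℝ] Vec d) = hessU f p' (y t) (u t) ∧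
      ‖(L.symm : Vec d →L[ℝ] Vec d)‖ ≤ ω

/-- `C` is a polynomial of degree at most two. -/
def IsQuadraticPoly (C : Vec m → ℝ) : Prop :=
  ∃ Q : MvPolynomial (Fin m) ℝ, Q.totalDegree ≤ 2 ∧
    ∀ y : Vec m, C y = MvPolynomial.eval (fun i => y i) Q

/-! ### The discrete problem -/

variable {s : ℕ}

/-- The discrete first-order optimality conditions without control constraints on the grid
`t_n = n h`, `n = 0, …, N`. -/
structure PeerTriplet.IsDiscreteKKT (𝒯 : PeerTriplet s) (f : Vec m × Vec d → Vec m) (C : Vec m → ℝ)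
    (y₀ : Vec m) (N : ℕ) (h : ℝ) (Y P : Fin (N + 1) → Fin s → Vec m)
    (U : Fin (N + 1) → Fin s → Vec d) : Prop where
  state_start : ∀ i, ∑ j, 𝒯.An N 0 i j • Y 0 j
    = 𝒯.a i • y₀ + h • ∑ j, 𝒯.Kn N 0 i j • f (Y 0 j, U 0 j)
  state_step : ∀ (n : Fin N) (i : Fin s), ∑ j, 𝒯.An N (n + 1) i j • Y n.succ j
    = ∑ j, 𝒯.Bn N (n + 1) i j • Y n.castSucc j
      + h • ∑ j, 𝒯.Kn N (n + 1) i j • f (Y n.succ j, U n.succ j)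
  adjoint_end : ∀ i, ∑ j, 𝒯.An N N j i • P (Fin.last N) j
    = 𝒯.w i • gradient C (∑ j, 𝒯.w j • Y (Fin.last N) j)
      + h • gradYT f (Y (Fin.last N) i, U (Fin.last N) i)
          (∑ j, 𝒯.Kn N N j i • P (Fin.last N) j)
  adjoint_step : ∀ (n : Fin N) (i : Fin s), ∑ j, 𝒯.An N n j i • P n.castSucc j
    = ∑ j, 𝒯.Bn N (n + 1) j i • P n.succ j
      + h • gradYT f (Y n.castSucc i, U n.castSucc i) (∑ j, 𝒯.Kn N n j i • P n.castSucc j)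
  control : ∀ (n : Fin (N + 1)) (j : Fin s),
    gradUT f (Y n j, U n j) (∑ i, 𝒯.Kn N n i j • P n i) = 0

/-- The maximal error of `(Y, P, U)` against the values of `(y, p, u)` in the points
`t_{ni} = (n + c_i) h` is at most `δ`, for `U` over the active stages. -/
def PeerTriplet.ErrorLE (𝒯 : PeerTriplet s) (y p : ℝ → Vec m) (u : ℝ → Vec d) (N : ℕ) (h : ℝ)
    (Y P : Fin (N + 1) → Fin s → Vec m) (U : Fin (N + 1) → Fin s → Vec d) (δ : ℝ) : Prop :=
  ∀ (n : Fin (N + 1)) (i : Fin s),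
    ‖Y n i - y (((n : ℕ) + 𝒯.c i) * h)‖ ≤ δ ∧
    ‖P n i - p (((n : ℕ) + 𝒯.c i) * h)‖ ≤ δ ∧
    (𝒯.Active N n i → ‖U n i - u (((n : ℕ) + 𝒯.c i) * h)‖ ≤ δ)

end Derivatives

end

/-!
The discrete optimality conditions are written as the zero of a residual map `𝒢.residual` of the
unknowns `z = (Y, P, U)` in the maximum norm (`GridProblem`). The control equations are divided by
the column sums of `K_n`, so that they evaluate `∇ᵤf(Y, U)ᵀ` at a weighted mean of the multipliers
of one step; at a blind stage, where the column vanishes, the equation `U = u⋆` takes their place.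
The zero closest to the exact solution is found with the contraction principle
(`exists_unique_zero_of_approx_linear`), which needs a stable linear model, a small Lipschitz
constant of the difference between residual and model, and a small residual at the exact solution.

*Linear model and stability.* The model `𝒢.frozen` drops the terms with the factor `h` from the
state and adjoint equations, keeps the coupling at the end point through the constant Hessian of the
objective, and linearizes the control equations at the exact solution. It is block triangular in
the order `Y`, `P`, `U`, with block bidiagonal operators `stateOp` and `adjointOp` and an invertible
control Hessian on the diagonal. The bidiagonal blocks are stable uniformly in `N`
(`PeerTriplet.exists_stability`) because the powers of `A⁻¹ B` are bounded: the order conditions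
provide the right eigenvector `𝟙` and the left eigenvector `𝟙ᵀ A` for the eigenvalue one, the
conditions of the last step and the end point show that their product is one, and after deflation
all eigenvalues lie in the open unit disc (`Matrix.exists_abs_pow_apply_le_of_secondEigLE`).

*Contraction.* The remaining terms of the state and adjoint equations carry the factor `h` and a
Lipschitz constant made of `Λ₁` and `Λ₂`; summed over the `N + 1` steps they yield `T` times that
constant. Their effect passes on to the controls with another factor `Λ₁` or `Λ₂` and the bound `ω`
of the inverse control Hessian. The two smallness assumptions, with `ζ` taken as fixed multiples of
powers of the stability constant and of a bound of the coefficients, make these contributions small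
(`contraction_constants`), and the nonlinear part of the control equations is small on a small ball
(`PointSmoothness.norm_pairing_sub_linearization_le`). Altogether the difference has Lipschitz
constant at most one half in a norm that measures the right-hand sides
(`GridProblem.Bounds.size_residual_sub_frozen_le`).

*Consistency.* The order conditions say that the difference formulas are exact for monomials of low
degree (`forward_exact`, `adjoint_exact`, `OneLegWeights`), and Taylor expansion with a remainder
that is uniform in the base point gives residuals of order `h ^ q` in each step
(`PeerTriplet.exists_consistency`). Stability costs one power of `h`, which leaves the error
`O(h ^ (q - 1))`.
-/

noncomputable section

/-! ### Power-boundedness of the stability matrix -/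

/-- By Gelfand's formula, the powers of an element of spectral radius below one are bounded. -/
theorem exists_norm_pow_le_of_spectralRadius_lt_one {A : Type*} [NormedRing A] [NormedAlgebra ℂ A]
    [CompleteSpace A] (a : A) (ha : spectralRadius ℂ a < 1) : ∃ C : ℝ, ∀ n : ℕ, ‖a ^ n‖ ≤ C := by
  have h := spectrum.pow_nnnorm_pow_one_div_tendsto_nhds_spectralRadius a
  have hev : ∀ᶠ n : ℕ in Filter.atTop, ‖a ^ n‖ ≤ 1 := by
    filter_upwards [h.eventually (gt_mem_nhds ha), Filter.eventually_gt_atTop 0] with n hn hn0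
    by_contra! hcon
    have h1 : (1 : ENNReal) ≤ (‖a ^ n‖₊ : ENNReal) := by
      have : (1 : NNReal) ≤ ‖a ^ n‖₊ := by exact_mod_cast hcon.le
      exact_mod_cast this
    exact absurd hn (not_lt.mpr (ENNReal.one_le_rpow h1 (by positivity)))
  have hb : Filter.IsBoundedUnder (· ≤ ·) Filter.atTop (fun n : ℕ => ‖a ^ n‖) := ⟨1, hev⟩
  obtain ⟨C, hC⟩ := hb.bddAbove_range
  exact ⟨C, fun n => hC ⟨n, rfl⟩⟩

section

attribute [local instance] Matrix.linftyOpNormedRing Matrix.linftyOpNormedAlgebra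

/-- The powers of a complex matrix whose eigenvalues lie in the open unit disc are bounded. -/
theorem Matrix.exists_norm_pow_apply_le {s : ℕ} (D : Matrix (Fin s) (Fin s) ℂ)
    (hD : ∀ ν ∈ spectrum ℂ D, ‖ν‖ < 1) : ∃ C : ℝ, ∀ (n : ℕ) (i j : Fin s), ‖(D ^ n) i j‖ ≤ C := by
  have hr : spectralRadius ℂ D < 1 := by
    rcases isEmpty_or_nonempty (Fin s) with hs | hs
    · rw [Subsingleton.elim D 0, spectrum.spectralRadius_zero]
      exact zero_lt_one
    · have := spectrum.spectralRadius_lt_of_forall_lt (r := 1) D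
        (fun k hk => by exact_mod_cast hD k hk)
      exact_mod_cast this
  obtain ⟨C, hC⟩ := exists_norm_pow_le_of_spectralRadius_lt_one D hr
  refine ⟨C, fun n i j => le_trans ?_ (hC n)⟩
  have h1 : ‖(D ^ n) i j‖ ≤ ∑ j, ‖(D ^ n) i j‖ :=
    Finset.single_le_sum (f := fun j => ‖(D ^ n) i j‖) (fun _ _ => norm_nonneg _)
      (Finset.mem_univ j)
  have h2 := Matrix.linfty_opNorm_def (D ^ n)
  rw [h2]
  refine h1.trans ?_
  have h3 := Finset.le_sup (f := fun i => ∑ j, ‖(D ^ n) i j‖₊) (Finset.mem_univ i)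
  have : ((∑ j, ‖(D ^ n) i j‖₊ : NNReal) : ℝ) ≤
    ((Finset.univ.sup fun i => ∑ j, ‖(D ^ n) i j‖₊ : NNReal) : ℝ) := by exact_mod_cast h3
  simpa using this

end

/-- If `e` and `v` are right and left eigenvectors of `M` for the eigenvalue `1`, normalized by
`vᵀ e = 1`, and all eigenvalues but one are bounded by `γ < 1`, then the powers of `M` are bounded:
they differ from those of the deflated matrix `M - e vᵀ`, whose spectrum lies in the open unit
disc, by the projection `e vᵀ`. -/
theorem Matrix.exists_abs_pow_apply_le_of_secondEigLE {s : ℕ} (M : Matrix (Fin s) (Fin s) ℝ)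
    (e v : Fin s → ℝ) (hMe : M *ᵥ e = e) (hvM : v ᵥ* M = v) (hve : v ⬝ᵥ e = 1)
    {γ : ℝ} (hγ : γ < 1) (hlam : SecondEigLE M γ) :
    ∃ C : ℝ, ∀ (n : ℕ) (i j : Fin s), |(M ^ n) i j| ≤ C := by
  set P := Matrix.vecMulVec e v with hP
  set D := M - P with hDdef
  have hMP : M * P = P := by rw [hP, Matrix.mul_vecMulVec, hMe]
  have hPM : P * M = P := by rw [hP, Matrix.vecMulVec_mul, hvM]
  have hPP : P * P = P := by
    rw [hP, Matrix.vecMulVec_mul_vecMulVec, hve, one_smul]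
  have hDP : D * P = 0 := by rw [hDdef, sub_mul, hMP, hPP, sub_self]
  have hPD : P * D = 0 := by rw [hDdef, mul_sub, hPM, hPP, sub_self]
  have hpow : ∀ n : ℕ, M ^ (n + 1) = D ^ (n + 1) + P := by
    intro n
    induction n with
    | zero => simp [hDdef]
    | succ n ih =>
      rw [pow_succ, ih]
      have : M = D + P := by rw [hDdef]; abel
      conv_lhs => rw [this]
      rw [add_mul, mul_add, mul_add, hPD, hPP, pow_succ D n, mul_assoc (D ^ n) D P, hDP, mul_zero,
        add_zero, zero_add, ← pow_succ, ← pow_succ]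
  -- the spectrum of the deflated matrix
  let φ : ℝ →+* ℂ := algebraMap ℝ ℂ
  let eC : Fin s → ℂ := fun i => (e i : ℂ)
  let vC : Fin s → ℂ := fun i => (v i : ℂ)
  have hMe' : (M.map φ) *ᵥ eC = eC := by
    funext i
    have := congrFun hMe i
    simp only [Matrix.mulVec, dotProduct, Matrix.map_apply, eC] at this ⊢
    rw [← this]
    push_cast
    rfl
  have hvM' : vC ᵥ* (M.map φ) = vC := by
    funext i
    have := congrFun hvM i
    simp only [Matrix.vecMul, dotProduct, Matrix.map_apply, vC] at this ⊢
    conv_rhs => rw [← this]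
    push_cast
    rfl
  have hve' : vC ⬝ᵥ eC = 1 := by
    simp only [dotProduct, vC, eC] at hve ⊢
    exact_mod_cast congrArg (fun x : ℝ => (x : ℂ)) hve
  have hDmap : D.map φ = M.map φ - Matrix.vecMulVec eC vC := by
    ext i j
    simp [hDdef, hP, Matrix.vecMulVec_apply, eC, vC, φ]
  obtain ⟨μ, rest, hroots, hrest⟩ := hlam
  have hne : (M.map φ).charpoly ≠ 0 := (Matrix.charpoly_monic _).ne_zero
  have heC : eC ≠ 0 := by
    intro h0
    rw [h0, dotProduct_zero] at hve'
    exact zero_ne_one hve'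
  have heig : ∀ (ν : ℂ) (x : Fin s → ℂ), x ≠ 0 → (M.map φ) *ᵥ x = ν • x → ν ∈ μ ::ₘ rest := by
    intro ν x hx hMx
    rw [← hroots]
    change ν ∈ (M.map φ).charpoly.roots
    rw [Polynomial.mem_roots hne, ← Matrix.mem_spectrum_iff_isRoot_charpoly,
      ← Matrix.spectrum_toLin', ← Module.End.hasEigenvalue_iff_mem_spectrum]
    exact Module.End.hasEigenvalue_of_hasEigenvector (x := x)
      ⟨Module.End.mem_eigenspace_iff.mpr (by simpa using hMx), hx⟩
  have h1rest : (1 : ℂ) ∉ rest := by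
    intro h
    have := (hrest 1 h).2
    rw [norm_one] at this
    linarith
  have hμ : μ = 1 := by
    have := heig 1 eC heC (by rw [hMe', one_smul])
    rcases Multiset.mem_cons.mp this with h | h
    · exact h.symm
    · exact absurd h h1rest
  have hspec : ∀ ν ∈ spectrum ℂ (D.map φ), ‖ν‖ < 1 := by
    intro ν hν
    rw [← Matrix.spectrum_toLin', ← Module.End.hasEigenvalue_iff_mem_spectrum] at hν
    obtain ⟨x, hx⟩ := hν.exists_hasEigenvector
    have hDx : (D.map φ) *ᵥ x = ν • x := by
      simpa using Module.End.mem_eigenspace_iff.mp hx.1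
    have hx0 : x ≠ 0 := hx.2
    by_cases hν0 : ν = 0
    · simp [hν0]
    have hvx : vC ⬝ᵥ x = 0 := by
      have h1 : vC ⬝ᵥ ((D.map φ) *ᵥ x) = 0 := by
        rw [hDmap, Matrix.dotProduct_mulVec, Matrix.vecMul_sub, hvM', Matrix.vecMul_vecMulVec,
          hve', one_smul, sub_self, zero_dotProduct]
      rw [hDx, dotProduct_smul, smul_eq_mul] at h1
      exact (mul_eq_zero.mp h1).resolve_left hν0
    have hMx : (M.map φ) *ᵥ x = ν • x := by
      rw [← hDx, hDmap, Matrix.sub_mulVec, Matrix.vecMulVec_mulVec, hvx]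
      simp
    rcases Multiset.mem_cons.mp (heig ν x hx0 hMx) with h | h
    · -- a second eigenvector for the eigenvalue one would make it a double eigenvalue
      exfalso
      rw [h, hμ, one_smul] at hMx
      have hli : LinearIndependent ℂ ![eC, x] := by
        rw [LinearIndependent.pair_iff]
        intro a b hab
        have h2 : vC ⬝ᵥ (a • eC + b • x) = 0 := by rw [hab, dotProduct_zero]
        rw [dotProduct_add, dotProduct_smul, dotProduct_smul, hve', hvx] at h2
        have ha : a = 0 := by simpa using h2
        refine ⟨ha, ?_⟩
        rw [ha, zero_smul, zero_add] at hab
        exact (smul_eq_zero.mp hab).resolve_right hx0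
      have hle := LinearMap.finrank_eigenspace_le (Matrix.toLin' (M.map φ)) (1 : ℂ)
      have h2le : 2 ≤ Module.finrank ℂ (Module.End.eigenspace (Matrix.toLin' (M.map φ)) (1 : ℂ)) := by
        have hspan : Submodule.span ℂ (Set.range ![eC, x]) ≤
            Module.End.eigenspace (Matrix.toLin' (M.map φ)) (1 : ℂ) := by
          rw [Submodule.span_le]
          rintro _ ⟨i, rfl⟩
          fin_cases i
          · exact Module.End.mem_eigenspace_iff.mpr (by simpa using hMe')
          · exact Module.End.mem_eigenspace_iff.mpr (by simpa using hMx)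
        have := Submodule.finrank_mono hspan
        rwa [finrank_span_eq_card hli, Fintype.card_fin] at this
      rw [Matrix.charpoly_toLin', ← Polynomial.count_roots] at hle
      have hc : (M.map φ).charpoly.roots = 1 ::ₘ rest := by rw [← hμ]; exact hroots
      rw [hc, Multiset.count_cons_self, Multiset.count_eq_zero_of_notMem h1rest] at hle
      omega
    · exact lt_of_le_of_lt (hrest ν h).2 hγ
  obtain ⟨C, hC⟩ := Matrix.exists_norm_pow_apply_le (D.map φ) hspec
  have hC' : ∀ (n : ℕ) (i j : Fin s), |(D ^ n) i j| ≤ C := by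
    intro n i j
    have := hC n i j
    rw [← Matrix.map_pow] at this
    simpa [φ] using this
  obtain ⟨C₂, hC₂⟩ : ∃ C₂ : ℝ, ∀ i j, |P i j| ≤ C₂ :=
    ⟨∑ i, ∑ j, |P i j|, fun i j =>
      (Finset.single_le_sum (f := fun j => |P i j|) (fun _ _ => abs_nonneg _)
        (Finset.mem_univ j)).trans
      (Finset.single_le_sum (f := fun i => ∑ j, |P i j|)
        (fun _ _ => Finset.sum_nonneg fun _ _ => abs_nonneg _) (Finset.mem_univ i))⟩
  refine ⟨C + C₂, fun n i j => ?_⟩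
  have hC₂0 : 0 ≤ C₂ := (abs_nonneg _).trans (hC₂ i j)
  cases n with
  | zero =>
    have := hC' 0 i j
    rw [pow_zero] at this ⊢
    linarith
  | succ n =>
    rw [hpow, Matrix.add_apply]
    exact (abs_add_le _ _).trans (add_le_add (hC' _ i j) (hC₂ i j))

end

noncomputable section

/-! ### Matrices acting on stage vectors and stability of block bidiagonal systems -/

/-- The action `A ⊗ I` of a real `s × s` matrix on stage vectors with entries in a module. -/
def stageMap {s : ℕ} {E : Type*} [AddCommGroup E] [Module ℝ E] (A : Matrix (Fin s) (Fin s) ℝ) :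
    (Fin s → E) →ₗ[ℝ] (Fin s → E) :=
  LinearMap.pi fun i => ∑ j, A i j • LinearMap.proj j

/-- The sum of the absolute values of all entries, an upper bound for the norm of `A ⊗ I`. -/
def entrySum {s : ℕ} (A : Matrix (Fin s) (Fin s) ℝ) : ℝ := ∑ i, ∑ j, |A i j|

section StageMap

variable {s : ℕ}

theorem entrySum_nonneg (A : Matrix (Fin s) (Fin s) ℝ) : 0 ≤ entrySum A :=
  Finset.sum_nonneg fun _ _ => Finset.sum_nonneg fun _ _ => abs_nonneg _

theorem sum_abs_row_le_entrySum (A : Matrix (Fin s) (Fin s) ℝ) (i : Fin s) :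
    ∑ j, |A i j| ≤ entrySum A :=
  Finset.single_le_sum (f := fun i => ∑ j, |A i j|)
    (fun _ _ => Finset.sum_nonneg fun _ _ => abs_nonneg _) (Finset.mem_univ i)

theorem entrySum_transpose (A : Matrix (Fin s) (Fin s) ℝ) : entrySum Aᵀ = entrySum A :=
  Finset.sum_comm

theorem abs_colSum_le_entrySum (A : Matrix (Fin s) (Fin s) ℝ) (j : Fin s) :
    |∑ i, A i j| ≤ entrySum A := by
  rw [← entrySum_transpose]
  exact (Finset.abs_sum_le_sum_abs _ _).trans (sum_abs_row_le_entrySum Aᵀ j)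

variable {E : Type*}

section Algebra

variable [AddCommGroup E] [Module ℝ E]

@[simp]
theorem stageMap_apply (A : Matrix (Fin s) (Fin s) ℝ) (x : Fin s → E) (i : Fin s) :
    stageMap A x i = ∑ j, A i j • x j := by
  simp [stageMap]

theorem stageMap_mul (A B : Matrix (Fin s) (Fin s) ℝ) (x : Fin s → E) :
    stageMap (A * B) x = stageMap A (stageMap B x) := by
  funext i
  simp only [stageMap_apply, Matrix.mul_apply, Finset.sum_smul, Finset.smul_sum, smul_smul]
  exact Finset.sum_comm

theorem stageMap_one (x : Fin s → E) : stageMap (1 : Matrix (Fin s) (Fin s) ℝ) x = x := by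
  funext i
  simp [Matrix.one_apply, ite_smul]

theorem eq_stageMap_inv_of_stageMap_eq {A : Matrix (Fin s) (Fin s) ℝ} (hA : IsUnit A.det)
    {x b : Fin s → E} (h : stageMap A x = b) : x = stageMap A⁻¹ b := by
  rw [← h, ← stageMap_mul, Matrix.nonsing_inv_mul _ hA, stageMap_one]

end Algebra

variable [NormedAddCommGroup E] [NormedSpace ℝ E]

theorem norm_sum_smul_le_of_norm_le {ι : Type*} [Fintype ι] (α : ι → ℝ) (x : ι → E) {D : ℝ}
    (hx : ∀ j, ‖x j‖ ≤ D) : ‖∑ j, α j • x j‖ ≤ (∑ j, |α j|) * D := by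
  rw [Finset.sum_mul]
  refine (norm_sum_le _ _).trans (Finset.sum_le_sum fun j _ => ?_)
  rw [norm_smul, Real.norm_eq_abs]
  exact mul_le_mul_of_nonneg_left (hx j) (abs_nonneg _)

theorem norm_stageMap_le (A : Matrix (Fin s) (Fin s) ℝ) (x : Fin s → E) :
    ‖stageMap A x‖ ≤ entrySum A * ‖x‖ := by
  refine (pi_norm_le_iff_of_nonneg (mul_nonneg (entrySum_nonneg A) (norm_nonneg _))).mpr fun i => ?_
  rw [stageMap_apply]
  exact (norm_sum_smul_le_of_norm_le _ _ (norm_le_pi_norm x)).trans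
    (mul_le_mul_of_nonneg_right (sum_abs_row_le_entrySum A i) (norm_nonneg _))

end StageMap

/-- Stability of a one-step recursion with a start, a first, a repeated and a last step: if the
powers of `A⁻¹ B` are bounded, the solution is bounded by the sum of the norms of the data, with a
constant which depends neither on the number of steps nor on the space of values. -/
theorem exists_stage_recursion_bound {s : ℕ} {A₀ A A_N B₁ B B_N : Matrix (Fin s) (Fin s) ℝ}
    (hA₀ : IsUnit A₀.det) (hA : IsUnit A.det) (hA_N : IsUnit A_N.det)
    (hpow : ∃ C : ℝ, ∀ (n : ℕ) (i j : Fin s), |((A⁻¹ * B) ^ n) i j| ≤ C) :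
    ∃ S : ℝ, 0 < S ∧ ∀ (E : Type) [NormedAddCommGroup E] [NormedSpace ℝ E] (L : ℕ)
      (x g : ℕ → Fin s → E), stageMap A₀ (x 0) = g 0 →
      stageMap A (x 1) = stageMap B₁ (x 0) + g 1 →
      (∀ n, 1 ≤ n → n ≤ L → stageMap A (x (n + 1)) = stageMap B (x n) + g (n + 1)) →
      stageMap A_N (x (L + 2)) = stageMap B_N (x (L + 1)) + g (L + 2) →
      ∀ n ≤ L + 2, ‖x n‖ ≤ S * ∑ k ∈ Finset.range (L + 3), ‖g k‖ := by
  obtain ⟨C', hC'⟩ := hpow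
  set M := A⁻¹ * B with hM
  obtain ⟨C, hC0, hC⟩ : ∃ C : ℝ, 0 ≤ C ∧ ∀ n, entrySum (M ^ n) ≤ C := by
    refine ⟨∑ _i : Fin s, ∑ _j : Fin s, |C'|,
      Finset.sum_nonneg fun _ _ => Finset.sum_nonneg fun _ _ => abs_nonneg _, fun n => ?_⟩
    exact Finset.sum_le_sum fun i _ => Finset.sum_le_sum fun j _ =>
      (hC' n i j).trans (le_abs_self _)
  set a₀ := entrySum A₀⁻¹
  set a := entrySum A⁻¹
  set aN := entrySum A_N⁻¹
  set b₁ := entrySum (A⁻¹ * B₁)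
  set bN := entrySum (A_N⁻¹ * B_N)
  have ha₀ : 0 ≤ a₀ := entrySum_nonneg _
  have ha : 0 ≤ a := entrySum_nonneg _
  have haN : 0 ≤ aN := entrySum_nonneg _
  have hb₁ : 0 ≤ b₁ := entrySum_nonneg _
  have hbN : 0 ≤ bN := entrySum_nonneg _
  set c := C * (b₁ * a₀ + a) with hc
  have hc0 : 0 ≤ c := by positivity
  refine ⟨a₀ + c + (bN * c + aN) + 1, by positivity, ?_⟩
  intro E _ _ L x g h0 h1 hstep hlast
  set G : ℕ → ℝ := fun n => ∑ k ∈ Finset.range (n + 1), ‖g k‖ with hG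
  have hGs : ∀ n, G (n + 1) = G n + ‖g (n + 1)‖ := fun n => Finset.sum_range_succ _ _
  have hG0 : ∀ n, 0 ≤ G n := fun n => Finset.sum_nonneg fun _ _ => norm_nonneg _
  have hGmono : ∀ n ≤ L + 2, G n ≤ G (L + 2) := fun n hn =>
    Finset.sum_le_sum_of_subset_of_nonneg (Finset.range_mono (by omega))
      fun _ _ _ => norm_nonneg _
  have hx0 : ‖x 0‖ ≤ a₀ * ‖g 0‖ := by
    rw [eq_stageMap_inv_of_stageMap_eq hA₀ h0]
    exact norm_stageMap_le _ _
  have hpowle : ∀ (j : ℕ) (v : Fin s → E), ‖stageMap (M ^ j) v‖ ≤ C * ‖v‖ := fun j v =>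
    (norm_stageMap_le _ _).trans (mul_le_mul_of_nonneg_right (hC j) (norm_nonneg _))
  -- all images under powers of `M` are estimated at once: the recursion only raises the exponent,
  -- and the bound `C` of the powers enters once and does not accumulate
  have hmain : ∀ n, n ≤ L → ∀ j, ‖stageMap (M ^ j) (x (n + 1))‖ ≤ c * G (n + 1) := by
    intro n
    induction n with
    | zero =>
      intro _ j
      have hx1 : x 1 = stageMap (A⁻¹ * B₁) (x 0) + stageMap A⁻¹ (g 1) := by
        rw [eq_stageMap_inv_of_stageMap_eq hA h1, map_add, stageMap_mul]
      have : ‖x 1‖ ≤ b₁ * (a₀ * ‖g 0‖) + a * ‖g 1‖ := by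
        rw [hx1]
        exact (norm_add_le _ _).trans (add_le_add ((norm_stageMap_le _ _).trans
          (mul_le_mul_of_nonneg_left hx0 hb₁)) (norm_stageMap_le _ _))
      refine (hpowle j _).trans ?_
      rw [hc, mul_assoc]
      refine mul_le_mul_of_nonneg_left (this.trans ?_) hC0
      have hG1 : G (0 + 1) = ‖g 0‖ + ‖g 1‖ := by rw [hGs]; simp [hG]
      rw [hG1]
      have h2 : 0 ≤ b₁ * a₀ * ‖g 1‖ := by positivity
      have h3 : 0 ≤ a * ‖g 0‖ := by positivity
      nlinarith
    | succ n ih =>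
      intro hn j
      have hx : x (n + 1 + 1) = stageMap M (x (n + 1)) + stageMap A⁻¹ (g (n + 1 + 1)) := by
        rw [eq_stageMap_inv_of_stageMap_eq hA (hstep (n + 1) (by omega) hn), map_add, hM,
          stageMap_mul]
      rw [hx, map_add, ← stageMap_mul, ← pow_succ, hGs (n + 1), mul_add]
      refine (norm_add_le _ _).trans (add_le_add (ih (by omega) (j + 1)) ((hpowle j _).trans ?_))
      rw [hc, mul_assoc]
      refine mul_le_mul_of_nonneg_left ((norm_stageMap_le _ _).trans ?_) hC0
      exact mul_le_mul_of_nonneg_right (by linarith [mul_nonneg hb₁ ha₀]) (norm_nonneg _)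
  have hmid : ∀ n, n ≤ L → ‖x (n + 1)‖ ≤ c * G (L + 2) := by
    intro n hn
    have := hmain n hn 0
    rw [pow_zero, stageMap_one] at this
    exact this.trans (mul_le_mul_of_nonneg_left (hGmono _ (by omega)) hc0)
  have hg : ∀ n ≤ L + 2, ‖g n‖ ≤ G (L + 2) := fun n hn =>
    Finset.single_le_sum (f := fun k => ‖g k‖) (fun _ _ => norm_nonneg _)
      (Finset.mem_range.mpr (by omega))
  have hGL := hG0 (L + 2)
  have p1 : 0 ≤ a₀ * G (L + 2) := by positivity
  have p2 : 0 ≤ c * G (L + 2) := by positivity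
  have p3 : 0 ≤ (bN * c + aN) * G (L + 2) := by positivity
  intro n hn
  change ‖x n‖ ≤ _ * G (L + 2)
  rcases Nat.eq_zero_or_pos n with rfl | hpos
  · have := hx0.trans (mul_le_mul_of_nonneg_left (hg 0 (by omega)) ha₀)
    linarith
  obtain ⟨k, rfl⟩ : ∃ k, n = k + 1 := ⟨n - 1, by omega⟩
  by_cases hk : k ≤ L
  · linarith [hmid k hk]
  · obtain rfl : k = L + 1 := by omega
    have hx : x (L + 2) = stageMap (A_N⁻¹ * B_N) (x (L + 1)) + stageMap A_N⁻¹ (g (L + 2)) := by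
      rw [eq_stageMap_inv_of_stageMap_eq hA_N hlast, map_add, stageMap_mul]
    have h4 : ‖x (L + 2)‖ ≤ bN * (c * G (L + 2)) + aN * G (L + 2) := by
      rw [hx]
      exact (norm_add_le _ _).trans (add_le_add
        ((norm_stageMap_le _ _).trans (mul_le_mul_of_nonneg_left (hmid L le_rfl) hbN))
        ((norm_stageMap_le _ _).trans (mul_le_mul_of_nonneg_left (hg _ le_rfl) haN)))
    change ‖x (L + 2)‖ ≤ _
    linarith

end

noncomputable section

/-! ### Taylor expansion and residuals of linear difference formulas -/

section Taylor

variable {E : Type*} [NormedAddCommGroup E] [NormedSpace ℝ E]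

/-- One integration step of Taylor's formula: an expansion of the derivative with remainder
`M |t - t₀| ^ q` gives an expansion of the function with remainder `M |t - t₀| ^ (q + 1)`. -/
theorem norm_sub_taylor_le_of_deriv {T t₀ M : ℝ} {q : ℕ} {g g' : ℝ → E}
    (hg' : ∀ t ∈ Set.Icc 0 T, HasDerivWithinAt g (g' t) (Set.Icc 0 T) t) (ht₀ : t₀ ∈ Set.Icc 0 T)
    (hM : 0 ≤ M) {v : ℕ → E} (hv0 : v 0 = g t₀)
    (hv : ∀ t ∈ Set.Icc 0 T,
      ‖g' t - ∑ l ∈ Finset.range q, (t - t₀) ^ l • ((l : ℝ) + 1) • v (l + 1)‖ ≤ M * |t - t₀| ^ q)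
    {t : ℝ} (ht : t ∈ Set.Icc 0 T) :
    ‖g t - ∑ l ∈ Finset.range (q + 1), (t - t₀) ^ l • v l‖ ≤ M * |t - t₀| ^ (q + 1) := by
  set r : ℝ → E := fun τ => g τ - ∑ l ∈ Finset.range (q + 1), (τ - t₀) ^ l • v l with hr
  have hsub : Set.uIcc t₀ t ⊆ Set.Icc 0 T := Set.uIcc_subset_Icc ht₀ ht
  have hderiv : ∀ τ ∈ Set.uIcc t₀ t, HasDerivWithinAt r
      (g' τ - ∑ l ∈ Finset.range q, (τ - t₀) ^ l • ((l : ℝ) + 1) • v (l + 1)) (Set.uIcc t₀ t) τ := by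
    intro τ hτ
    refine ((hg' τ (hsub hτ)).mono hsub).sub (HasDerivAt.hasDerivWithinAt ?_)
    have h1 : ∀ l ∈ Finset.range (q + 1), HasDerivAt (fun τ : ℝ => (τ - t₀) ^ l • v l)
        (((l : ℝ) * (τ - t₀) ^ (l - 1)) • v l) τ := by
      intro l _
      have := (((hasDerivAt_id τ).sub_const t₀).pow l).smul_const (v l)
      simpa using this
    have h2 := HasDerivAt.fun_sum h1
    rw [Finset.sum_range_succ'] at h2
    convert h2 using 1
    simp only [Nat.cast_zero, zero_mul, zero_smul, add_zero]
    refine Finset.sum_congr rfl fun l _ => ?_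
    rw [smul_smul, Nat.add_sub_cancel, mul_comm]
    push_cast
    rfl
  have hbound : ∀ τ ∈ Set.uIcc t₀ t,
      ‖g' τ - ∑ l ∈ Finset.range q, (τ - t₀) ^ l • ((l : ℝ) + 1) • v (l + 1)‖
        ≤ M * |t - t₀| ^ q := by
    intro τ hτ
    refine (hv τ (hsub hτ)).trans (mul_le_mul_of_nonneg_left ?_ hM)
    exact pow_le_pow_left₀ (abs_nonneg _) (Set.abs_sub_left_of_mem_uIcc hτ) q
  have hmv := (convex_uIcc t₀ t).norm_image_sub_le_of_norm_hasDerivWithin_le hderiv hbound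
    Set.left_mem_uIcc Set.right_mem_uIcc
  have hr0 : r t₀ = 0 := by
    simp [hr, Finset.sum_range_succ', hv0]
  rw [hr0, sub_zero, Real.norm_eq_abs, mul_assoc, ← pow_succ] at hmv
  exact hmv

/-- A function of class `C^q` on a compact interval has Taylor expansions of order `q` about all
points of the interval, with a common constant in the remainder. -/
theorem exists_taylor_expansion {T : ℝ} (hT : 0 < T) (q : ℕ) (g : ℝ → E)
    (hg : ContDiffOn ℝ q g (Set.Icc 0 T)) :
    ∃ M : ℝ, 0 ≤ M ∧ ∀ t₀ ∈ Set.Icc 0 T, ∃ v : ℕ → E, ∀ t ∈ Set.Icc 0 T,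
      ‖g t - ∑ l ∈ Finset.range q, (t - t₀) ^ l • v l‖ ≤ M * |t - t₀| ^ q := by
  induction q generalizing g with
  | zero =>
    obtain ⟨M, hM⟩ := isCompact_Icc.exists_bound_of_continuousOn hg.continuousOn
    refine ⟨|M|, abs_nonneg _, fun t₀ _ => ⟨fun _ => 0, fun t ht => ?_⟩⟩
    simpa using (hM t ht).trans (le_abs_self M)
  | succ q ih =>
    have hu := uniqueDiffOn_Icc hT
    have hd := (contDiffOn_succ_iff_derivWithin (n := (q : WithTop ℕ∞)) hu).mp (by exact_mod_cast hg)
    obtain ⟨M, hM, h⟩ := ih _ hd.2.2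
    refine ⟨M, hM, fun t₀ ht₀ => ?_⟩
    obtain ⟨v, hv⟩ := h t₀ ht₀
    refine ⟨fun l => if l = 0 then g t₀ else (l : ℝ)⁻¹ • v (l - 1), fun t ht => ?_⟩
    refine norm_sub_taylor_le_of_deriv (fun t ht => (hd.1 t ht).hasDerivWithinAt) ht₀ hM (by simp)
      (fun τ hτ => ?_) ht
    convert! hv τ hτ using 4 with l
    have hl : (l : ℝ) + 1 ≠ 0 := by positivity
    simp [smul_smul, hl]

/-- The residual of a linear difference formula with values `α` in the points `t₀ + ξ h` and
derivatives with weights `β` in the points `t₀ + η h`: if the formula is exact for polynomials of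
degree at most `q`, the residual is `O(h ^ (q + 1))`, uniformly in the base point. -/
theorem exists_residual_bound {T : ℝ} (hT : 0 < T) (q : ℕ) (g g' : ℝ → E)
    (hg : ContDiffOn ℝ ((q + 1 : ℕ) : WithTop ℕ∞) g (Set.Icc 0 T))
    (hg' : ∀ t ∈ Set.Icc 0 T, HasDerivWithinAt g (g' t) (Set.Icc 0 T) t) :
    ∃ M : ℝ, 0 ≤ M ∧ ∀ (ι κ : Type) [Fintype ι] [Fintype κ] (α ξ : ι → ℝ) (β η : κ → ℝ),
      (∀ l ≤ q, ∑ i, α i * ξ i ^ l = ∑ k, β k * (l * η k ^ (l - 1))) →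
      ∀ t₀ ∈ Set.Icc 0 T, ∀ h : ℝ, 0 ≤ h → (∀ i, t₀ + ξ i * h ∈ Set.Icc 0 T) →
        (∀ k, t₀ + η k * h ∈ Set.Icc 0 T) →
        ‖∑ i, α i • g (t₀ + ξ i * h) - h • ∑ k, β k • g' (t₀ + η k * h)‖
          ≤ M * (∑ i, |α i| * |ξ i| ^ (q + 1) + ∑ k, |β k| * |η k| ^ q) * h ^ (q + 1) := by
  have hu := uniqueDiffOn_Icc hT
  have hd := (contDiffOn_succ_iff_derivWithin (n := (q : WithTop ℕ∞)) hu).mp (by exact_mod_cast hg)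
  have hcd : ContDiffOn ℝ q g' (Set.Icc 0 T) :=
    hd.2.2.congr fun t ht => ((hg' t ht).derivWithin (hu t ht)).symm
  obtain ⟨M, hM, hT'⟩ := exists_taylor_expansion hT q g' hcd
  refine ⟨M, hM, ?_⟩
  intro ι κ _ _ α ξ β η hexact t₀ ht₀ h hh hξ hη
  obtain ⟨v', hv'⟩ := hT' t₀ ht₀
  set v : ℕ → E := fun l => if l = 0 then g t₀ else (l : ℝ)⁻¹ • v' (l - 1) with hvdef
  have hv2 : ∀ t ∈ Set.Icc 0 T,
      ‖g' t - ∑ l ∈ Finset.range q, (t - t₀) ^ l • ((l : ℝ) + 1) • v (l + 1)‖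
        ≤ M * |t - t₀| ^ q := by
    intro τ hτ
    convert! hv' τ hτ using 4 with l
    have hl : (l : ℝ) + 1 ≠ 0 := by positivity
    simp [hvdef, smul_smul, hl]
  have hv1 : ∀ t ∈ Set.Icc 0 T,
      ‖g t - ∑ l ∈ Finset.range (q + 1), (t - t₀) ^ l • v l‖ ≤ M * |t - t₀| ^ (q + 1) :=
    fun t ht => norm_sub_taylor_le_of_deriv hg' ht₀ hM (by simp [hvdef]) hv2 ht
  have hpoly : ∑ i, α i • ∑ l ∈ Finset.range (q + 1), (t₀ + ξ i * h - t₀) ^ l • v l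
      = h • ∑ k, β k • ∑ l ∈ Finset.range q,
          (t₀ + η k * h - t₀) ^ l • ((l : ℝ) + 1) • v (l + 1) := by
    have e1 : ∑ i, α i • ∑ l ∈ Finset.range (q + 1), (t₀ + ξ i * h - t₀) ^ l • v l
        = ∑ l ∈ Finset.range (q + 1), (h ^ l * ∑ i, α i * ξ i ^ l) • v l := by
      simp only [Finset.smul_sum, Finset.mul_sum, Finset.sum_smul, smul_smul]
      rw [Finset.sum_comm]
      refine Finset.sum_congr rfl fun l _ => Finset.sum_congr rfl fun i _ => ?_
      congr 1
      ring
    have e2 : h • ∑ k, β k • ∑ l ∈ Finset.range q,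
          (t₀ + η k * h - t₀) ^ l • ((l : ℝ) + 1) • v (l + 1)
        = ∑ l ∈ Finset.range q,
          (h ^ (l + 1) * ∑ k, β k * ((l + 1 : ℕ) * η k ^ (l + 1 - 1))) • v (l + 1) := by
      simp only [Finset.smul_sum, Finset.mul_sum, Finset.sum_smul, smul_smul]
      rw [Finset.sum_comm]
      refine Finset.sum_congr rfl fun l _ => Finset.sum_congr rfl fun i _ => ?_
      congr 1
      push_cast
      ring
    rw [e1, e2, Finset.sum_range_succ', hexact 0 (Nat.zero_le _)]
    have h0 : ∑ k, β k * (((0 : ℕ) : ℝ) * η k ^ (0 - 1)) = 0 := by simp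
    rw [h0, mul_zero, zero_smul, add_zero]
    refine Finset.sum_congr rfl fun l hl => ?_
    rw [hexact (l + 1) (by have := Finset.mem_range.mp hl; omega)]
  have hsplit : ∑ i, α i • g (t₀ + ξ i * h) - h • ∑ k, β k • g' (t₀ + η k * h)
      = ∑ i, α i • (g (t₀ + ξ i * h) -
            ∑ l ∈ Finset.range (q + 1), (t₀ + ξ i * h - t₀) ^ l • v l)
        - h • ∑ k, β k • (g' (t₀ + η k * h) -
            ∑ l ∈ Finset.range q, (t₀ + η k * h - t₀) ^ l • ((l : ℝ) + 1) • v (l + 1)) := by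
    simp only [smul_sub, Finset.sum_sub_distrib]
    rw [hpoly]
    abel
  rw [hsplit]
  refine (norm_sub_le _ _).trans ?_
  have hb1 : ‖∑ i, α i • (g (t₀ + ξ i * h) -
      ∑ l ∈ Finset.range (q + 1), (t₀ + ξ i * h - t₀) ^ l • v l)‖
      ≤ M * (∑ i, |α i| * |ξ i| ^ (q + 1)) * h ^ (q + 1) := by
    refine (norm_sum_le _ _).trans ?_
    rw [Finset.mul_sum, Finset.sum_mul]
    refine Finset.sum_le_sum fun i _ => ?_
    rw [norm_smul, Real.norm_eq_abs]
    refine (mul_le_mul_of_nonneg_left (hv1 _ (hξ i)) (abs_nonneg _)).trans (le_of_eq ?_)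
    rw [add_sub_cancel_left, abs_mul, abs_of_nonneg hh]
    ring
  have hb2 : ‖h • ∑ k, β k • (g' (t₀ + η k * h) -
      ∑ l ∈ Finset.range q, (t₀ + η k * h - t₀) ^ l • ((l : ℝ) + 1) • v (l + 1))‖
      ≤ M * (∑ k, |β k| * |η k| ^ q) * h ^ (q + 1) := by
    rw [norm_smul, Real.norm_eq_abs, abs_of_nonneg hh]
    have : ‖∑ k, β k • (g' (t₀ + η k * h) -
      ∑ l ∈ Finset.range q, (t₀ + η k * h - t₀) ^ l • ((l : ℝ) + 1) • v (l + 1))‖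
      ≤ M * (∑ k, |β k| * |η k| ^ q) * h ^ q := by
      refine (norm_sum_le _ _).trans ?_
      rw [Finset.mul_sum, Finset.sum_mul]
      refine Finset.sum_le_sum fun i _ => ?_
      rw [norm_smul, Real.norm_eq_abs]
      refine (mul_le_mul_of_nonneg_left (hv2 _ (hη i)) (abs_nonneg _)).trans (le_of_eq ?_)
      rw [add_sub_cancel_left, abs_mul, abs_of_nonneg hh]
      ring
    refine (mul_le_mul_of_nonneg_left this hh).trans (le_of_eq ?_)
    ring
  refine (add_le_add hb1 hb2).trans (le_of_eq ?_)
  ring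

end Taylor

/-! ### Zeros of maps close to a linear isomorphism -/

/-- If the linear map `T` satisfies `‖x‖ ≤ ν (T x)`, and the deviation of `G` from `T` is a
contraction in this sense on a ball around `z₀`, then `G` has exactly one zero in the ball,
provided that `ν (G z₀)` is small. This is Banach's fixed point theorem for `z - T⁻¹ (G z)`. -/
theorem exists_unique_zero_of_approx_linear {X : Type*} [NormedAddCommGroup X] [NormedSpace ℝ X]
    [FiniteDimensional ℝ X] (T : X →ₗ[ℝ] X) (ν : X → ℝ) (hν0 : ν 0 ≤ 0) (hν : ∀ x, ‖x‖ ≤ ν (T x))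
    (G : X → X) (z₀ : X) (δ : ℝ)
    (hG : ∀ z z', ‖z - z₀‖ ≤ δ → ‖z' - z₀‖ ≤ δ → ν (G z - G z' - T (z - z')) ≤ ‖z - z'‖ / 2)
    (h₀ : ν (G z₀) ≤ δ / 2) :
    ∃ z, ‖z - z₀‖ ≤ δ ∧ ‖z - z₀‖ ≤ 2 * ν (G z₀) ∧ G z = 0 ∧
      ∀ z', ‖z' - z₀‖ ≤ δ → G z' = 0 → z' = z := by
  have hinj : Function.Injective T := by
    rw [injective_iff_map_eq_zero]
    intro x hx
    have := hν x
    rw [hx] at this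
    exact norm_le_zero_iff.mp (this.trans hν0)
  let e : X ≃ₗ[ℝ] X := LinearEquiv.ofInjectiveEndo T hinj
  have he : ∀ x, T (e.symm x) = x := fun x => by
    have := e.apply_symm_apply x
    rwa [LinearEquiv.coe_ofInjectiveEndo] at this
  have hes : ∀ x, e.symm (T x) = x := fun x => hinj (he _)
  have hsymm : ∀ x, ‖e.symm x‖ ≤ ν x := fun x => by
    have := hν (e.symm x)
    rwa [he] at this
  let Φ : X → X := fun z => z - e.symm (G z)
  have hΦ : ∀ z z', ‖z - z₀‖ ≤ δ → ‖z' - z₀‖ ≤ δ → ‖Φ z - Φ z'‖ ≤ ‖z - z'‖ / 2 := by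
    intro z z' hz hz'
    have : Φ z - Φ z' = -(e.symm (G z - G z' - T (z - z'))) := by
      rw [map_sub, map_sub, hes]
      simp only [Φ]
      abel
    rw [this, norm_neg]
    exact (hsymm _).trans (hG z z' hz hz')
  have hΦ0 : ‖Φ z₀ - z₀‖ ≤ ν (G z₀) := by
    have : Φ z₀ - z₀ = -(e.symm (G z₀)) := by simp only [Φ]; abel
    rw [this, norm_neg]
    exact hsymm _
  have hδ : 0 ≤ δ := by linarith [norm_nonneg (Φ z₀ - z₀)]
  have hz₀ : ‖z₀ - z₀‖ ≤ δ := by simpa using hδ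
  have hmaps : Set.MapsTo Φ (Metric.closedBall z₀ δ) (Metric.closedBall z₀ δ) := by
    intro z hz
    rw [mem_closedBall_iff_norm] at hz ⊢
    have h1 := hΦ z z₀ hz hz₀
    have : Φ z - z₀ = (Φ z - Φ z₀) + (Φ z₀ - z₀) := by abel
    rw [this]
    refine (norm_add_le _ _).trans ?_
    linarith
  have hcontr : ContractingWith (1 / 2) (hmaps.restrict Φ _ _) := by
    refine ⟨by norm_num, LipschitzWith.of_dist_le_mul ?_⟩
    rintro ⟨z, hz⟩ ⟨z', hz'⟩
    rw [mem_closedBall_iff_norm] at hz hz'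
    have := hΦ z z' hz hz'
    simp only [Subtype.dist_eq, Set.MapsTo.val_restrict_apply, dist_eq_norm]
    refine this.trans (le_of_eq ?_)
    push_cast
    ring
  obtain ⟨z, hz, hfix, -, -⟩ := hcontr.exists_fixedPoint'
    (Metric.isClosed_closedBall.isComplete) hmaps (x := z₀) (Metric.mem_closedBall_self hδ)
    (edist_ne_top _ _)
  have hGz : G z = 0 := by
    have : e.symm (G z) = 0 := by
      have h1 : z - e.symm (G z) = z := hfix
      simpa using h1
    simpa using this
  rw [mem_closedBall_iff_norm] at hz
  refine ⟨z, hz, ?_, hGz, ?_⟩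
  · have h1 := hΦ z z₀ hz hz₀
    rw [show Φ z = z from hfix] at h1
    have : z - z₀ = (z - Φ z₀) + (Φ z₀ - z₀) := by abel
    have h2 := norm_add_le (z - Φ z₀) (Φ z₀ - z₀)
    rw [← this] at h2
    linarith
  · intro z' hz' hGz'
    have h1 := hΦ z' z hz' hz
    have h2 : Φ z' = z' := by simp [Φ, hGz']
    have h3 : Φ z = z := hfix
    rw [h2, h3] at h1
    have : ‖z' - z‖ ≤ 0 := by linarith [norm_nonneg (z' - z)]
    exact sub_eq_zero.mp (norm_le_zero_iff.mp this)

end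

noncomputable section

/-! ### Local estimates for the right-hand side -/

section AdjointEval

variable {V W Z : Type*} [NormedAddCommGroup V] [InnerProductSpace ℝ V] [CompleteSpace V]
  [NormedAddCommGroup W] [InnerProductSpace ℝ W] [CompleteSpace W]
  [NormedAddCommGroup Z] [NormedSpace ℝ Z]

/-- The bilinear map `(L, p) ↦ (L ∘ i)ᵀ p`. -/
def adjointEval (i : W →L[ℝ] Z) : (Z →L[ℝ] V) →L[ℝ] V →L[ℝ] W :=
  LinearMap.mkContinuous₂
    (LinearMap.mk₂ ℝ (fun (L : Z →L[ℝ] V) (p : V) => ContinuousLinearMap.adjoint (L.comp i) p)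
      (fun L L' p => by simp [ContinuousLinearMap.add_comp])
      (fun c L p => by simp [ContinuousLinearMap.smul_comp])
      (fun L p p' => by simp) (fun c L p => by simp))
    ‖i‖ (fun L p => by
      simp only [LinearMap.mk₂_apply]
      refine ((ContinuousLinearMap.adjoint (L.comp i)).le_opNorm p).trans ?_
      rw [LinearIsometryEquiv.norm_map]
      refine mul_le_mul_of_nonneg_right ((ContinuousLinearMap.opNorm_comp_le L i).trans ?_)
        (norm_nonneg _)
      rw [mul_comm])

theorem adjointEval_apply (i : W →L[ℝ] Z) (L : Z →L[ℝ] V) (p : V) :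
    adjointEval i L p = ContinuousLinearMap.adjoint (L.comp i) p := rfl

theorem norm_adjointEval_le (i : W →L[ℝ] Z) (hi : ‖i‖ ≤ 1) (L : Z →L[ℝ] V) (p : V) :
    ‖adjointEval i L p‖ ≤ ‖L‖ * ‖p‖ := by
  rw [adjointEval_apply]
  refine ((ContinuousLinearMap.adjoint (L.comp i)).le_opNorm p).trans ?_
  rw [LinearIsometryEquiv.norm_map]
  refine mul_le_mul_of_nonneg_right ((ContinuousLinearMap.opNorm_comp_le L i).trans ?_)
    (norm_nonneg _)
  exact mul_le_of_le_one_right (norm_nonneg _) hi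

end AdjointEval

section Tube

variable {V W Z : Type*} [NormedAddCommGroup V] [NormedSpace ℝ V]
  [NormedAddCommGroup W] [NormedSpace ℝ W] [NormedAddCommGroup Z] [NormedSpace ℝ Z]

/-- The derivative with respect to `z` of `Ψ (f' z) p`, where `Ψ` is a bilinear map of the
derivative `f' z` and a multiplier `p`. With `Ψ (L, p) = (L ∘ i)ᵀ p` for the injection `i` of the
control space this is `∇_z (∇_u f(z)ᵀ p)`. -/
def derivPairing (Ψ : (Z →L[ℝ] V) →L[ℝ] V →L[ℝ] W) (f : Z → V) (p : V) (z : Z) : Z →L[ℝ] W :=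
  fderiv ℝ (fun z => Ψ (fderiv ℝ f z) p) z

/-- The smoothness bounds in the tube of radius `ρ` around a single point `(zs, ps)`. -/
def PointSmoothness (Ψ : (Z →L[ℝ] V) →L[ℝ] V →L[ℝ] W) (f : Z → V) (zs : Z) (ps : V)
    (ρ Λ₁ Λ₂ Λ₃ : ℝ) : Prop :=
  ∀ (z : Z) (p : V), ‖z - zs‖ ≤ ρ → ‖p - ps‖ ≤ ρ →
    ContDiffAt ℝ 2 f z ∧ DifferentiableAt ℝ (derivPairing Ψ f p) z ∧ ‖fderiv ℝ f z‖ ≤ Λ₁ ∧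
    (1 + ‖p‖) * ‖fderiv ℝ (fderiv ℝ f) z‖ ≤ Λ₂ ∧ ‖fderiv ℝ (derivPairing Ψ f p) z‖ ≤ Λ₃

theorem differentiableAt_fderiv_of_contDiffAt_two {f : Z → V} {z : Z}
    (h : ContDiffAt ℝ 2 f z) : DifferentiableAt ℝ (fderiv ℝ f) z :=
  (h.fderiv_right (m := 1) (by norm_num)).differentiableAt (by norm_num)

variable {Ψ : (Z →L[ℝ] V) →L[ℝ] V →L[ℝ] W} {f : Z → V} {zs : Z} {ps : V} {ρ R Λ₁ Λ₂ Λ₃ : ℝ}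

theorem hasFDerivAt_pairing (Ψ : (Z →L[ℝ] V) →L[ℝ] V →L[ℝ] W) {f : Z → V} {z : Z}
    (h : ContDiffAt ℝ 2 f z) (p : V) :
    HasFDerivAt (fun z => Ψ (fderiv ℝ f z) p) ((Ψ.flip p).comp (fderiv ℝ (fderiv ℝ f) z)) z :=
  (Ψ.flip p).hasFDerivAt.comp z (differentiableAt_fderiv_of_contDiffAt_two h).hasFDerivAt

theorem norm_derivPairing_le (hΨ : ∀ L p, ‖Ψ L p‖ ≤ ‖L‖ * ‖p‖) {z : Z}
    (h : ContDiffAt ℝ 2 f z) (p : V) :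
    ‖derivPairing Ψ f p z‖ ≤ ‖p‖ * ‖fderiv ℝ (fderiv ℝ f) z‖ := by
  rw [derivPairing, (hasFDerivAt_pairing Ψ h p).fderiv]
  refine (ContinuousLinearMap.opNorm_comp_le _ _).trans
    (mul_le_mul_of_nonneg_right ?_ (norm_nonneg _))
  refine ContinuousLinearMap.opNorm_le_bound _ (norm_nonneg _) fun L => ?_
  rw [ContinuousLinearMap.flip_apply, mul_comm]
  exact hΨ _ _

theorem derivPairing_sub {z : Z} (h : ContDiffAt ℝ 2 f z) (p p' : V) :
    derivPairing Ψ f p z - derivPairing Ψ f p' z = derivPairing Ψ f (p - p') z := by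
  rw [derivPairing, derivPairing, derivPairing, (hasFDerivAt_pairing Ψ h _).fderiv,
    (hasFDerivAt_pairing Ψ h _).fderiv, (hasFDerivAt_pairing Ψ h _).fderiv,
    ← ContinuousLinearMap.sub_comp, ← map_sub]

namespace PointSmoothness

theorem norm_fderiv_fderiv_le (h : PointSmoothness Ψ f zs ps ρ Λ₁ Λ₂ Λ₃) {z : Z}
    {p : V} (hz : ‖z - zs‖ ≤ ρ) (hp : ‖p - ps‖ ≤ ρ) :
    ‖fderiv ℝ (fderiv ℝ f) z‖ ≤ Λ₂ ∧ ‖p‖ * ‖fderiv ℝ (fderiv ℝ f) z‖ ≤ Λ₂ := by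
  obtain ⟨-, -, -, h4, -⟩ := h z p hz hp
  have h1 := norm_nonneg (fderiv ℝ (fderiv ℝ f) z)
  have h2 := mul_nonneg (norm_nonneg p) h1
  constructor <;> nlinarith

theorem nonneg (h : PointSmoothness Ψ f zs ps ρ Λ₁ Λ₂ Λ₃) (hρ : 0 ≤ ρ) :
    0 ≤ Λ₁ ∧ 0 ≤ Λ₂ ∧ 0 ≤ Λ₃ := by
  have hz : ‖zs - zs‖ ≤ ρ := by simpa using hρ
  have hp : ‖ps - ps‖ ≤ ρ := by simpa using hρ
  obtain ⟨-, -, h3, -, h5⟩ := h zs ps hz hp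
  exact ⟨(norm_nonneg _).trans h3, (norm_nonneg (fderiv ℝ (fderiv ℝ f) zs)).trans (h.norm_fderiv_fderiv_le hz hp).1,
    (norm_nonneg (fderiv ℝ (derivPairing Ψ f ps) zs)).trans h5⟩

theorem norm_map_sub_le (h : PointSmoothness Ψ f zs ps ρ Λ₁ Λ₂ Λ₃) (hρ : 0 ≤ ρ)
    {z z' : Z} (hz : ‖z - zs‖ ≤ ρ) (hz' : ‖z' - zs‖ ≤ ρ) :
    ‖f z - f z'‖ ≤ Λ₁ * ‖z - z'‖ := by
  have hp : ‖ps - ps‖ ≤ ρ := by simpa using hρ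
  refine (convex_closedBall zs ρ).norm_image_sub_le_of_norm_fderiv_le (𝕜 := ℝ)
    (fun x hx => ?_) (fun x hx => ?_) (mem_closedBall_iff_norm.mpr hz')
    (mem_closedBall_iff_norm.mpr hz)
  · exact (h x ps (mem_closedBall_iff_norm.mp hx) hp).1.differentiableAt (by norm_num)
  · exact (h x ps (mem_closedBall_iff_norm.mp hx) hp).2.2.1

theorem norm_fderiv_sub_mul_le (h : PointSmoothness Ψ f zs ps ρ Λ₁ Λ₂ Λ₃) (hρ : 0 ≤ ρ)
    {z z' : Z} (hz : ‖z - zs‖ ≤ ρ) (hz' : ‖z' - zs‖ ≤ ρ) :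
    ‖fderiv ℝ f z - fderiv ℝ f z'‖ ≤ Λ₂ * ‖z - z'‖ ∧
    ∀ p : V, ‖p - ps‖ ≤ ρ → ‖fderiv ℝ f z - fderiv ℝ f z'‖ * ‖p‖ ≤ Λ₂ * ‖z - z'‖ := by
  have aux : ∀ p : V, ‖p - ps‖ ≤ ρ →
      (1 + ‖p‖) * ‖fderiv ℝ f z - fderiv ℝ f z'‖ ≤ Λ₂ * ‖z - z'‖ := by
    intro p hp
    have hpos : 0 < 1 + ‖p‖ := by positivity
    have key : ‖fderiv ℝ f z - fderiv ℝ f z'‖ ≤ Λ₂ / (1 + ‖p‖) * ‖z - z'‖ := by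
      refine (convex_closedBall zs ρ).norm_image_sub_le_of_norm_fderiv_le (𝕜 := ℝ)
        (fun x hx => ?_) (fun x hx => ?_) (mem_closedBall_iff_norm.mpr hz')
        (mem_closedBall_iff_norm.mpr hz)
      · exact differentiableAt_fderiv_of_contDiffAt_two (h x p (mem_closedBall_iff_norm.mp hx) hp).1
      · rw [le_div_iff₀ hpos, mul_comm]
        exact (h x p (mem_closedBall_iff_norm.mp hx) hp).2.2.2.1
    have h1 := mul_le_mul_of_nonneg_left key hpos.le
    rwa [← mul_assoc, mul_div_cancel₀ _ hpos.ne'] at h1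
  have hn := norm_nonneg (fderiv ℝ f z - fderiv ℝ f z')
  refine ⟨?_, fun p hp => ?_⟩
  · have := aux ps (by simpa using hρ)
    nlinarith [mul_nonneg (norm_nonneg ps) hn]
  · have := aux p hp
    nlinarith

/-- The increments of `Ψ' (f' z) p`, for any bilinear map `Ψ'` of norm at most one. The growth
factor in `(1 + ‖z‖) ‖∇_zz f‖ ≤ Λ₂` absorbs the size of the multiplier. -/
theorem norm_pairing_sub_le {W' : Type*} [NormedAddCommGroup W'] [NormedSpace ℝ W']
    {Ψ' : (Z →L[ℝ] V) →L[ℝ] V →L[ℝ] W'} (hΨ' : ∀ L p, ‖Ψ' L p‖ ≤ ‖L‖ * ‖p‖)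
    (h : PointSmoothness Ψ f zs ps ρ Λ₁ Λ₂ Λ₃) (hρ : 0 ≤ ρ)
    {z z' : Z} {p p' : V} (hz : ‖z - zs‖ ≤ ρ) (hz' : ‖z' - zs‖ ≤ ρ) (hp' : ‖p' - ps‖ ≤ ρ) :
    ‖Ψ' (fderiv ℝ f z) p - Ψ' (fderiv ℝ f z') p'‖ ≤ Λ₁ * ‖p - p'‖ + Λ₂ * ‖z - z'‖ := by
  have e : Ψ' (fderiv ℝ f z) p - Ψ' (fderiv ℝ f z') p' = Ψ' (fderiv ℝ f z) (p - p')
      + Ψ' (fderiv ℝ f z - fderiv ℝ f z') p' := by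
    rw [map_sub, map_sub, sub_apply]
    abel
  rw [e]
  refine (norm_add_le _ _).trans (add_le_add ?_ ?_)
  · exact (hΨ' _ _).trans (mul_le_mul_of_nonneg_right (h z p' hz hp').2.2.1 (norm_nonneg _))
  · exact (hΨ' _ _).trans ((h.norm_fderiv_sub_mul_le hρ hz hz').2 p' hp')

/-- In a tube of radius `R` the map `(z, p) ↦ Ψ (f' z) p` differs from its linearization at the
centre by a map with a Lipschitz constant proportional to `R`. -/
theorem norm_pairing_sub_linearization_le (hΨ : ∀ L p, ‖Ψ L p‖ ≤ ‖L‖ * ‖p‖)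
    (h : PointSmoothness Ψ f zs ps ρ Λ₁ Λ₂ Λ₃) (hR : 0 ≤ R)
    (hRρ : R ≤ ρ) {z z' : Z} {p p' : V} (hz : ‖z - zs‖ ≤ R) (hz' : ‖z' - zs‖ ≤ R)
    (hp' : ‖p' - ps‖ ≤ R) :
    ‖Ψ (fderiv ℝ f z) p - Ψ (fderiv ℝ f z') p'
        - (Ψ (fderiv ℝ f zs) (p - p') + derivPairing Ψ f ps zs (z - z'))‖
      ≤ (Λ₂ + Λ₃) * R * ‖z - z'‖ + Λ₂ * R * ‖p - p'‖ := by
  have hρ : 0 ≤ ρ := hR.trans hRρ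
  have hzs : ‖zs - zs‖ ≤ R := by simpa using hR
  have e : Ψ (fderiv ℝ f z) p - Ψ (fderiv ℝ f z') p'
        - (Ψ (fderiv ℝ f zs) (p - p') + derivPairing Ψ f ps zs (z - z'))
      = (Ψ (fderiv ℝ f z) p' - Ψ (fderiv ℝ f z') p' - derivPairing Ψ f ps zs (z - z'))
      + Ψ (fderiv ℝ f z - fderiv ℝ f zs) (p - p') := by
    rw [map_sub Ψ, sub_apply, map_sub (Ψ (fderiv ℝ f z))]
    abel
  rw [e]
  refine (norm_add_le _ _).trans (add_le_add ?_ ?_)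
  · refine (convex_closedBall zs R).norm_image_sub_le_of_norm_fderiv_le' (𝕜 := ℝ)
      (f := fun z => Ψ (fderiv ℝ f z) p') (fun x hx => ?_) (fun x hx => ?_)
      (mem_closedBall_iff_norm.mpr hz') (mem_closedBall_iff_norm.mpr hz)
    · have hx' := (mem_closedBall_iff_norm.mp hx).trans hRρ
      exact (hasFDerivAt_pairing Ψ (h x p' hx' (hp'.trans hRρ)).1 p').differentiableAt
    · rw [mem_closedBall_iff_norm] at hx
      have h1 : ‖derivPairing Ψ f p' x - derivPairing Ψ f p' zs‖ ≤ Λ₃ * ‖x - zs‖ := by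
        refine (convex_closedBall zs R).norm_image_sub_le_of_norm_fderiv_le (𝕜 := ℝ)
          (fun w hw => ?_) (fun w hw => ?_) (mem_closedBall_iff_norm.mpr hzs)
          (mem_closedBall_iff_norm.mpr hx)
        · exact (h w p' ((mem_closedBall_iff_norm.mp hw).trans hRρ) (hp'.trans hRρ)).2.1
        · exact (h w p' ((mem_closedBall_iff_norm.mp hw).trans hRρ) (hp'.trans hRρ)).2.2.2.2
      have hc := (h zs p' (hzs.trans hRρ) (hp'.trans hRρ)).1
      have h2 : ‖derivPairing Ψ f p' zs - derivPairing Ψ f ps zs‖ ≤ Λ₂ * R := by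
        rw [derivPairing_sub hc]
        refine (norm_derivPairing_le hΨ hc _).trans ?_
        rw [mul_comm]
        exact mul_le_mul (h.norm_fderiv_fderiv_le (hzs.trans hRρ) (hp'.trans hRρ)).1 hp'
          (norm_nonneg _) (h.nonneg hρ).2.1
      have e2 : fderiv ℝ (fun z => Ψ (fderiv ℝ f z) p') x - derivPairing Ψ f ps zs
          = (derivPairing Ψ f p' x - derivPairing Ψ f p' zs)
            + (derivPairing Ψ f p' zs - derivPairing Ψ f ps zs) := by
        simp only [derivPairing]
        abel
      rw [e2]
      have h3 : Λ₃ * ‖x - zs‖ ≤ Λ₃ * R := mul_le_mul_of_nonneg_left hx (h.nonneg hρ).2.2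
      refine (norm_add_le _ _).trans ?_
      linarith
  · refine (hΨ _ _).trans (mul_le_mul_of_nonneg_right ?_ (norm_nonneg _))
    exact (h.norm_fderiv_sub_mul_le hρ (hz.trans hRρ) (hzs.trans hRρ)).1.trans
      (mul_le_mul_of_nonneg_left hz (h.nonneg hρ).2.1)

theorem norm_derivPairing_self_le (hΨ : ∀ L p, ‖Ψ L p‖ ≤ ‖L‖ * ‖p‖)
    (h : PointSmoothness Ψ f zs ps ρ Λ₁ Λ₂ Λ₃) (hρ : 0 ≤ ρ) : ‖derivPairing Ψ f ps zs‖ ≤ Λ₂ := by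
  have hz : ‖zs - zs‖ ≤ ρ := by simpa using hρ
  have hp : ‖ps - ps‖ ≤ ρ := by simpa using hρ
  exact (norm_derivPairing_le hΨ (h zs ps hz hp).1 ps).trans (h.norm_fderiv_fderiv_le hz hp).2

end PointSmoothness

end Tube

/-! ### Gradients of quadratic polynomials -/

section Quadratic

variable {m : ℕ}

/-- A function of the form `b(y, y) + ℓ(y) + c` with a bilinear form `b`. -/
def IsBilinearQuadratic (C : Vec m → ℝ) : Prop :=
  ∃ (b : Vec m →L[ℝ] Vec m →L[ℝ] ℝ) (l : Vec m →L[ℝ] ℝ) (c : ℝ), ∀ y, C y = b y y + l y + c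

theorem IsBilinearQuadratic.sum {ι : Type*} (t : Finset ι) (g : ι → Vec m → ℝ)
    (hg : ∀ i ∈ t, IsBilinearQuadratic (g i)) : IsBilinearQuadratic fun y => ∑ i ∈ t, g i y := by
  classical
  induction t using Finset.induction_on with
  | empty => exact ⟨0, 0, 0, fun y => by simp⟩
  | insert a t ha ih =>
    obtain ⟨b, l, c, h⟩ := hg a (Finset.mem_insert_self a t)
    obtain ⟨b', l', c', h'⟩ := ih fun i hi => hg i (Finset.mem_insert_of_mem hi)
    refine ⟨b + b', l + l', c + c', fun y => ?_⟩
    have h'' : ∑ i ∈ t, g i y = b' y y + l' y + c' := h' y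
    simp only [Finset.sum_insert ha, h, h'', add_apply]
    ring

theorem Finsupp.degree_le_two_cases {σ : Type*} (k : σ →₀ ℕ) (hk : k.degree ≤ 2) :
    k = 0 ∨ (∃ i, k = Finsupp.single i 1) ∨
      ∃ i j, k = Finsupp.single i 1 + Finsupp.single j 1 := by
  classical
  have step : ∀ k : σ →₀ ℕ, k ≠ 0 → ∃ i k', k = Finsupp.single i 1 + k' := by
    intro k hk
    obtain ⟨i, hi⟩ := Finsupp.ne_iff.mp hk
    refine ⟨i, k - Finsupp.single i 1, (add_tsub_cancel_of_le ?_).symm⟩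
    rw [Finsupp.single_le_iff]
    exact Nat.one_le_iff_ne_zero.mpr hi
  by_cases h0 : k = 0
  · exact Or.inl h0
  obtain ⟨i, k', rfl⟩ := step k h0
  by_cases h1 : k' = 0
  · exact Or.inr (Or.inl ⟨i, by rw [h1, add_zero]⟩)
  obtain ⟨j, k'', rfl⟩ := step k' h1
  have h2 : k'' = 0 := by
    rw [map_add, map_add, Finsupp.degree_single, Finsupp.degree_single] at hk
    rw [← Finsupp.degree_eq_zero_iff]
    omega
  exact Or.inr (Or.inr ⟨i, j, by rw [h2, add_zero]⟩)

theorem IsQuadraticPoly.isBilinearQuadratic {C : Vec m → ℝ} (hC : IsQuadraticPoly C) :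
    IsBilinearQuadratic C := by
  obtain ⟨Q, hQ, hC⟩ := hC
  have e : C = fun y => ∑ k ∈ Q.support, Q.coeff k * k.prod fun i n => (y i) ^ n := by
    funext y
    rw [hC y, MvPolynomial.eval_eq']
    refine Finset.sum_congr rfl fun k _ => ?_
    rw [Finsupp.prod_fintype _ _ (by simp)]
  rw [e]
  refine IsBilinearQuadratic.sum _ _ fun k hk => ?_
  have hdeg : k.degree ≤ 2 := by
    have := MvPolynomial.le_totalDegree hk
    rw [Finsupp.degree_eq_sum]
    rw [Finsupp.sum_fintype _ _ (by simp)] at this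
    exact this.trans hQ
  let π : Fin m → Vec m →L[ℝ] ℝ := fun i => EuclideanSpace.proj i
  rcases Finsupp.degree_le_two_cases k hdeg with rfl | ⟨i, rfl⟩ | ⟨i, j, rfl⟩
  · exact ⟨0, 0, Q.coeff 0, fun y => by simp⟩
  · exact ⟨0, Q.coeff (Finsupp.single i 1) • π i, 0, fun y => by simp [π]⟩
  · refine ⟨Q.coeff (Finsupp.single i 1 + Finsupp.single j 1) • (π i).smulRight (π j), 0, 0,
      fun y => ?_⟩
    have hp : ((Finsupp.single i 1 + Finsupp.single j 1 : Fin m →₀ ℕ).prod fun i n => y i ^ n)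
        = y i * y j := by
      rw [Finsupp.prod_add_index' (by simp) (fun _ _ _ => pow_add _ _ _)]
      simp
    simp only [hp]
    simp [π]

/-- The gradient of a polynomial of degree at most two is affine, with the derivative of the
gradient as its linear part. -/
theorem IsQuadraticPoly.gradient_sub {C : Vec m → ℝ} (hC : IsQuadraticPoly C) (y₀ y y' : Vec m) :
    gradient C y - gradient C y' = fderiv ℝ (gradient C) y₀ (y - y') := by
  obtain ⟨b, l, c, h⟩ := hC.isBilinearQuadratic
  have hder : ∀ y, HasFDerivAt C ((b + b.flip) y + l) y := by
    intro y
    have hCe : C = fun y => b y y + l y + c := funext h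
    rw [hCe]
    have h1 : HasFDerivAt (fun y => b y y) ((b + b.flip) y) y := by
      have := b.hasFDerivAt (x := y) |>.clm_apply (hasFDerivAt_id y)
      convert! this using 1
    exact (h1.add l.hasFDerivAt).add_const c
  let D : (Vec m →L[ℝ] ℝ) →L[ℝ] Vec m := LinearMap.toContinuousLinearMap
    { toFun := (InnerProductSpace.toDual ℝ (Vec m)).symm
      map_add' := fun x y => map_add _ x y
      map_smul' := fun c x => by
        rw [map_smulₛₗ]
        simp }
  have hgrad : gradient C = fun y => D ((b + b.flip) y) + D l := by
    funext y
    rw [← map_add, ← (hder y).fderiv]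
    rfl
  have hfd : fderiv ℝ (gradient C) y₀ = D.comp (b + b.flip) := by
    rw [hgrad]
    exact ((D.comp (b + b.flip)).hasFDerivAt.add_const (D l)).fderiv
  rw [hfd, hgrad, map_sub, add_sub_add_right_eq_sub]
  rfl

end Quadratic

end

noncomputable section

/-! ### The local estimates for the control problem -/

/-- What the convergence proof uses of the right-hand side `f` near a point `(zs, ps)` of the
solution curve, `zs = (y, u)`: `gY` and `gU` are the transposed partial derivatives, and `D` is the
derivative of `gU(z) ps` with respect to `z` at `zs`. The Lipschitz constant `η` of the control
equation minus its linearization becomes small with the radius `R`. -/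
structure LocalEstimates {V W : Type*} [NormedAddCommGroup V] [NormedSpace ℝ V]
    [NormedAddCommGroup W] [NormedSpace ℝ W] (f : V × W → V) (gY : V × W → V →L[ℝ] V)
    (gU : V × W → V →L[ℝ] W) (zs : V × W) (ps : V) (D : V × W →L[ℝ] W) (R Λ₁ Λ₂ η ω : ℝ) :
    Prop where
  map_sub_le : ∀ z z', ‖z - zs‖ ≤ R → ‖z' - zs‖ ≤ R → ‖f z - f z'‖ ≤ Λ₁ * ‖z - z'‖
  gY_sub_le : ∀ z z' p p', ‖z - zs‖ ≤ R → ‖z' - zs‖ ≤ R → ‖p' - ps‖ ≤ R →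
    ‖gY z p - gY z' p'‖ ≤ Λ₁ * ‖p - p'‖ + Λ₂ * ‖z - z'‖
  gU_sub_le : ∀ z z' p p', ‖z - zs‖ ≤ R → ‖z' - zs‖ ≤ R → ‖p' - ps‖ ≤ R →
    ‖gU z p - gU z' p' - (gU zs (p - p') + D (z - z'))‖ ≤ η * (‖z - z'‖ + ‖p - p'‖)
  gU_le : ∀ p, ‖gU zs p‖ ≤ Λ₁ * ‖p‖
  D_fst_le : ∀ y, ‖D (y, 0)‖ ≤ Λ₂ * ‖y‖
  D_snd_ge : ∀ u, ‖u‖ ≤ ω * ‖D (0, u)‖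

section

variable {m d : ℕ} {f : Vec m × Vec d → Vec m} {T' : ℝ} {y p : ℝ → Vec m} {u : ℝ → Vec d}
  {ρ R ε ω Λ₁ Λ₂ Λ₃ : ℝ}

theorem derivPairing_eq_fderiv_gradUT (f : Vec m × Vec d → Vec m) (p : Vec m) :
    derivPairing (adjointEval (ContinuousLinearMap.inr ℝ (Vec m) (Vec d))) f p
      = fderiv ℝ (fun z => gradUT f z p) := rfl

theorem norm_adjointEval_inr_le (L : (Vec m × Vec d) →L[ℝ] Vec m) (p : Vec m) :
    ‖adjointEval (ContinuousLinearMap.inr ℝ (Vec m) (Vec d)) L p‖ ≤ ‖L‖ * ‖p‖ := by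
  have h : ‖ContinuousLinearMap.inr ℝ (Vec m) (Vec d)‖ ≤ 1 :=
    ContinuousLinearMap.norm_inr_le_one ℝ (Vec m) (Vec d)
  exact norm_adjointEval_le _ h L p

theorem norm_adjointEval_inl_le (L : (Vec m × Vec d) →L[ℝ] Vec m) (p : Vec m) :
    ‖adjointEval (ContinuousLinearMap.inl ℝ (Vec m) (Vec d)) L p‖ ≤ ‖L‖ * ‖p‖ := by
  have h : ‖ContinuousLinearMap.inl ℝ (Vec m) (Vec d)‖ ≤ 1 :=
    ContinuousLinearMap.norm_inl_le_one ℝ (Vec m) (Vec d)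
  exact norm_adjointEval_le _ h L p

theorem differentiableAt_fderiv_gradUT {z : Vec m × Vec d} (h : ContDiffAt ℝ 2 (gradU f) z)
    (p : Vec m) : DifferentiableAt ℝ (fderiv ℝ (fun z => gradUT f z p)) z := by
  have h1 : ContDiffAt ℝ 2
      (fun z => (adjointEval (ContinuousLinearMap.id ℝ (Vec d))).flip p (gradU f z)) z :=
    ((adjointEval (V := Vec m) (ContinuousLinearMap.id ℝ (Vec d))).flip p).contDiff.contDiffAt.comp
      z h
  exact differentiableAt_fderiv_of_contDiffAt_two h1

theorem SmoothnessBounds.pointSmoothness (h : SmoothnessBounds f T' y p u ρ Λ₁ Λ₂ Λ₃) {t : ℝ}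
    (ht : t ∈ Set.Icc 0 T') :
    PointSmoothness (adjointEval (ContinuousLinearMap.inr ℝ (Vec m) (Vec d))) f (y t, u t) (p t)
      ρ Λ₁ Λ₂ Λ₃ := by
  rintro ⟨y', u'⟩ p' hz hp
  have hy : ‖y' - y t‖ ≤ ρ := (norm_fst_le _).trans hz
  have hu : ‖u' - u t‖ ≤ ρ := (norm_snd_le _).trans hz
  obtain ⟨h1, h2, h3, h4, h5⟩ := h t ht y' p' u' hy hp hu
  have hpn : ‖p'‖ ≤ ‖(y', p', u')‖ :=
    (norm_fst_le (p', u')).trans (norm_snd_le (y', p', u'))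
  rw [derivPairing_eq_fderiv_gradUT]
  refine ⟨h1, differentiableAt_fderiv_gradUT h2 p', h3, ?_, h5⟩
  refine le_trans ?_ h4
  gcongr

theorem hessU_eq_fderiv_gradUT {z : Vec m × Vec d} (h : ContDiffAt ℝ 2 f z) (p : Vec m)
    (v : Vec d) : hessU f p z.1 z.2 v = fderiv ℝ (fun z => gradUT f z p) z (0, v) := by
  have h1 : HasFDerivAt (fun v : Vec d => (z.1, v))
      (ContinuousLinearMap.inr ℝ (Vec m) (Vec d)) z.2 := hasFDerivAt_prodMk_right z.1 z.2
  have h0 : DifferentiableAt ℝ (fun z => gradUT f z p) z :=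
    (hasFDerivAt_pairing (adjointEval (ContinuousLinearMap.inr ℝ (Vec m) (Vec d))) h
      p).differentiableAt
  have h2 : HasFDerivAt (fun v => gradUT f (z.1, v) p)
      ((fderiv ℝ (fun z => gradUT f z p) z).comp (ContinuousLinearMap.inr ℝ (Vec m) (Vec d))) z.2 :=
    HasFDerivAt.comp (g := fun z => gradUT f z p) z.2 h0.hasFDerivAt h1
  rw [hessU, h2.fderiv]
  rfl

/-- The smoothness bounds and the bound for the inverse control Hessian give the local estimates
along the solution curve. -/
theorem localEstimates (hS : SmoothnessBounds f T' y p u ρ Λ₁ Λ₂ Λ₃)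
    (hH : ControlHessianBound f T' y p u ε ω) (hε : 0 ≤ ε) (hR : 0 ≤ R) (hRρ : R ≤ ρ) {t : ℝ}
    (ht : t ∈ Set.Icc 0 T') :
    LocalEstimates f (fun z => ContinuousLinearMap.adjoint (gradY f z))
      (fun z => ContinuousLinearMap.adjoint (gradU f z)) (y t, u t) (p t)
      (fderiv ℝ (fun z => gradUT f z (p t)) (y t, u t)) R Λ₁ Λ₂ ((Λ₂ + Λ₃) * R) ω := by
  have hρ : 0 ≤ ρ := hR.trans hRρ
  have h := hS.pointSmoothness ht
  have hz0 : ‖(y t, u t) - (y t, u t)‖ ≤ ρ := by rw [sub_self, norm_zero]; exact hρ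
  have hp0 : ‖p t - p t‖ ≤ ρ := by rw [sub_self, norm_zero]; exact hρ
  obtain ⟨hΛ₁, hΛ₂, hΛ₃⟩ := h.nonneg hρ
  constructor
  · intro z z' hz hz'
    exact h.norm_map_sub_le hρ (hz.trans hRρ) (hz'.trans hRρ)
  · intro z z' q q' hz hz' hq'
    exact h.norm_pairing_sub_le norm_adjointEval_inl_le hρ (hz.trans hRρ) (hz'.trans hRρ)
      (hq'.trans hRρ)
  · intro z z' q q' hz hz' hq'
    have h1 := h.norm_pairing_sub_linearization_le (p := q) norm_adjointEval_inr_le hR hRρ hz hz' hq'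
    rw [derivPairing_eq_fderiv_gradUT] at h1
    refine h1.trans ?_
    rw [mul_add]
    refine add_le_add le_rfl ?_
    gcongr
    linarith
  · intro q
    exact (norm_adjointEval_inr_le _ q).trans
      (mul_le_mul_of_nonneg_right (h _ _ hz0 hp0).2.2.1 (norm_nonneg _))
  · intro y'
    have h1 := h.norm_derivPairing_self_le norm_adjointEval_inr_le hρ
    rw [derivPairing_eq_fderiv_gradUT] at h1
    refine (ContinuousLinearMap.le_opNorm _ _).trans ?_
    refine mul_le_mul h1 ?_ (norm_nonneg _) hΛ₂
    simp [Prod.norm_def]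
  · intro v
    obtain ⟨L, hL, hLω⟩ := hH t ht (p t) (by rw [sub_self, norm_zero]; exact hε)
    have h1 : L v = fderiv ℝ (fun z => gradUT f z (p t)) (y t, u t) (0, v) := by
      rw [← hessU_eq_fderiv_gradUT (z := (y t, u t)) (h _ _ hz0 hp0).1, ← hL]
      rfl
    rw [← h1]
    have h2 := (L.symm : Vec d →L[ℝ] Vec d).le_opNorm (L v)
    have h3 : (L.symm : Vec d →L[ℝ] Vec d) (L v) = v := L.symm_apply_apply v
    rw [h3] at h2
    exact h2.trans (mul_le_mul_of_nonneg_right hLω (norm_nonneg _))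

end

end

noncomputable section

/-! ### The residual map of the discrete optimality conditions -/

/-- The column-normalized matrix `κ_ij / ∑_l κ_lj`; columns with sum zero become zero. -/
def normalizedCols {s : ℕ} (K : Matrix (Fin s) (Fin s) ℝ) : Matrix (Fin s) (Fin s) ℝ :=
  Matrix.of fun i j => K i j / ∑ l, K l j

/-- The data of a discrete boundary value problem on a fixed grid: the block bidiagonal operators
`LY` and `LP` of the state and the adjoint equations, the matrices `K_n`, the inhomogeneity `b`,
the end weights `w` with the end gradient `grad` and its linear part `gradLin`, the right-hand side
`f` with its transposed partial derivatives `gY` and `gU`, the reference values `ys, ps, us`, the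
linear parts `D` of the control equations there, and the step size `h`. -/
structure GridProblem (s N : ℕ) (V W : Type*) [NormedAddCommGroup V] [NormedSpace ℝ V]
    [NormedAddCommGroup W] [NormedSpace ℝ W] where
  LY : (Fin (N + 1) → Fin s → V) →ₗ[ℝ] (Fin (N + 1) → Fin s → V)
  LP : (Fin (N + 1) → Fin s → V) →ₗ[ℝ] (Fin (N + 1) → Fin s → V)
  K : Fin (N + 1) → Matrix (Fin s) (Fin s) ℝ
  b : Fin (N + 1) → Fin s → V
  w : Fin s → ℝ
  grad : V → V
  gradLin : V →L[ℝ] V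
  f : V × W → V
  gY : V × W → V →L[ℝ] V
  gU : V × W → V →L[ℝ] W
  ys : Fin (N + 1) → Fin s → V
  ps : Fin (N + 1) → Fin s → V
  us : Fin (N + 1) → Fin s → W
  D : Fin (N + 1) → Fin s → V × W →L[ℝ] W
  h : ℝ

namespace GridProblem

variable {s N : ℕ} {V W : Type*} [NormedAddCommGroup V] [NormedSpace ℝ V]
  [NormedAddCommGroup W] [NormedSpace ℝ W] (𝒢 : GridProblem s N V W)

/-- The space of the unknowns `(Y, P, U)`, with the maximum norm. -/
abbrev Unknowns (s N : ℕ) (V W : Type*) : Type _ :=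
  (Fin (N + 1) → Fin s → V) × (Fin (N + 1) → Fin s → V) × (Fin (N + 1) → Fin s → W)

/-- Column `j` of `K_n` does not vanish. -/
def Act (n : Fin (N + 1)) (j : Fin s) : Prop := ∃ i, 𝒢.K n i j ≠ 0

/-- The sum of column `j` of `K_n`. -/
def colSum (n : Fin (N + 1)) (j : Fin s) : ℝ := ∑ i, 𝒢.K n i j

/-- The multipliers `∑ᵢ κᵢⱼ Pᵢ / ∑ᵢ κᵢⱼ` which enter the adjoint and the control equations. -/
def mult (P : Fin (N + 1) → Fin s → V) (n : Fin (N + 1)) : Fin s → V :=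
  stageMap (normalizedCols (𝒢.K n))ᵀ (P n)

/-- The reference point of the unknowns. -/
def ref : Unknowns s N V W := (𝒢.ys, 𝒢.ps, 𝒢.us)

open Classical in
/-- The residual of the discrete optimality conditions. The control equations are divided by the
column sums of `K_n`, and at blind stages replaced by `U = us`. -/
def residual (z : Unknowns s N V W) : Unknowns s N V W :=
  (fun n => 𝒢.LY z.1 n - 𝒢.b n - 𝒢.h • stageMap (𝒢.K n) fun j => 𝒢.f (z.1 n j, z.2.2 n j),
   fun n i => 𝒢.LP z.2.1 n i
      - (if n = Fin.last N then 𝒢.w i • 𝒢.grad (∑ j, 𝒢.w j • z.1 (Fin.last N) j) else 0)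
      - 𝒢.h • 𝒢.colSum n i • 𝒢.gY (z.1 n i, z.2.2 n i) (𝒢.mult z.2.1 n i),
   fun n j => if 𝒢.Act n j then 𝒢.gU (z.1 n j, z.2.2 n j) (𝒢.mult z.2.1 n j)
      else z.2.2 n j - 𝒢.us n j)

theorem mult_sub (P P' : Fin (N + 1) → Fin s → V) (n : Fin (N + 1)) :
    𝒢.mult (P - P') n = 𝒢.mult P n - 𝒢.mult P' n := map_sub _ _ _

open Classical in
/-- The linear operator which approximates the residual map: the terms with the factor `h` are
omitted, and the control equations are linearized at the reference point. It is block lower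
triangular in the order `Y, P, U`. -/
def frozen : Unknowns s N V W →ₗ[ℝ] Unknowns s N V W where
  toFun z := (𝒢.LY z.1,
    fun n i => 𝒢.LP z.2.1 n i
      - (if n = Fin.last N then 𝒢.w i • 𝒢.gradLin (∑ j, 𝒢.w j • z.1 (Fin.last N) j) else 0),
    fun n j => if 𝒢.Act n j then 𝒢.gU (𝒢.ys n j, 𝒢.us n j) (𝒢.mult z.2.1 n j)
      + 𝒢.D n j (z.1 n j, z.2.2 n j) else z.2.2 n j)
  map_add' z z' := by
    refine Prod.ext (map_add _ _ _) (Prod.ext ?_ ?_)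
    · funext n i
      simp only [Prod.fst_add, Prod.snd_add, map_add, Pi.add_apply, smul_add,
        Finset.sum_add_distrib]
      split_ifs
      · abel
      · abel
    · funext n j
      have h1 : 𝒢.mult (z.2.1 + z'.2.1) n j = 𝒢.mult z.2.1 n j + 𝒢.mult z'.2.1 n j := by
        simp [mult, Finset.sum_add_distrib]
      simp only [Prod.fst_add, Prod.snd_add, Pi.add_apply, h1, map_add, ← Prod.mk_add_mk]
      split_ifs
      · abel
      · rfl
  map_smul' c z := by
    refine Prod.ext (map_smul _ _ _) (Prod.ext ?_ ?_)
    · funext n i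
      have h1 : ∑ j, 𝒢.w j • (c • z.1 (Fin.last N) j) = c • ∑ j, 𝒢.w j • z.1 (Fin.last N) j := by
        rw [Finset.smul_sum]
        exact Finset.sum_congr rfl fun j _ => smul_comm _ _ _
      simp only [Prod.smul_fst, Prod.smul_snd, map_smul, Pi.smul_apply, h1, RingHom.id_apply,
        smul_sub]
      split_ifs
      · rw [smul_comm]
      · simp
    · funext n j
      have h1 : 𝒢.mult (c • z.2.1) n j = c • 𝒢.mult z.2.1 n j := by
        simp only [mult, stageMap_apply, Pi.smul_apply]
        rw [Finset.smul_sum]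
        exact Finset.sum_congr rfl fun j _ => smul_comm _ _ _
      simp only [Prod.smul_fst, Prod.smul_snd, Pi.smul_apply, h1, map_smul, RingHom.id_apply,
        ← Prod.smul_mk]
      split_ifs
      · rw [smul_add]
      · rfl

/-- Quantitative hypotheses on a grid problem: stability of the block operators with constant `S`,
a common bound `κ` of the method coefficients, and the local estimates in tubes of radius `R`
around the reference values, where `R` is so large that multipliers of unknowns at distance at most
`δ` from the reference point stay inside. -/
structure Bounds (S κ Λ₁ Λ₂ Γ η ω R δ : ℝ) : Prop where
  S_pos : 0 < S
  κ_nonneg : 0 ≤ κ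
  Λ₁_nonneg : 0 ≤ Λ₁
  Λ₂_nonneg : 0 ≤ Λ₂
  Γ_nonneg : 0 ≤ Γ
  η_nonneg : 0 ≤ η
  ω_nonneg : 0 ≤ ω
  h_nonneg : 0 ≤ 𝒢.h
  LY_stable : ∀ x, ‖x‖ ≤ S * ∑ n, ‖𝒢.LY x n‖
  LP_stable : ∀ x, ‖x‖ ≤ S * ∑ n, ‖𝒢.LP x n‖
  entrySum_K : ∀ n, entrySum (𝒢.K n) ≤ κ
  entrySum_normalizedCols : ∀ n, entrySum (normalizedCols (𝒢.K n)) ≤ κ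
  sum_w : ∑ j, |𝒢.w j| ≤ κ
  grad_sub : ∀ x x', 𝒢.grad x - 𝒢.grad x' = 𝒢.gradLin (x - x')
  norm_gradLin : ‖𝒢.gradLin‖ ≤ Γ
  δ_le : δ ≤ R
  mult_mem : ∀ P, ‖P - 𝒢.ps‖ ≤ δ → ∀ n j, 𝒢.Act n j → ‖𝒢.mult P n j - 𝒢.ps n j‖ ≤ R
  loc : ∀ n j, LocalEstimates 𝒢.f 𝒢.gY 𝒢.gU (𝒢.ys n j, 𝒢.us n j) (𝒢.ps n j) (𝒢.D n j)
    R Λ₁ Λ₂ η ω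

/-- The bound for the `Y`-component of a preimage under the frozen operator. -/
def sizeY (S : ℝ) (g : Unknowns s N V W) : ℝ := S * ∑ n, ‖g.1 n‖

/-- The bound for the `P`-component of a preimage under the frozen operator. -/
def sizeP (S κ Γ : ℝ) (g : Unknowns s N V W) : ℝ :=
  S * (κ ^ 2 * Γ * sizeY S g + ∑ n, ‖g.2.1 n‖)

/-- The bound for the `U`-component of a preimage under the frozen operator. -/
def sizeU (S κ Λ₁ Λ₂ Γ ω : ℝ) (g : Unknowns s N V W) : ℝ :=
  ω * (κ * Λ₁ * sizeP S κ Γ g + Λ₂ * sizeY S g) + (1 + ω) * ‖g.2.2‖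

/-- The bound for a preimage under the frozen operator. -/
def size (S κ Λ₁ Λ₂ Γ ω : ℝ) (g : Unknowns s N V W) : ℝ :=
  max (sizeY S g) (max (sizeP S κ Γ g) (sizeU S κ Λ₁ Λ₂ Γ ω g))

variable {𝒢} {S κ Λ₁ Λ₂ Γ η ω R δ : ℝ}

theorem colSum_eq_zero {n : Fin (N + 1)} {j : Fin s} (h : ¬ 𝒢.Act n j) : 𝒢.colSum n j = 0 := by
  refine Finset.sum_eq_zero fun i _ => ?_
  by_contra hne
  exact h ⟨i, hne⟩

theorem norm_mult_le (hκ : 0 ≤ κ) (hK : ∀ n, entrySum (normalizedCols (𝒢.K n)) ≤ κ)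
    (P : Fin (N + 1) → Fin s → V) (n : Fin (N + 1)) (j : Fin s) :
    ‖𝒢.mult P n j‖ ≤ κ * ‖P‖ := by
  refine (norm_le_pi_norm _ j).trans ((norm_stageMap_le _ _).trans ?_)
  rw [entrySum_transpose]
  exact mul_le_mul (hK n) (norm_le_pi_norm P n) (norm_nonneg _) hκ

namespace Bounds

variable (hB : 𝒢.Bounds S κ Λ₁ Λ₂ Γ η ω R δ)
include hB

/-- Stability of the frozen operator. -/
theorem norm_le_size (z : Unknowns s N V W) : ‖z‖ ≤ size S κ Λ₁ Λ₂ Γ ω (𝒢.frozen z) := by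
  obtain ⟨y, p, u⟩ := z
  set g := 𝒢.frozen (y, p, u) with hg
  have hS := hB.S_pos.le
  have hκ := hB.κ_nonneg
  have hΓ := hB.Γ_nonneg
  have hY : ‖y‖ ≤ sizeY S g := hB.LY_stable y
  have hP : ‖p‖ ≤ sizeP S κ Γ g := by
    refine (hB.LP_stable p).trans (mul_le_mul_of_nonneg_left ?_ hS)
    -- the adjoint rows depend on `y` in the last step only
    have hn : ∀ n, ‖𝒢.LP p n‖ ≤ (if n = Fin.last N then κ ^ 2 * Γ * ‖y‖ else 0) + ‖g.2.1 n‖ := by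
      intro n
      by_cases hn : n = Fin.last N
      · rw [if_pos hn]
        have e : 𝒢.LP p n
            = (fun i => 𝒢.w i • 𝒢.gradLin (∑ j, 𝒢.w j • y (Fin.last N) j)) + g.2.1 n := by
          funext i
          simp [hg, frozen, hn]
        rw [e]
        refine (norm_add_le _ _).trans (add_le_add ?_ le_rfl)
        refine (pi_norm_le_iff_of_nonneg (by positivity)).mpr fun i => ?_
        rw [norm_smul, Real.norm_eq_abs]
        have h1 : |𝒢.w i| ≤ κ := (Finset.single_le_sum (f := fun j => |𝒢.w j|)
          (fun _ _ => abs_nonneg _) (Finset.mem_univ i)).trans hB.sum_w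
        have h2 : ‖∑ j, 𝒢.w j • y (Fin.last N) j‖ ≤ κ * ‖y‖ :=
          (norm_sum_smul_le_of_norm_le _ _ fun j =>
            (norm_le_pi_norm _ j).trans (norm_le_pi_norm y _)).trans
            (mul_le_mul_of_nonneg_right hB.sum_w (norm_nonneg _))
        have h3 := (𝒢.gradLin.le_opNorm (∑ j, 𝒢.w j • y (Fin.last N) j)).trans
          (mul_le_mul hB.norm_gradLin h2 (norm_nonneg _) hΓ)
        refine (mul_le_mul h1 h3 (norm_nonneg _) hκ).trans (le_of_eq ?_)
        ring
      · rw [if_neg hn, zero_add]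
        refine le_of_eq (congrArg _ ?_)
        funext i
        simp [hg, frozen, hn]
    refine (Finset.sum_le_sum fun n _ => hn n).trans ?_
    rw [Finset.sum_add_distrib, Finset.sum_ite_eq' Finset.univ (Fin.last N)]
    simp only [Finset.mem_univ, if_true]
    have : κ ^ 2 * Γ * ‖y‖ ≤ κ ^ 2 * Γ * sizeY S g := mul_le_mul_of_nonneg_left hY (by positivity)
    linarith
  have hY0 : 0 ≤ sizeY S g := (norm_nonneg _).trans hY
  have hP0 : 0 ≤ sizeP S κ Γ g := (norm_nonneg _).trans hP
  have hω := hB.ω_nonneg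
  have hΛ₁ := hB.Λ₁_nonneg
  have hΛ₂ := hB.Λ₂_nonneg
  have hU : ‖u‖ ≤ sizeU S κ Λ₁ Λ₂ Γ ω g := by
    have hU0 : 0 ≤ sizeU S κ Λ₁ Λ₂ Γ ω g := by
      unfold sizeU
      positivity
    refine (pi_norm_le_iff_of_nonneg hU0).mpr fun n => (pi_norm_le_iff_of_nonneg hU0).mpr fun j => ?_
    have hgn : ‖g.2.2 n j‖ ≤ ‖g.2.2‖ := (norm_le_pi_norm _ j).trans (norm_le_pi_norm g.2.2 n)
    by_cases hact : 𝒢.Act n j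
    -- the control equation is solved for `u` with the inverse control Hessian
    · have e : 𝒢.D n j (0, u n j)
          = g.2.2 n j - 𝒢.gU (𝒢.ys n j, 𝒢.us n j) (𝒢.mult p n j) - 𝒢.D n j (y n j, 0) := by
        have e1 : g.2.2 n j = 𝒢.gU (𝒢.ys n j, 𝒢.us n j) (𝒢.mult p n j)
            + 𝒢.D n j (y n j, u n j) := by simp [hg, frozen, hact]
        have e2 : ((y n j, u n j) : V × W) = (y n j, 0) + (0, u n j) := by simp
        rw [e1, e2, map_add]
        abel
      have hl := hB.loc n j
      have h1 : ‖𝒢.gU (𝒢.ys n j, 𝒢.us n j) (𝒢.mult p n j)‖ ≤ Λ₁ * (κ * sizeP S κ Γ g) :=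
        (hl.gU_le _).trans (mul_le_mul_of_nonneg_left
          ((norm_mult_le hκ hB.entrySum_normalizedCols p n j).trans (mul_le_mul_of_nonneg_left hP hκ)) hΛ₁)
      have h2 : ‖𝒢.D n j (y n j, 0)‖ ≤ Λ₂ * sizeY S g :=
        (hl.D_fst_le _).trans (mul_le_mul_of_nonneg_left
          (((norm_le_pi_norm _ j).trans (norm_le_pi_norm y n)).trans hY) hΛ₂)
      have h3 : ‖𝒢.D n j (0, u n j)‖ ≤
          ‖g.2.2‖ + Λ₁ * (κ * sizeP S κ Γ g) + Λ₂ * sizeY S g := by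
        rw [e]
        exact (norm_sub_le _ _).trans (add_le_add ((norm_sub_le _ _).trans (add_le_add hgn h1)) h2)
      refine (hl.D_snd_ge _).trans ((mul_le_mul_of_nonneg_left h3 hω).trans ?_)
      unfold sizeU
      nlinarith [norm_nonneg g.2.2]
    · have e : u n j = g.2.2 n j := by simp [hg, frozen, hact]
      rw [e]
      refine hgn.trans ?_
      unfold sizeU
      have h1 : 0 ≤ ω * (κ * Λ₁ * sizeP S κ Γ g + Λ₂ * sizeY S g) := by positivity
      nlinarith [norm_nonneg g.2.2]
  refine norm_prod_le_iff.mpr ⟨hY.trans (le_max_left _ _), norm_prod_le_iff.mpr ⟨?_, ?_⟩⟩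
  · exact hP.trans ((le_max_left _ _).trans (le_max_right _ _))
  · exact hU.trans ((le_max_right _ _).trans (le_max_right _ _))

/-- If the blocks of `g` are bounded by `h a`, `h b` and `e`, the size of `g` is bounded in terms
of the length `T = (N + 1) h` of the interval. -/
theorem size_le {g : Unknowns s N V W} {a b e : ℝ} (he : 0 ≤ e)
    (hY : ∀ n, ‖g.1 n‖ ≤ 𝒢.h * a) (hP : ∀ n, ‖g.2.1 n‖ ≤ 𝒢.h * b)
    (hU : ∀ n j, ‖g.2.2 n j‖ ≤ e) {T : ℝ} (hT : T = (N + 1) * 𝒢.h) {α β : ℝ}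
    (hα : S * (T * a) ≤ α) (hβ : S * (κ ^ 2 * Γ * α + T * b) ≤ β) :
    size S κ Λ₁ Λ₂ Γ ω g ≤ max α (max β (ω * (κ * Λ₁ * β + Λ₂ * α) + (1 + ω) * e)) := by
  have hS := hB.S_pos.le
  have hκ := hB.κ_nonneg
  have hΓ := hB.Γ_nonneg
  have hω := hB.ω_nonneg
  have hΛ₁ := hB.Λ₁_nonneg
  have hΛ₂ := hB.Λ₂_nonneg
  have hsum : ∀ (x : Fin (N + 1) → ℝ) (a : ℝ), (∀ n, x n ≤ 𝒢.h * a) → ∑ n, x n ≤ T * a := by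
    intro x a hx
    refine (Finset.sum_le_sum fun n _ => hx n).trans (le_of_eq ?_)
    rw [Finset.sum_const, Finset.card_univ, Fintype.card_fin, nsmul_eq_mul, hT]
    push_cast
    ring
  have h1 : sizeY S g ≤ α := (mul_le_mul_of_nonneg_left (hsum _ a hY) hS).trans hα
  have h2 : sizeP S κ Γ g ≤ β := by
    refine le_trans (mul_le_mul_of_nonneg_left ?_ hS) hβ
    exact add_le_add (mul_le_mul_of_nonneg_left h1 (by positivity)) (hsum _ b hP)
  have h3 : ‖g.2.2‖ ≤ e :=
    (pi_norm_le_iff_of_nonneg he).mpr fun n => (pi_norm_le_iff_of_nonneg he).mpr fun j => hU n j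
  have h4 : sizeU S κ Λ₁ Λ₂ Γ ω g ≤ ω * (κ * Λ₁ * β + Λ₂ * α) + (1 + ω) * e := by
    unfold sizeU
    gcongr
  exact max_le_max h1 (max_le_max h2 h4)

/-- The difference between the residual map and the frozen operator has small increments. -/
theorem size_residual_sub_frozen_le {T : ℝ} (hT : T = (N + 1) * 𝒢.h) {α β : ℝ}
    (hα : S * (T * (κ * Λ₁)) ≤ α)
    (hβ : S * (κ ^ 2 * Γ * α + T * (κ * (κ * Λ₁ + Λ₂))) ≤ β) (hα2 : α ≤ 1 / 2) (hβ2 : β ≤ 1 / 2)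
    (hγ2 : ω * (κ * Λ₁ * β + Λ₂ * α) + (1 + ω) * (η * (1 + κ)) ≤ 1 / 2)
    (z z' : Unknowns s N V W) (hz : ‖z - 𝒢.ref‖ ≤ δ) (hz' : ‖z' - 𝒢.ref‖ ≤ δ) :
    size S κ Λ₁ Λ₂ Γ ω (𝒢.residual z - 𝒢.residual z' - 𝒢.frozen (z - z')) ≤ ‖z - z'‖ / 2 := by
  have hκ := hB.κ_nonneg
  have hω := hB.ω_nonneg
  have hΛ₁ := hB.Λ₁_nonneg
  have hΛ₂ := hB.Λ₂_nonneg
  have hh := hB.h_nonneg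
  have hη := hB.η_nonneg
  set Δ := ‖z - z'‖ with hΔ
  have hΔ0 : 0 ≤ Δ := norm_nonneg _
  obtain ⟨Y, P, U⟩ := z
  obtain ⟨Y', P', U'⟩ := z'
  have hY : ‖Y - Y'‖ ≤ Δ := norm_fst_le ((Y, P, U) - (Y', P', U'))
  have hPU : ‖(P, U) - (P', U')‖ ≤ Δ := norm_snd_le ((Y, P, U) - (Y', P', U'))
  have hP : ‖P - P'‖ ≤ Δ := (norm_fst_le ((P, U) - (P', U'))).trans hPU
  have hU : ‖U - U'‖ ≤ Δ := (norm_snd_le ((P, U) - (P', U'))).trans hPU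
  have hball : ∀ (Y P : Fin (N + 1) → Fin s → V) (U : Fin (N + 1) → Fin s → W),
      ‖(Y, P, U) - 𝒢.ref‖ ≤ δ → (∀ n j, ‖(Y n j, U n j) - (𝒢.ys n j, 𝒢.us n j)‖ ≤ R) ∧
        ‖P - 𝒢.ps‖ ≤ δ := by
    intro Y P U hb
    have h1 : ‖Y - 𝒢.ys‖ ≤ δ := (norm_fst_le ((Y, P, U) - 𝒢.ref)).trans hb
    have h2 : ‖(P, U) - (𝒢.ps, 𝒢.us)‖ ≤ δ := (norm_snd_le ((Y, P, U) - 𝒢.ref)).trans hb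
    have h3 : ‖P - 𝒢.ps‖ ≤ δ := (norm_fst_le ((P, U) - (𝒢.ps, 𝒢.us))).trans h2
    have h4 : ‖U - 𝒢.us‖ ≤ δ := (norm_snd_le ((P, U) - (𝒢.ps, 𝒢.us))).trans h2
    refine ⟨fun n j => norm_prod_le_iff.mpr ⟨?_, ?_⟩, h3⟩
    · exact (((norm_le_pi_norm _ j).trans (norm_le_pi_norm (Y - 𝒢.ys) n)).trans h1).trans hB.δ_le
    · exact (((norm_le_pi_norm _ j).trans (norm_le_pi_norm (U - 𝒢.us) n)).trans h4).trans hB.δ_le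
  obtain ⟨hz1, hz2⟩ := hball Y P U hz
  obtain ⟨hz1', hz2'⟩ := hball Y' P' U' hz'
  have hYU : ∀ n j, ‖(Y n j, U n j) - (Y' n j, U' n j)‖ ≤ Δ := fun n j =>
    norm_prod_le_iff.mpr
      ⟨((norm_le_pi_norm _ j).trans (norm_le_pi_norm (Y - Y') n)).trans hY,
       ((norm_le_pi_norm _ j).trans (norm_le_pi_norm (U - U') n)).trans hU⟩
  have hQ : ∀ n j, ‖𝒢.mult P n j - 𝒢.mult P' n j‖ ≤ κ * Δ := by
    intro n j
    have h1 := norm_mult_le hκ hB.entrySum_normalizedCols (P - P') n j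
    rw [𝒢.mult_sub] at h1
    exact h1.trans (mul_le_mul_of_nonneg_left hP hκ)
  have hcol : ∀ n j, |𝒢.colSum n j| ≤ κ := fun n j =>
    (abs_colSum_le_entrySum _ _).trans (hB.entrySum_K n)
  have hsize := hB.size_le (T := T) (α := α * Δ) (β := β * Δ) (a := κ * Λ₁ * Δ)
    (b := κ * (κ * Λ₁ + Λ₂) * Δ) (e := η * (1 + κ) * Δ)
    (g := 𝒢.residual (Y, P, U) - 𝒢.residual (Y', P', U') - 𝒢.frozen ((Y, P, U) - (Y', P', U')))
    (by positivity) ?_ ?_ ?_ hT ?_ ?_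
  · refine hsize.trans (max_le ?_ (max_le ?_ ?_))
    · nlinarith
    · nlinarith
    · have h1 := mul_le_mul_of_nonneg_right hγ2 hΔ0
      refine le_trans (le_of_eq ?_) (h1.trans (le_of_eq ?_)) <;> ring
  · intro n
    have e : (𝒢.residual (Y, P, U) - 𝒢.residual (Y', P', U')
        - 𝒢.frozen ((Y, P, U) - (Y', P', U'))).1 n
        = -(𝒢.h • stageMap (𝒢.K n) fun j => 𝒢.f (Y n j, U n j) - 𝒢.f (Y' n j, U' n j)) := by
      change (𝒢.LY Y n - 𝒢.b n - 𝒢.h • stageMap (𝒢.K n) fun j => 𝒢.f (Y n j, U n j))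
        - (𝒢.LY Y' n - 𝒢.b n - 𝒢.h • stageMap (𝒢.K n) fun j => 𝒢.f (Y' n j, U' n j))
        - 𝒢.LY (Y - Y') n = _
      have e1 : (fun j => 𝒢.f (Y n j, U n j) - 𝒢.f (Y' n j, U' n j))
          = (fun j => 𝒢.f (Y n j, U n j)) - fun j => 𝒢.f (Y' n j, U' n j) := rfl
      rw [map_sub, e1, map_sub, smul_sub, Pi.sub_apply]
      abel
    rw [e, norm_neg, norm_smul, Real.norm_eq_abs, abs_of_nonneg hh]
    refine mul_le_mul_of_nonneg_left ((norm_stageMap_le _ _).trans ?_) hh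
    rw [mul_assoc]
    refine mul_le_mul (hB.entrySum_K n) ?_ (norm_nonneg _) hκ
    refine (pi_norm_le_iff_of_nonneg (by positivity)).mpr fun j => ?_
    exact ((hB.loc n j).map_sub_le _ _ (hz1 n j) (hz1' n j)).trans
      (mul_le_mul_of_nonneg_left (hYU n j) hΛ₁)
  · intro n
    refine (pi_norm_le_iff_of_nonneg (by positivity)).mpr fun i => ?_
    have e : (𝒢.residual (Y, P, U) - 𝒢.residual (Y', P', U')
        - 𝒢.frozen ((Y, P, U) - (Y', P', U'))).2.1 n i
        = -(𝒢.h • 𝒢.colSum n i • (𝒢.gY (Y n i, U n i) (𝒢.mult P n i)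
            - 𝒢.gY (Y' n i, U' n i) (𝒢.mult P' n i))) := by
      change (𝒢.LP P n i
          - (if n = Fin.last N then 𝒢.w i • 𝒢.grad (∑ j, 𝒢.w j • Y (Fin.last N) j) else 0)
          - 𝒢.h • 𝒢.colSum n i • 𝒢.gY (Y n i, U n i) (𝒢.mult P n i))
        - (𝒢.LP P' n i
          - (if n = Fin.last N then 𝒢.w i • 𝒢.grad (∑ j, 𝒢.w j • Y' (Fin.last N) j) else 0)
          - 𝒢.h • 𝒢.colSum n i • 𝒢.gY (Y' n i, U' n i) (𝒢.mult P' n i))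
        - (𝒢.LP (P - P') n i - (if n = Fin.last N then
            𝒢.w i • 𝒢.gradLin (∑ j, 𝒢.w j • (Y - Y') (Fin.last N) j) else 0)) = _
      have e1 : ∑ j, 𝒢.w j • (Y - Y') (Fin.last N) j
          = ∑ j, 𝒢.w j • Y (Fin.last N) j - ∑ j, 𝒢.w j • Y' (Fin.last N) j := by
        simp [smul_sub, Finset.sum_sub_distrib]
      rw [map_sub, e1, ← hB.grad_sub, smul_sub, smul_sub, smul_sub, Pi.sub_apply, Pi.sub_apply]
      split_ifs <;> abel
    rw [e, norm_neg, norm_smul, Real.norm_eq_abs, abs_of_nonneg hh]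
    refine mul_le_mul_of_nonneg_left ?_ hh
    by_cases hact : 𝒢.Act n i
    · rw [norm_smul, Real.norm_eq_abs, mul_assoc]
      refine mul_le_mul (hcol n i) ?_ (norm_nonneg _) hκ
      refine ((hB.loc n i).gY_sub_le _ _ _ _ (hz1 n i) (hz1' n i)
        (hB.mult_mem P' hz2' n i hact)).trans ?_
      have h1 := mul_le_mul_of_nonneg_left (hQ n i) hΛ₁
      have h2 := mul_le_mul_of_nonneg_left (hYU n i) hΛ₂
      refine (add_le_add h1 h2).trans (le_of_eq ?_)
      ring
    · rw [colSum_eq_zero hact, zero_smul, norm_zero]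
      positivity
  · intro n j
    by_cases hact : 𝒢.Act n j
    · have e : (𝒢.residual (Y, P, U) - 𝒢.residual (Y', P', U')
          - 𝒢.frozen ((Y, P, U) - (Y', P', U'))).2.2 n j
          = 𝒢.gU (Y n j, U n j) (𝒢.mult P n j) - 𝒢.gU (Y' n j, U' n j) (𝒢.mult P' n j)
            - (𝒢.gU (𝒢.ys n j, 𝒢.us n j) (𝒢.mult P n j - 𝒢.mult P' n j)
              + 𝒢.D n j ((Y n j, U n j) - (Y' n j, U' n j))) := by
        have e1 : 𝒢.mult (P - P') n j = 𝒢.mult P n j - 𝒢.mult P' n j := by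
          rw [𝒢.mult_sub, Pi.sub_apply]
        rw [← e1]
        simp [residual, frozen, hact]
      rw [e]
      refine ((hB.loc n j).gU_sub_le _ _ _ _ (hz1 n j) (hz1' n j)
        (hB.mult_mem P' hz2' n j hact)).trans ?_
      rw [mul_assoc]
      refine mul_le_mul_of_nonneg_left ?_ hη
      refine (add_le_add (hYU n j) (hQ n j)).trans (le_of_eq ?_)
      ring
    · have e : (𝒢.residual (Y, P, U) - 𝒢.residual (Y', P', U')
          - 𝒢.frozen ((Y, P, U) - (Y', P', U'))).2.2 n j = 0 := by
        simp [residual, frozen, hact]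
      rw [e, norm_zero]
      positivity
  · refine le_trans (le_of_eq ?_) (mul_le_mul_of_nonneg_right hα hΔ0)
    ring
  · refine le_trans (le_of_eq ?_) (mul_le_mul_of_nonneg_right hβ hΔ0)
    ring

/-- Existence and local uniqueness of a zero of the residual map near the reference point, with
an error proportional to the residual `τ` of the reference point. -/
theorem exists_unique_zero [FiniteDimensional ℝ V] [FiniteDimensional ℝ W] {T : ℝ}
    (hT : T = (N + 1) * 𝒢.h) {α β : ℝ}
    (hα : S * (T * (κ * Λ₁)) ≤ α)
    (hβ : S * (κ ^ 2 * Γ * α + T * (κ * (κ * Λ₁ + Λ₂))) ≤ β) (hα2 : α ≤ 1 / 2) (hβ2 : β ≤ 1 / 2)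
    (hγ2 : ω * (κ * Λ₁ * β + Λ₂ * α) + (1 + ω) * (η * (1 + κ)) ≤ 1 / 2)
    {τ M : ℝ} (hτ : 0 ≤ τ) (hY : ∀ n i, ‖(𝒢.residual 𝒢.ref).1 n i‖ ≤ 𝒢.h * τ)
    (hP : ∀ n i, ‖(𝒢.residual 𝒢.ref).2.1 n i‖ ≤ 𝒢.h * τ)
    (hU : ∀ n j, ‖(𝒢.residual 𝒢.ref).2.2 n j‖ ≤ τ)
    (hM : M = S * T + S * (κ ^ 2 * Γ * (S * T) + T)
      + (ω * (κ * Λ₁ * (S * (κ ^ 2 * Γ * (S * T) + T)) + Λ₂ * (S * T)) + (1 + ω)))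
    (hMδ : M * τ ≤ δ / 2) :
    ∃ z, ‖z - 𝒢.ref‖ ≤ δ ∧ ‖z - 𝒢.ref‖ ≤ 2 * (M * τ) ∧ 𝒢.residual z = 0 ∧
      ∀ z', ‖z' - 𝒢.ref‖ ≤ δ → 𝒢.residual z' = 0 → z' = z := by
  have hS := hB.S_pos.le
  have hκ := hB.κ_nonneg
  have hΓ := hB.Γ_nonneg
  have hω := hB.ω_nonneg
  have hΛ₁ := hB.Λ₁_nonneg
  have hΛ₂ := hB.Λ₂_nonneg
  have hh := hB.h_nonneg
  have hT0 : 0 ≤ T := by rw [hT]; positivity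
  have hsize : size S κ Λ₁ Λ₂ Γ ω (𝒢.residual 𝒢.ref) ≤ M * τ := by
    refine (hB.size_le (T := T) (a := τ) (b := τ) (e := τ) (α := S * T * τ)
      (β := S * (κ ^ 2 * Γ * (S * T) + T) * τ) hτ
      (fun n => (pi_norm_le_iff_of_nonneg (by positivity)).mpr (hY n))
      (fun n => (pi_norm_le_iff_of_nonneg (by positivity)).mpr (hP n)) hU hT
      (le_of_eq (by ring)) (le_of_eq (by ring))).trans ?_
    set a := S * T with ha
    set b := S * (κ ^ 2 * Γ * a + T) with hb
    have ha0 : 0 ≤ a := by positivity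
    have hb0 : 0 ≤ b := by positivity
    have p1 : 0 ≤ a * τ := by positivity
    have p2 : 0 ≤ b * τ := by positivity
    have p3 : 0 ≤ (ω * (κ * Λ₁ * b + Λ₂ * a) + (1 + ω)) * τ := by positivity
    rw [hM]
    refine max_le ?_ (max_le ?_ ?_)
    · linarith
    · linarith
    · refine le_trans (le_of_eq ?_) (le_add_of_nonneg_left (add_nonneg p1 p2) |>.trans
        (le_of_eq ?_)) (b := (ω * (κ * Λ₁ * b + Λ₂ * a) + (1 + ω)) * τ) <;> ring
  have h0 : size S κ Λ₁ Λ₂ Γ ω (0 : Unknowns s N V W) ≤ 0 := by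
    simp [size, sizeY, sizeP, sizeU]
  obtain ⟨z, h1, h2, h3, h4⟩ := exists_unique_zero_of_approx_linear 𝒢.frozen
    (size S κ Λ₁ Λ₂ Γ ω) h0 hB.norm_le_size 𝒢.residual 𝒢.ref δ
    (hB.size_residual_sub_frozen_le hT hα hβ hα2 hβ2 hγ2) (hsize.trans hMδ)
  exact ⟨z, h1, h2.trans (mul_le_mul_of_nonneg_left hsize (by norm_num)), h3, h4⟩

end Bounds

end GridProblem

end

noncomputable section

/-! ### The order conditions as exactness for monomials -/

section Vandermonde

theorem vandermondeCols_mul_pascal {s : ℕ} (c : Fin s → ℝ) (k : ℕ) :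
    vandermondeCols c k * pascal k = vandermondeCols (fun i => 1 + c i) k := by
  ext i j
  simp only [vandermondeCols, pascal, Matrix.mul_apply, Matrix.of_apply]
  rw [Fin.sum_univ_eq_sum_range (fun x => c i ^ x * (Nat.choose j x : ℝ)) k, add_comm, add_pow]
  refine (Finset.sum_subset (Finset.range_mono j.2) fun x _ hx => ?_).symm.trans ?_
  · rw [Nat.choose_eq_zero_of_lt (by simpa using hx)]
    simp
  · exact Finset.sum_congr rfl fun x _ => by simp

theorem vandermondeCols_mul_tildeE_apply {s : ℕ} (c : Fin s → ℝ) (k : ℕ) (i : Fin s) (j : Fin k) :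
    (vandermondeCols c k * tildeE k) i j = (j : ℕ) * c i ^ ((j : ℕ) - 1) := by
  simp only [vandermondeCols, tildeE, Matrix.mul_apply, Matrix.of_apply, mul_ite, mul_zero]
  rw [Fin.sum_univ_eq_sum_range
    (fun x => if (j : ℕ) = x + 1 then c i ^ x * ((x : ℝ) + 1) else 0) k]
  rcases Nat.eq_zero_or_pos (j : ℕ) with h | h
  · rw [h]
    simp
  · obtain ⟨x, hx⟩ : ∃ x, (j : ℕ) = x + 1 := ⟨(j : ℕ) - 1, by omega⟩
    rw [Finset.sum_eq_single_of_mem x (Finset.mem_range.mpr (by have := j.2; omega))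
      (fun b _ hb => if_neg (by omega)), if_pos hx, hx]
    push_cast
    exact mul_comm _ _

theorem tildeE_mul_pascal (k : ℕ) : tildeE k * pascal k = pascal k * tildeE k := by
  ext i j
  simp only [tildeE, pascal, Matrix.mul_apply, Matrix.of_apply, mul_ite, mul_zero, ite_mul,
    zero_mul]
  rw [Fin.sum_univ_eq_sum_range
    (fun x => if x = (i : ℕ) + 1 then ((i : ℕ) + 1 : ℝ) * (Nat.choose j x : ℝ) else 0) k,
    Fin.sum_univ_eq_sum_range
    (fun x => if (j : ℕ) = x + 1 then (Nat.choose x i : ℝ) * ((x : ℝ) + 1) else 0) k,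
    Finset.sum_ite_eq']
  have hl : (if (i : ℕ) + 1 ∈ Finset.range k then
      ((i : ℕ) + 1 : ℝ) * (Nat.choose j ((i : ℕ) + 1) : ℝ) else 0)
      = ((i : ℕ) + 1 : ℝ) * (Nat.choose j ((i : ℕ) + 1) : ℝ) := by
    split_ifs with h
    · rfl
    · rw [Nat.choose_eq_zero_of_lt (by have := j.2; rw [Finset.mem_range] at h; omega)]
      simp
  rw [hl]
  rcases Nat.eq_zero_or_pos (j : ℕ) with h | h
  · rw [h]
    simp
  · obtain ⟨x, hx⟩ : ∃ x, (j : ℕ) = x + 1 := ⟨(j : ℕ) - 1, by omega⟩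
    rw [Finset.sum_eq_single_of_mem x (Finset.mem_range.mpr (by have := j.2; omega))
      (fun b _ hb => if_neg (by omega)), if_pos hx, hx]
    have := Nat.add_one_mul_choose_eq x (i : ℕ)
    have h2 : ((x : ℝ) + 1) * (Nat.choose x i : ℝ)
        = (Nat.choose (x + 1) ((i : ℕ) + 1) : ℝ) * ((i : ℕ) + 1 : ℝ) := by exact_mod_cast this
    linarith

theorem isUnit_det_pascal (k : ℕ) : IsUnit (pascal k).det := by
  rw [Matrix.det_of_isUpperTriangular]
  · simp [pascal]
  · intro i j hij
    simp only [pascal, Matrix.of_apply]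
    rw [Nat.choose_eq_zero_of_lt (by simpa using hij)]
    simp

variable {s k : ℕ} {c : Fin s → ℝ} {A B K : Matrix (Fin s) (Fin s) ℝ}

/-- The forward order conditions express that the scheme integrates polynomials exactly. -/
theorem forward_exact (h : A * vandermondeCols c k
      = B * vandermondeCols c k * (pascal k)⁻¹ + K * vandermondeCols c k * tildeE k)
    {l : ℕ} (hl : l < k) (i : Fin s) :
    ∑ j, A i j * (1 + c j) ^ l
      = ∑ j, B i j * c j ^ l + ∑ j, K i j * (l * (1 + c j) ^ (l - 1)) := by
  have h1 : A * vandermondeCols (fun i => 1 + c i) k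
      = B * vandermondeCols c k + K * (vandermondeCols (fun i => 1 + c i) k * tildeE k) := by
    rw [← vandermondeCols_mul_pascal, ← Matrix.mul_assoc, h, Matrix.add_mul,
      Matrix.nonsing_inv_mul_cancel_right _ _ (isUnit_det_pascal k), Matrix.mul_assoc _ (tildeE k),
      tildeE_mul_pascal]
    simp only [Matrix.mul_assoc]
  have h2 := congrFun (congrFun h1 i) ⟨l, hl⟩
  rw [Matrix.add_apply, Matrix.mul_apply, Matrix.mul_apply, Matrix.mul_apply] at h2
  simp only [vandermondeCols_mul_tildeE_apply] at h2
  exact h2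

theorem adjoint_exact (h : Aᵀ * vandermondeCols c k
      = Bᵀ * vandermondeCols c k * pascal k - Kᵀ * vandermondeCols c k * tildeE k)
    {l : ℕ} (hl : l < k) (i : Fin s) :
    ∑ j, A j i * c j ^ l
      = ∑ j, B j i * (1 + c j) ^ l - ∑ j, K j i * (l * c j ^ (l - 1)) := by
  rw [Matrix.mul_assoc, Matrix.mul_assoc, vandermondeCols_mul_pascal] at h
  have h2 := congrFun (congrFun h i) ⟨l, hl⟩
  rw [Matrix.sub_apply, Matrix.mul_apply, Matrix.mul_apply, Matrix.mul_apply] at h2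
  simp only [vandermondeCols_mul_tildeE_apply, Matrix.transpose_apply] at h2
  exact h2

theorem start_exact {a : Fin s → ℝ} (h : A * vandermondeCols c k
      = Matrix.vecMulVec a (firstUnit k) + K * vandermondeCols c k * tildeE k)
    {l : ℕ} (hl : l < k) (i : Fin s) :
    ∑ j, A i j * c j ^ l = a i * 0 ^ l + ∑ j, K i j * (l * c j ^ (l - 1)) := by
  rw [Matrix.mul_assoc] at h
  have h2 := congrFun (congrFun h i) ⟨l, hl⟩
  rw [Matrix.add_apply, Matrix.mul_apply, Matrix.mul_apply] at h2
  simp only [vandermondeCols_mul_tildeE_apply, Matrix.vecMulVec_apply, firstUnit] at h2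
  rw [zero_pow_eq]
  exact h2

theorem end_exact {w : Fin s → ℝ} (h : Aᵀ * vandermondeCols c k
      = Matrix.vecMulVec w (fun _ => 1) - Kᵀ * vandermondeCols c k * tildeE k)
    {l : ℕ} (hl : l < k) (i : Fin s) :
    ∑ j, A j i * c j ^ l = w i - ∑ j, K j i * (l * c j ^ (l - 1)) := by
  rw [Matrix.mul_assoc] at h
  have h2 := congrFun (congrFun h i) ⟨l, hl⟩
  rw [Matrix.sub_apply, Matrix.mul_apply, Matrix.mul_apply] at h2
  simp only [vandermondeCols_mul_tildeE_apply, Matrix.vecMulVec_apply, mul_one,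
    Matrix.transpose_apply] at h2
  exact h2

end Vandermonde

/-- The common consequence of the one-leg and positivity conditions and of the diagonal form of
the standard method: non-zero columns have positive sums, and the columns, as functionals on the
nodes, reproduce monomials of degree below `q` up to their sums. -/
structure OneLegWeights {s : ℕ} (c : Fin s → ℝ) (K : Matrix (Fin s) (Fin s) ℝ) (q : ℕ) : Prop where
  pos : ∀ j, (∃ i, K i j ≠ 0) → 0 < ∑ i, K i j
  exact : ∀ j, ∀ l < q, ∑ i, K i j * c i ^ l = (∑ i, K i j) * c j ^ l

theorem OneLeg.oneLegWeights {s q : ℕ} {c : Fin s → ℝ} {K : Matrix (Fin s) (Fin s) ℝ}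
    (h : OneLeg c K q) (hpos : ∀ j, 0 < ∑ i, K i j) : OneLegWeights c K q where
  pos j _ := hpos j
  exact j l hl := by
    rcases Nat.eq_zero_or_pos l with rfl | hl0
    · simp
    · have := h (l + 1) (by omega) (by omega) j
      rw [Nat.add_sub_cancel] at this
      rw [← this]
      exact Finset.sum_congr rfl fun i _ => mul_comm _ _

theorem OneLegWeights.of_isDiag {s : ℕ} (q : ℕ) (c : Fin s → ℝ) {K : Matrix (Fin s) (Fin s) ℝ}
    (h : K.IsDiag) (hpos : ∀ j, 0 ≤ ∑ i, K i j) : OneLegWeights c K q := by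
  have hs : ∀ j (x : Fin s → ℝ), ∑ i, K i j * x i = K j j * x j := fun j x =>
    Finset.sum_eq_single_of_mem j (Finset.mem_univ j) fun i _ hij => by rw [h hij, zero_mul]
  have hs1 : ∀ j, ∑ i, K i j = K j j := fun j => by simpa using hs j fun _ => 1
  refine ⟨fun j hj => (hpos j).lt_of_ne fun h0 => ?_, fun j l _ => ?_⟩
  · obtain ⟨i, hi⟩ := hj
    by_cases hij : i = j
    · subst hij
      rw [hs1] at h0
      exact hi h0.symm
    · exact hi (h hij)
  · rw [hs, hs1]

theorem OneLegWeights.normalizedCols_exact {s q : ℕ} {c : Fin s → ℝ}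
    {K : Matrix (Fin s) (Fin s) ℝ} (h : OneLegWeights c K q) {j : Fin s} (hj : ∃ i, K i j ≠ 0)
    {l : ℕ} (hl : l < q) : ∑ i, normalizedCols K i j * c i ^ l = c j ^ l := by
  have hpos := h.pos j hj
  simp only [normalizedCols, Matrix.of_apply, div_mul_eq_mul_div, ← Finset.sum_div]
  rw [h.exact j l hl, mul_div_cancel_left₀ _ hpos.ne']

theorem OneLegWeights.sum_smul_eq {s q : ℕ} {c : Fin s → ℝ} {K : Matrix (Fin s) (Fin s) ℝ}
    (h : OneLegWeights c K q) {E : Type*} [AddCommGroup E] [Module ℝ E] (x : Fin s → E)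
    (j : Fin s) : ∑ i, K i j • x i = (∑ i, K i j) • stageMap (normalizedCols K)ᵀ x j := by
  rw [stageMap_apply, Finset.smul_sum]
  refine Finset.sum_congr rfl fun i _ => ?_
  rw [smul_smul]
  congr 1
  simp only [normalizedCols, Matrix.transpose_apply, Matrix.of_apply]
  by_cases hj : ∃ i, K i j ≠ 0
  · rw [mul_div_cancel₀ _ (h.pos j hj).ne']
  · push Not at hj
    simp [hj]

/-! ### Stability of the Peer triplet -/

namespace PeerTriplet

variable {s : ℕ} (𝒯 : PeerTriplet s)

/-- The matrix `A⁻¹ B` of a triplet with consistent forward and adjoint schemes has the right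
eigenvector `𝟙` and the left eigenvector `𝟙ᵀ A` for the eigenvalue one; their product is fixed to
one by the conditions at the end point. -/
theorem exists_abs_pow_apply_le {q r : ℕ} (hq : 0 < q) (hr : 0 < r)
    (hord : 𝒯.OrderConditions r q) {γ : ℝ} (hγ : γ < 1) (hlam : SecondEigLE (𝒯.A⁻¹ * 𝒯.B) γ) :
    ∃ C : ℝ, ∀ (n : ℕ) (i j : Fin s), |((𝒯.A⁻¹ * 𝒯.B) ^ n) i j| ≤ C := by
  have hf : ∀ i, ∑ j, 𝒯.A i j = ∑ j, 𝒯.B i j := fun i => by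
    simpa using forward_exact hord.standard_forward hr i
  have ha : ∀ i, ∑ j, 𝒯.A j i = ∑ j, 𝒯.B j i := fun i => by
    simpa using adjoint_exact hord.standard_adjoint hq i
  have hl : ∀ i, ∑ j, 𝒯.A j i = ∑ j, 𝒯.B_N j i := fun i => by
    simpa using adjoint_exact hord.last_adjoint hq i
  have hlf : ∀ i, ∑ j, 𝒯.A_N i j = ∑ j, 𝒯.B_N i j := fun i => by
    simpa using forward_exact hord.last_forward hr i
  have he : ∀ i, ∑ j, 𝒯.A_N j i = 𝒯.w i := fun i => by
    simpa using end_exact hord.end_adjoint hq i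
  have hw : ∑ i, 𝒯.w i = 1 := by
    have := congrFun hord.end_forward ⟨0, hr⟩
    simpa [Matrix.vecMul, dotProduct, vandermondeCols] using this
  refine Matrix.exists_abs_pow_apply_le_of_secondEigLE (𝒯.A⁻¹ * 𝒯.B) (fun _ => 1)
    ((fun _ => 1) ᵥ* 𝒯.A) ?_ ?_ ?_ hγ hlam
  · have h1 : 𝒯.B *ᵥ (fun _ => 1) = 𝒯.A *ᵥ (fun _ => 1) := by
      funext i
      simpa [Matrix.mulVec, dotProduct] using (hf i).symm
    rw [← Matrix.mulVec_mulVec, h1, Matrix.mulVec_mulVec, Matrix.nonsing_inv_mul _ 𝒯.A_unit,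
      Matrix.one_mulVec]
  · have h1 : (fun _ => 1) ᵥ* 𝒯.A = (fun _ => 1) ᵥ* 𝒯.B := by
      funext i
      simpa [Matrix.vecMul, dotProduct] using ha i
    rw [← Matrix.vecMul_vecMul, Matrix.vecMul_vecMul _ 𝒯.A, Matrix.mul_nonsing_inv _ 𝒯.A_unit,
      Matrix.vecMul_one, h1]
  · simp only [Matrix.vecMul, dotProduct, one_mul, mul_one]
    rw [← hw]
    simp only [← he]
    rw [Finset.sum_congr rfl fun i _ => hl i, Finset.sum_comm,
      ← Finset.sum_congr rfl fun i _ => hlf i, Finset.sum_comm]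

variable {V : Type*} [AddCommGroup V] [Module ℝ V]

/-- The block lower bidiagonal operator with rows `A_n Y_n - B_n Y_{n-1}`. -/
def stateOp (N : ℕ) : (Fin (N + 1) → Fin s → V) →ₗ[ℝ] (Fin (N + 1) → Fin s → V) :=
  LinearMap.pi (Fin.cases (motive := fun _ => (Fin (N + 1) → Fin s → V) →ₗ[ℝ] (Fin s → V))
    (stageMap (𝒯.An N 0) ∘ₗ LinearMap.proj 0)
    fun n : Fin N => stageMap (𝒯.An N (n + 1)) ∘ₗ LinearMap.proj n.succ
      - stageMap (𝒯.Bn N (n + 1)) ∘ₗ LinearMap.proj n.castSucc)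

/-- The block upper bidiagonal operator with rows `A_nᵀ P_n - B_{n+1}ᵀ P_{n+1}`. -/
def adjointOp (N : ℕ) : (Fin (N + 1) → Fin s → V) →ₗ[ℝ] (Fin (N + 1) → Fin s → V) :=
  LinearMap.pi (Fin.lastCases (motive := fun _ => (Fin (N + 1) → Fin s → V) →ₗ[ℝ] (Fin s → V))
    (stageMap (𝒯.An N N)ᵀ ∘ₗ LinearMap.proj (Fin.last N))
    fun n : Fin N => stageMap (𝒯.An N n)ᵀ ∘ₗ LinearMap.proj n.castSucc
      - stageMap (𝒯.Bn N (n + 1))ᵀ ∘ₗ LinearMap.proj n.succ)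

theorem stateOp_zero (N : ℕ) (x : Fin (N + 1) → Fin s → V) :
    𝒯.stateOp N x 0 = stageMap (𝒯.An N 0) (x 0) := rfl

theorem stateOp_succ (N : ℕ) (x : Fin (N + 1) → Fin s → V) (n : Fin N) :
    𝒯.stateOp N x n.succ = stageMap (𝒯.An N (n + 1)) (x n.succ)
      - stageMap (𝒯.Bn N (n + 1)) (x n.castSucc) := rfl

theorem adjointOp_last (N : ℕ) (x : Fin (N + 1) → Fin s → V) :
    𝒯.adjointOp N x (Fin.last N) = stageMap (𝒯.An N N)ᵀ (x (Fin.last N)) := by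
  simp [adjointOp]

theorem adjointOp_castSucc (N : ℕ) (x : Fin (N + 1) → Fin s → V) (n : Fin N) :
    𝒯.adjointOp N x n.castSucc = stageMap (𝒯.An N n)ᵀ (x n.castSucc)
      - stageMap (𝒯.Bn N (n + 1))ᵀ (x n.succ) := by
  simp [adjointOp]

/-- Both block operators of the triplet are stable, uniformly in the number of steps and in the
space of values. -/
theorem exists_stability (hpow : ∃ C : ℝ, ∀ (n : ℕ) (i j : Fin s),
      |((𝒯.A⁻¹ * 𝒯.B) ^ n) i j| ≤ C) :
    ∃ S : ℝ, 0 < S ∧ ∀ (E : Type) [NormedAddCommGroup E] [NormedSpace ℝ E] (N : ℕ), 2 ≤ N →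
      ∀ x : Fin (N + 1) → Fin s → E, ‖x‖ ≤ S * ∑ n, ‖𝒯.stateOp N x n‖ ∧
        ‖x‖ ≤ S * ∑ n, ‖𝒯.adjointOp N x n‖ := by
  obtain ⟨S₁, hS₁, h₁⟩ := exists_stage_recursion_bound (B₁ := 𝒯.B) (B_N := 𝒯.B_N) 𝒯.A₀_unit
    𝒯.A_unit 𝒯.A_N_unit hpow
  have htr : ∀ {A : Matrix (Fin s) (Fin s) ℝ}, IsUnit A.det → IsUnit Aᵀ.det := fun h => by
    rwa [Matrix.det_transpose]
  have hpow' : ∃ C : ℝ, ∀ (n : ℕ) (i j : Fin s), |((𝒯.Aᵀ⁻¹ * 𝒯.Bᵀ) ^ n) i j| ≤ C := by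
    obtain ⟨C, hC⟩ := hpow
    -- the transposed stability matrix is similar to the transpose of `A⁻¹ B`
    have hsim : ∀ n : ℕ, (𝒯.Aᵀ⁻¹ * 𝒯.Bᵀ) ^ n = (𝒯.A * (𝒯.A⁻¹ * 𝒯.B) ^ n * 𝒯.A⁻¹)ᵀ := by
      intro n
      rw [← Matrix.transpose_nonsing_inv, ← Matrix.transpose_mul, ← Matrix.transpose_pow]
      congr 1
      induction n with
      | zero => rw [pow_zero, pow_zero, mul_one, Matrix.mul_nonsing_inv _ 𝒯.A_unit]
      | succ n ih =>
        rw [pow_succ, ih, pow_succ]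
        simp only [mul_assoc]
    refine ⟨∑ i, ∑ j, ∑ k, ∑ l, |𝒯.A i k| * C * |𝒯.A⁻¹ l j|, fun n i j => ?_⟩
    have hC0 : 0 ≤ C := (abs_nonneg _).trans (hC 0 i j)
    rw [hsim, Matrix.transpose_apply, Matrix.mul_apply]
    have h1 : |∑ l, (𝒯.A * (𝒯.A⁻¹ * 𝒯.B) ^ n) j l * 𝒯.A⁻¹ l i|
        ≤ ∑ k, ∑ l, |𝒯.A j k| * C * |𝒯.A⁻¹ l i| := by
      rw [Finset.sum_comm]
      refine (Finset.abs_sum_le_sum_abs _ _).trans (Finset.sum_le_sum fun l _ => ?_)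
      rw [abs_mul, Matrix.mul_apply, ← Finset.sum_mul]
      refine mul_le_mul_of_nonneg_right ?_ (abs_nonneg _)
      refine (Finset.abs_sum_le_sum_abs _ _).trans (Finset.sum_le_sum fun k _ => ?_)
      rw [abs_mul]
      exact mul_le_mul_of_nonneg_left (hC n k l) (abs_nonneg _)
    refine h1.trans ?_
    have h0 : ∀ i j, 0 ≤ ∑ k, ∑ l, |𝒯.A i k| * C * |𝒯.A⁻¹ l j| := fun i j =>
      Finset.sum_nonneg fun _ _ => Finset.sum_nonneg fun _ _ => by positivity
    exact (Finset.single_le_sum (f := fun i' => ∑ k, ∑ l, |𝒯.A j k| * C * |𝒯.A⁻¹ l i'|)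
      (fun i' _ => h0 j i') (Finset.mem_univ i)).trans
      (Finset.single_le_sum (f := fun j' => ∑ i', ∑ k, ∑ l, |𝒯.A j' k| * C * |𝒯.A⁻¹ l i'|)
      (fun j' _ => Finset.sum_nonneg fun i' _ => h0 j' i') (Finset.mem_univ j))
  obtain ⟨S₂, hS₂, h₂⟩ := exists_stage_recursion_bound (B₁ := 𝒯.B_Nᵀ) (B_N := 𝒯.Bᵀ)
    (htr 𝒯.A_N_unit) (htr 𝒯.A_unit) (htr 𝒯.A₀_unit) hpow'
  refine ⟨S₁ + S₂, by positivity, ?_⟩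
  intro E _ _ N hN x
  obtain ⟨L, rfl⟩ : ∃ L, N = L + 2 := ⟨N - 2, by omega⟩
  have hA : ∀ n, 1 ≤ n → n ≤ L + 1 → 𝒯.An (L + 2) n = 𝒯.A := fun n h1 h2 => by
    rw [An, if_neg (by omega), if_neg (by omega)]
  have hBm : ∀ n, n ≤ L + 1 → 𝒯.Bn (L + 2) n = 𝒯.B := fun n h2 => by
    rw [Bn, if_neg (by omega)]
  have hA0 : 𝒯.An (L + 2) 0 = 𝒯.A₀ := if_pos rfl
  have hAN : 𝒯.An (L + 2) (L + 2) = 𝒯.A_N := by rw [An, if_neg (by omega), if_pos rfl]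
  have hBN : 𝒯.Bn (L + 2) (L + 2) = 𝒯.B_N := if_pos rfl
  have hext : ∀ z : Fin (L + 2 + 1) → Fin s → E, ∀ n (hn : n < L + 2 + 1),
      (if h : n < L + 2 + 1 then z ⟨n, h⟩ else 0) = z ⟨n, hn⟩ := fun z n hn => dif_pos hn
  have hsum : ∀ z : Fin (L + 2 + 1) → Fin s → E,
      ∑ k ∈ Finset.range (L + 3), ‖if h : k < L + 2 + 1 then z ⟨k, h⟩ else 0‖ = ∑ n, ‖z n‖ := by
    intro z
    rw [Finset.sum_range]
    refine Finset.sum_congr rfl fun n _ => ?_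
    rw [hext z n n.2]
  constructor
  · set G := ∑ n, ‖𝒯.stateOp (L + 2) x n‖ with hG
    have hG0 : 0 ≤ G := Finset.sum_nonneg fun _ _ => norm_nonneg _
    have hstep : ∀ n (hn : n < L + 2), stageMap (𝒯.An (L + 2) (n + 1)) (x ⟨n + 1, by omega⟩)
        = stageMap (𝒯.Bn (L + 2) (n + 1)) (x ⟨n, by omega⟩)
          + 𝒯.stateOp (L + 2) x ⟨n + 1, by omega⟩ := by
      intro n hn
      have := 𝒯.stateOp_succ (L + 2) x ⟨n, hn⟩
      simp only [Fin.succ_mk, Fin.castSucc_mk] at this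
      rw [this]
      abel
    have key := h₁ E L (fun n => if h : n < L + 2 + 1 then x ⟨n, h⟩ else 0)
      (fun n => if h : n < L + 2 + 1 then 𝒯.stateOp (L + 2) x ⟨n, h⟩ else 0) ?_ ?_ ?_ ?_
    · rw [hsum, ← hG] at key
      refine (pi_norm_le_iff_of_nonneg (by positivity)).mpr fun n => ?_
      have := key n (by omega)
      simp only [hext x n n.2] at this
      nlinarith
    · simp only [hext _ 0 (by omega)]
      rw [← hA0]
      rfl
    · simp only [hext _ 0 (by omega), hext _ 1 (by omega)]
      rw [← hA 1 le_rfl (by omega), ← hBm 1 (by omega)]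
      exact hstep 0 (by omega)
    · intro n hn1 hnL
      simp only [hext _ n (by omega), hext _ (n + 1) (by omega)]
      rw [← hA (n + 1) (by omega) (by omega), ← hBm (n + 1) (by omega)]
      exact hstep n (by omega)
    · simp only [hext _ (L + 1) (by omega), hext _ (L + 2) (by omega)]
      rw [← hAN, ← hBN]
      exact hstep (L + 1) (by omega)
  · -- the adjoint recursion runs backwards
    set G := ∑ n, ‖𝒯.adjointOp (L + 2) x n‖ with hG
    have hG0 : 0 ≤ G := Finset.sum_nonneg fun _ _ => norm_nonneg _
    have hGrev : ∑ n, ‖𝒯.adjointOp (L + 2) x (Fin.rev n)‖ = G :=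
      Equiv.sum_comp Fin.revPerm fun n => ‖𝒯.adjointOp (L + 2) x n‖
    have hrev : ∀ k n (hk : k < L + 2 + 1) (hn : n < L + 2 + 1), k + n = L + 2 →
        Fin.rev (⟨k, hk⟩ : Fin (L + 2 + 1)) = ⟨n, hn⟩ := by
      intro k n hk hn hkn
      ext
      simp only [Fin.val_rev]
      omega
    have hstep : ∀ n (hn : n < L + 2), stageMap (𝒯.An (L + 2) n)ᵀ (x ⟨n, by omega⟩)
        = stageMap (𝒯.Bn (L + 2) (n + 1))ᵀ (x ⟨n + 1, by omega⟩)
          + 𝒯.adjointOp (L + 2) x ⟨n, by omega⟩ := by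
      intro n hn
      have := 𝒯.adjointOp_castSucc (L + 2) x ⟨n, hn⟩
      simp only [Fin.succ_mk, Fin.castSucc_mk] at this
      rw [this]
      abel
    have key := h₂ E L (fun n => if h : n < L + 2 + 1 then x (Fin.rev ⟨n, h⟩) else 0)
      (fun n => if h : n < L + 2 + 1 then 𝒯.adjointOp (L + 2) x (Fin.rev ⟨n, h⟩) else 0) ?_ ?_ ?_ ?_
    · rw [hsum fun n => 𝒯.adjointOp (L + 2) x (Fin.rev n), hGrev] at key
      refine (pi_norm_le_iff_of_nonneg (by positivity)).mpr fun n => ?_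
      have := key (Fin.rev n) (by omega)
      rw [hext (fun n => x (Fin.rev n)) (Fin.rev n) (Fin.rev n).2, Fin.eta, Fin.rev_rev] at this
      nlinarith
    · rw [hext (fun n => x (Fin.rev n)) 0 (by omega),
        hext (fun n => 𝒯.adjointOp (L + 2) x (Fin.rev n)) 0 (by omega),
        hrev 0 (L + 2) (by omega) (by omega) (by omega), ← hAN]
      exact (𝒯.adjointOp_last (L + 2) x).symm
    · rw [hext (fun n => x (Fin.rev n)) 0 (by omega), hext (fun n => x (Fin.rev n)) 1 (by omega),
        hext (fun n => 𝒯.adjointOp (L + 2) x (Fin.rev n)) 1 (by omega),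
        hrev 0 (L + 2) (by omega) (by omega) (by omega),
        hrev 1 (L + 1) (by omega) (by omega) (by omega), ← hA (L + 1) (by omega) (by omega), ← hBN]
      exact hstep (L + 1) (by omega)
    · intro n hn1 hnL
      obtain ⟨k, hk⟩ : ∃ k, n + (k + 1) = L + 2 := ⟨L + 1 - n, by omega⟩
      rw [hext (fun n => x (Fin.rev n)) n (by omega),
        hext (fun n => x (Fin.rev n)) (n + 1) (by omega),
        hext (fun n => 𝒯.adjointOp (L + 2) x (Fin.rev n)) (n + 1) (by omega),
        hrev n (k + 1) (by omega) (by omega) (by omega),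
        hrev (n + 1) k (by omega) (by omega) (by omega), ← hA k (by omega) (by omega),
        ← hBm (k + 1) (by omega)]
      exact hstep k (by omega)
    · rw [hext (fun n => x (Fin.rev n)) (L + 1) (by omega),
        hext (fun n => x (Fin.rev n)) (L + 2) (by omega),
        hext (fun n => 𝒯.adjointOp (L + 2) x (Fin.rev n)) (L + 2) (by omega),
        hrev (L + 1) 1 (by omega) (by omega) (by omega),
        hrev (L + 2) 0 (by omega) (by omega) (by omega), ← hA0, ← hBm 1 (by omega)]
      exact hstep 0 (by omega)

end PeerTriplet

end

noncomputable section

/-! ### Difference formulas and bounds of the coefficients -/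

/-- The residual of a difference formula which equates two combinations of values with a
combination of derivatives, for bounded nodes and weights. -/
theorem exists_two_term_residual_bound {E : Type*} [NormedAddCommGroup E] [NormedSpace ℝ E]
    {T : ℝ} (hT : 0 < T) (q : ℕ) (g g' : ℝ → E)
    (hg : ContDiffOn ℝ ((q + 1 : ℕ) : WithTop ℕ∞) g (Set.Icc 0 T))
    (hg' : ∀ t ∈ Set.Icc 0 T, HasDerivWithinAt g (g' t) (Set.Icc 0 T) t)
    {κ b : ℝ} (hκ : 0 ≤ κ) (hb : 1 ≤ b) :
    ∃ M : ℝ, 0 ≤ M ∧ ∀ (ι ι' ι'' : Type) [Fintype ι] [Fintype ι'] [Fintype ι''] (α ξ : ι → ℝ)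
      (α' ξ' : ι' → ℝ) (β η : ι'' → ℝ),
      (∀ l ≤ q, ∑ i, α i * ξ i ^ l = ∑ i, α' i * ξ' i ^ l + ∑ k, β k * (l * η k ^ (l - 1))) →
      (∀ i, |ξ i| ≤ b) → (∀ i, |ξ' i| ≤ b) → (∀ k, |η k| ≤ b) →
      ∑ i, |α i| ≤ κ → ∑ i, |α' i| ≤ κ → ∑ k, |β k| ≤ κ →
      ∀ t₀ ∈ Set.Icc 0 T, ∀ h : ℝ, 0 ≤ h → (∀ i, t₀ + ξ i * h ∈ Set.Icc 0 T) →
        (∀ i, t₀ + ξ' i * h ∈ Set.Icc 0 T) → (∀ k, t₀ + η k * h ∈ Set.Icc 0 T) →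
        ‖∑ i, α i • g (t₀ + ξ i * h) - ∑ i, α' i • g (t₀ + ξ' i * h)
            - h • ∑ k, β k • g' (t₀ + η k * h)‖ ≤ M * h ^ (q + 1) := by
  obtain ⟨M, hM, H⟩ := exists_residual_bound hT q g g' hg hg'
  have hb0 : 0 ≤ b := by linarith
  refine ⟨M * (3 * κ * b ^ (q + 1)), by positivity, ?_⟩
  intro ι ι' ι'' _ _ _ α ξ α' ξ' β η hex hξ hξ' hη hα hα' hβ t₀ ht₀ h hh p1 p2 p3
  have key := H (ι ⊕ ι') ι'' (Sum.elim α fun i => -α' i) (Sum.elim ξ ξ') β η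
    (fun l hl => by
      rw [Fintype.sum_sum_type]
      simp only [Sum.elim_inl, Sum.elim_inr, neg_mul, Finset.sum_neg_distrib]
      rw [hex l hl]
      ring) t₀ ht₀ h hh (Sum.rec p1 p2) p3
  rw [Fintype.sum_sum_type, Fintype.sum_sum_type] at key
  simp only [Sum.elim_inl, Sum.elim_inr, neg_smul, Finset.sum_neg_distrib, abs_neg,
    ← sub_eq_add_neg] at key
  have hw : ∀ {J : Type} [Fintype J] (x y : J → ℝ) (n : ℕ), n ≤ q + 1 → (∀ i, |y i| ≤ b) →
      ∑ i, |x i| ≤ κ → ∑ i, |x i| * |y i| ^ n ≤ κ * b ^ (q + 1) := by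
    intro J _ x y n hn hy hx
    refine le_trans (Finset.sum_le_sum fun i _ => mul_le_mul_of_nonneg_left
      ((pow_le_pow_left₀ (abs_nonneg _) (hy i) n).trans (pow_le_pow_right₀ hb hn))
      (abs_nonneg _)) ?_
    rw [← Finset.sum_mul]
    exact mul_le_mul_of_nonneg_right hx (by positivity)
  refine key.trans (mul_le_mul_of_nonneg_right (mul_le_mul_of_nonneg_left ?_ hM) (by positivity))
  have h1 := hw α ξ (q + 1) le_rfl hξ hα
  have h2 := hw α' ξ' (q + 1) le_rfl hξ' hα'
  have h3 := hw β η q (by omega) hη hβ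
  linarith

theorem gradYT_smul {m d : ℕ} (f : Vec m × Vec d → Vec m) (z : Vec m × Vec d) (c : ℝ) (p : Vec m) :
    gradYT f z (c • p) = c • gradYT f z p := map_smul _ _ _

theorem gradUT_smul {m d : ℕ} (f : Vec m × Vec d → Vec m) (z : Vec m × Vec d) (c : ℝ) (p : Vec m) :
    gradUT f z (c • p) = c • gradUT f z p := map_smul _ _ _

theorem gradYT_sub {m d : ℕ} (f : Vec m × Vec d → Vec m) (z : Vec m × Vec d) (p p' : Vec m) :
    gradYT f z (p - p') = gradYT f z p - gradYT f z p' := map_sub _ _ _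

theorem gradUT_sub {m d : ℕ} (f : Vec m × Vec d → Vec m) (z : Vec m × Vec d) (p p' : Vec m) :
    gradUT f z (p - p') = gradUT f z p - gradUT f z p' := map_sub _ _ _

namespace PeerTriplet

variable {s : ℕ} (𝒯 : PeerTriplet s)

/-- A common bound for all coefficient sums of the triplet. -/
def coeffBound : ℝ :=
  1 + ∑ i, |𝒯.a i| + ∑ i, |𝒯.w i| + entrySum 𝒯.A₀ + entrySum 𝒯.A + entrySum 𝒯.A_N
    + entrySum 𝒯.B + entrySum 𝒯.B_N + entrySum 𝒯.K₀ + entrySum 𝒯.K + entrySum 𝒯.K_N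
    + entrySum (normalizedCols 𝒯.K₀) + entrySum (normalizedCols 𝒯.K)
    + entrySum (normalizedCols 𝒯.K_N)

/-- A common bound for the nodes `c_i` and `1 + c_i`. -/
def nodeBound : ℝ := 1 + ∑ i, 𝒯.c i

theorem le_nodeBound (i : Fin s) : 1 + 𝒯.c i ≤ 𝒯.nodeBound :=
  add_le_add_right (Finset.single_le_sum (f := 𝒯.c) (fun j _ => 𝒯.c_nonneg j) (Finset.mem_univ i)) 1

theorem one_le_nodeBound : 1 ≤ 𝒯.nodeBound :=
  le_add_of_nonneg_right (Finset.sum_nonneg fun j _ => 𝒯.c_nonneg j)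

/-- All quantities in the definition of `coeffBound` are bounded by it. -/
theorem coeffBound_spec : 1 ≤ 𝒯.coeffBound ∧ ∑ i, |𝒯.a i| ≤ 𝒯.coeffBound ∧
    ∑ i, |𝒯.w i| ≤ 𝒯.coeffBound ∧ (∀ N n, entrySum (𝒯.An N n) ≤ 𝒯.coeffBound) ∧
    (∀ N n, entrySum (𝒯.Bn N n) ≤ 𝒯.coeffBound) ∧ (∀ N n, entrySum (𝒯.Kn N n) ≤ 𝒯.coeffBound) ∧
    (∀ N n, entrySum (normalizedCols (𝒯.Kn N n)) ≤ 𝒯.coeffBound) := by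
  have ha : 0 ≤ ∑ i, |𝒯.a i| := Finset.sum_nonneg fun _ _ => abs_nonneg _
  have hw : 0 ≤ ∑ i, |𝒯.w i| := Finset.sum_nonneg fun _ _ => abs_nonneg _
  have h1 := entrySum_nonneg 𝒯.A₀
  have h2 := entrySum_nonneg 𝒯.A
  have h3 := entrySum_nonneg 𝒯.A_N
  have h4 := entrySum_nonneg 𝒯.B
  have h5 := entrySum_nonneg 𝒯.B_N
  have h6 := entrySum_nonneg 𝒯.K₀
  have h7 := entrySum_nonneg 𝒯.K
  have h8 := entrySum_nonneg 𝒯.K_N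
  have h9 := entrySum_nonneg (normalizedCols 𝒯.K₀)
  have h10 := entrySum_nonneg (normalizedCols 𝒯.K)
  have h11 := entrySum_nonneg (normalizedCols 𝒯.K_N)
  unfold coeffBound
  refine ⟨by linarith, by linarith, by linarith, fun N n => ?_, fun N n => ?_, fun N n => ?_,
    fun N n => ?_⟩
  · unfold An
    split_ifs <;> linarith
  · unfold Bn
    split_ifs <;> linarith
  · unfold Kn
    split_ifs <;> linarith
  · unfold Kn
    split_ifs <;> linarith

section Exactness

variable {𝒯} {q r : ℕ} (hord : 𝒯.OrderConditions r q)
include hord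

theorem OrderConditions.oneLegWeights (N n : ℕ) : OneLegWeights 𝒯.c (𝒯.Kn N n) q := by
  unfold Kn
  split_ifs
  · exact hord.start_oneLeg.oneLegWeights hord.start_pos
  · exact hord.end_oneLeg.oneLegWeights hord.end_pos
  · exact OneLegWeights.of_isDiag q 𝒯.c 𝒯.K_diag hord.standard_nonneg

theorem OrderConditions.forward_step {N n : ℕ} {l : ℕ} (hl : l < r) (i : Fin s) :
    ∑ j, 𝒯.An N (n + 1) i j * (1 + 𝒯.c j) ^ l = ∑ j, 𝒯.Bn N (n + 1) i j * 𝒯.c j ^ l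
      + ∑ j, 𝒯.Kn N (n + 1) i j * (l * (1 + 𝒯.c j) ^ (l - 1)) := by
  unfold An Bn Kn
  rw [if_neg (Nat.succ_ne_zero n), if_neg (Nat.succ_ne_zero n)]
  split_ifs
  · exact forward_exact hord.last_forward hl i
  · exact forward_exact hord.standard_forward hl i

/-- Exactness of the adjoint steps, with the one-leg form of the derivative term. -/
theorem OrderConditions.adjoint_step {N n : ℕ} (hN : 2 ≤ N) (hn : n < N) {l : ℕ} (hl : l < q)
    (i : Fin s) :
    ∑ j, 𝒯.An N n j i * 𝒯.c j ^ l = ∑ j, 𝒯.Bn N (n + 1) j i * (1 + 𝒯.c j) ^ l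
      - (∑ j, 𝒯.Kn N n j i) * (l * 𝒯.c i ^ (l - 1)) := by
  have h1 : ∑ j, 𝒯.Kn N n j i * (l * 𝒯.c j ^ (l - 1))
      = (∑ j, 𝒯.Kn N n j i) * (l * 𝒯.c i ^ (l - 1)) := by
    have h2 := (hord.oneLegWeights N n).exact i (l - 1) (by omega)
    rw [mul_left_comm, ← h2, Finset.mul_sum]
    exact Finset.sum_congr rfl fun j _ => by ring
  rw [← h1]
  by_cases h0 : n = 0
  · subst h0
    rw [An, Bn, Kn, if_pos rfl, if_neg (by omega), if_pos rfl]
    exact adjoint_exact hord.start_adjoint hl i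
  · have hA : 𝒯.An N n = 𝒯.A := by rw [An, if_neg h0, if_neg hn.ne]
    have hK : 𝒯.Kn N n = 𝒯.K := by rw [Kn, if_neg h0, if_neg hn.ne]
    rw [hA, hK, Bn]
    split_ifs
    · exact adjoint_exact hord.last_adjoint hl i
    · exact adjoint_exact hord.standard_adjoint hl i

theorem OrderConditions.adjoint_last {N : ℕ} (hN : 1 ≤ N) {l : ℕ} (hl : l < q) (i : Fin s) :
    ∑ j, 𝒯.An N N j i * 𝒯.c j ^ l
      = 𝒯.w i - (∑ j, 𝒯.Kn N N j i) * (l * 𝒯.c i ^ (l - 1)) := by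
  have h1 : ∑ j, 𝒯.Kn N N j i * (l * 𝒯.c j ^ (l - 1))
      = (∑ j, 𝒯.Kn N N j i) * (l * 𝒯.c i ^ (l - 1)) := by
    have h2 := (hord.oneLegWeights N N).exact i (l - 1) (by omega)
    rw [mul_left_comm, ← h2, Finset.mul_sum]
    exact Finset.sum_congr rfl fun j _ => by ring
  rw [← h1, An, Kn, if_neg (by omega), if_pos rfl, if_neg (by omega), if_pos rfl]
  exact end_exact hord.end_adjoint hl i

theorem OrderConditions.forward_start {N : ℕ} {l : ℕ} (hl : l < r) (i : Fin s) :
    ∑ j, 𝒯.An N 0 i j * 𝒯.c j ^ l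
      = 𝒯.a i * 0 ^ l + ∑ j, 𝒯.Kn N 0 i j * (l * 𝒯.c j ^ (l - 1)) := by
  rw [An, Kn, if_pos rfl, if_pos rfl]
  exact start_exact hord.start_forward hl i

theorem OrderConditions.end_value {l : ℕ} (hl : l < r) : ∑ j, 𝒯.w j * 𝒯.c j ^ l = 1 := by
  have := congrFun hord.end_forward ⟨l, hl⟩
  simpa [Matrix.vecMul, dotProduct, vandermondeCols] using this

end Exactness

/-! ### The discrete optimality conditions as a grid problem -/

section Grid

variable {m d : ℕ}

/-- The discrete optimality conditions of a triplet as a grid problem, with the values of the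
continuous solution as reference values. -/
def gridProblem (𝒯 : PeerTriplet s) (f : Vec m × Vec d → Vec m) (C : Vec m → ℝ) (y₀ : Vec m)
    (T : ℝ) (y p : ℝ → Vec m) (u : ℝ → Vec d) (N : ℕ) (h : ℝ) :
    GridProblem s N (Vec m) (Vec d) where
  LY := 𝒯.stateOp N
  LP := 𝒯.adjointOp N
  K n := 𝒯.Kn N n
  b := Fin.cases (fun i => 𝒯.a i • y₀) fun _ => 0
  w := 𝒯.w
  grad := gradient C
  gradLin := fderiv ℝ (gradient C) (y T)
  f := f
  gY z := ContinuousLinearMap.adjoint (gradY f z)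
  gU z := ContinuousLinearMap.adjoint (gradU f z)
  ys n j := y (((n : ℕ) + 𝒯.c j) * h)
  ps n j := p (((n : ℕ) + 𝒯.c j) * h)
  us n j := u (((n : ℕ) + 𝒯.c j) * h)
  D n j := fderiv ℝ (fun z => gradUT f z (p (((n : ℕ) + 𝒯.c j) * h)))
    (y (((n : ℕ) + 𝒯.c j) * h), u (((n : ℕ) + 𝒯.c j) * h))
  h := h

variable {𝒯} {f : Vec m × Vec d → Vec m} {C : Vec m → ℝ} {y₀ : Vec m} {T T' : ℝ}
  {y p : ℝ → Vec m} {u : ℝ → Vec d} {N : ℕ} {h : ℝ}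

/-- The residual of the grid problem, row by row. -/
theorem residual_state_zero (z : GridProblem.Unknowns s N (Vec m) (Vec d)) (i : Fin s) :
    ((𝒯.gridProblem f C y₀ T y p u N h).residual z).1 0 i
      = ∑ j, 𝒯.An N 0 i j • z.1 0 j - 𝒯.a i • y₀
        - h • ∑ j, 𝒯.Kn N 0 i j • f (z.1 0 j, z.2.2 0 j) := by
  simp only [GridProblem.residual, gridProblem, Pi.sub_apply, stateOp_zero, stageMap_apply,
    Pi.smul_apply, Fin.cases_zero, Fin.val_zero]

theorem residual_state_succ (z : GridProblem.Unknowns s N (Vec m) (Vec d)) (n : Fin N)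
    (i : Fin s) :
    ((𝒯.gridProblem f C y₀ T y p u N h).residual z).1 n.succ i
      = ∑ j, 𝒯.An N (n + 1) i j • z.1 n.succ j - ∑ j, 𝒯.Bn N (n + 1) i j • z.1 n.castSucc j
        - h • ∑ j, 𝒯.Kn N (n + 1) i j • f (z.1 n.succ j, z.2.2 n.succ j) := by
  simp only [GridProblem.residual, gridProblem, Pi.sub_apply, stateOp_succ, stageMap_apply,
    Pi.smul_apply, Fin.cases_succ, Fin.val_succ, sub_zero]

theorem residual_adjoint_last (z : GridProblem.Unknowns s N (Vec m) (Vec d)) (i : Fin s) :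
    ((𝒯.gridProblem f C y₀ T y p u N h).residual z).2.1 (Fin.last N) i
      = ∑ j, 𝒯.An N N j i • z.2.1 (Fin.last N) j
        - 𝒯.w i • gradient C (∑ j, 𝒯.w j • z.1 (Fin.last N) j)
        - h • (∑ j, 𝒯.Kn N N j i) • gradYT f (z.1 (Fin.last N) i, z.2.2 (Fin.last N) i)
          ((𝒯.gridProblem f C y₀ T y p u N h).mult z.2.1 (Fin.last N) i) := by
  simp only [GridProblem.residual, gridProblem, adjointOp_last, stageMap_apply, if_true,
    Matrix.transpose_apply, GridProblem.colSum, Fin.val_last]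
  rfl

theorem residual_adjoint_castSucc (z : GridProblem.Unknowns s N (Vec m) (Vec d)) (n : Fin N)
    (i : Fin s) :
    ((𝒯.gridProblem f C y₀ T y p u N h).residual z).2.1 n.castSucc i
      = ∑ j, 𝒯.An N n j i • z.2.1 n.castSucc j - ∑ j, 𝒯.Bn N (n + 1) j i • z.2.1 n.succ j
        - h • (∑ j, 𝒯.Kn N n j i) • gradYT f (z.1 n.castSucc i, z.2.2 n.castSucc i)
          ((𝒯.gridProblem f C y₀ T y p u N h).mult z.2.1 n.castSucc i) := by
  simp only [GridProblem.residual, gridProblem, adjointOp_castSucc, stageMap_apply, Pi.sub_apply,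
    if_neg (Fin.castSucc_lt_last n).ne, Matrix.transpose_apply, GridProblem.colSum,
    Fin.val_castSucc, sub_zero]
  rfl

theorem residual_control (z : GridProblem.Unknowns s N (Vec m) (Vec d)) (n : Fin (N + 1))
    {j : Fin s} (hj : 𝒯.Active N n j) :
    ((𝒯.gridProblem f C y₀ T y p u N h).residual z).2.2 n j
      = gradUT f (z.1 n j, z.2.2 n j)
          ((𝒯.gridProblem f C y₀ T y p u N h).mult z.2.1 n j) :=
  if_pos hj

theorem residual_control_blind (z : GridProblem.Unknowns s N (Vec m) (Vec d)) (n : Fin (N + 1))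
    {j : Fin s} (hj : ¬ 𝒯.Active N n j) :
    ((𝒯.gridProblem f C y₀ T y p u N h).residual z).2.2 n j
      = z.2.2 n j - u (((n : ℕ) + 𝒯.c j) * h) :=
  if_neg hj

/-- The multipliers of the adjoint and the control equations are those of the grid problem up to
the column sums. -/
theorem sum_smul_eq_mult {q : ℕ} (hK : ∀ n, OneLegWeights 𝒯.c (𝒯.Kn N n) q)
    (P : Fin (N + 1) → Fin s → Vec m) (n : Fin (N + 1)) (j : Fin s) :
    ∑ i, 𝒯.Kn N n i j • P n i
      = (∑ i, 𝒯.Kn N n i j) • (𝒯.gridProblem f C y₀ T y p u N h).mult P n j :=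
  (hK n).sum_smul_eq (P n) j

/-- Zeros of the residual map solve the discrete optimality conditions. -/
theorem isDiscreteKKT_of_residual_eq_zero {q : ℕ} (hK : ∀ n, OneLegWeights 𝒯.c (𝒯.Kn N n) q)
    {Y P : Fin (N + 1) → Fin s → Vec m} {U : Fin (N + 1) → Fin s → Vec d}
    (hz : (𝒯.gridProblem f C y₀ T y p u N h).residual (Y, P, U) = 0) :
    𝒯.IsDiscreteKKT f C y₀ N h Y P U := by
  have h1 : ∀ n i, ((𝒯.gridProblem f C y₀ T y p u N h).residual (Y, P, U)).1 n i = 0 :=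
    fun n i => by rw [hz]; rfl
  have h2 : ∀ n i, ((𝒯.gridProblem f C y₀ T y p u N h).residual (Y, P, U)).2.1 n i = 0 :=
    fun n i => by rw [hz]; rfl
  have h3 : ∀ n i, ((𝒯.gridProblem f C y₀ T y p u N h).residual (Y, P, U)).2.2 n i = 0 :=
    fun n i => by rw [hz]; rfl
  have hm := sum_smul_eq_mult (f := f) (C := C) (y₀ := y₀) (T := T) (y := y) (p := p) (u := u)
    (h := h) hK P
  constructor
  · intro i
    have := h1 0 i
    rw [residual_state_zero, sub_sub, sub_eq_zero] at this
    exact this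
  · intro n i
    have := h1 n.succ i
    rw [residual_state_succ, sub_sub, sub_eq_zero] at this
    exact this
  · intro i
    have := h2 (Fin.last N) i
    rw [residual_adjoint_last, sub_sub, sub_eq_zero, ← gradYT_smul] at this
    have hmi := hm (Fin.last N) i
    rw [Fin.val_last] at hmi
    rw [hmi]
    exact this
  · intro n i
    have := h2 n.castSucc i
    rw [residual_adjoint_castSucc, sub_sub, sub_eq_zero, ← gradYT_smul] at this
    have hmi := hm n.castSucc i
    rw [Fin.val_castSucc] at hmi
    rw [hmi]
    exact this
  · intro n j
    rw [hm n j, gradUT_smul]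
    by_cases hj : 𝒯.Active N n j
    · have := h3 n j
      rw [residual_control _ _ hj] at this
      rw [this, smul_zero]
    · have h0 : ∑ i, 𝒯.Kn N n i j = 0 := Finset.sum_eq_zero fun i _ => by
        by_contra hne
        exact hj ⟨i, hne⟩
      rw [h0, zero_smul]

open Classical in
/-- A solution of the discrete optimality conditions is a zero of the residual map, once the
controls at the blind stages are replaced by the reference values. -/
theorem residual_eq_zero_of_isDiscreteKKT {q : ℕ} (hK : ∀ n, OneLegWeights 𝒯.c (𝒯.Kn N n) q)
    {Y P : Fin (N + 1) → Fin s → Vec m} {U : Fin (N + 1) → Fin s → Vec d}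
    (hz : 𝒯.IsDiscreteKKT f C y₀ N h Y P U) :
    (𝒯.gridProblem f C y₀ T y p u N h).residual (Y, P, fun n j =>
      if 𝒯.Active N n j then U n j else u (((n : ℕ) + 𝒯.c j) * h)) = 0 := by
  set U' : Fin (N + 1) → Fin s → Vec d := fun n j =>
    if 𝒯.Active N n j then U n j else u (((n : ℕ) + 𝒯.c j) * h) with hU'
  have hm := sum_smul_eq_mult (f := f) (C := C) (y₀ := y₀) (T := T) (y := y) (p := p) (u := u)
    (h := h) hK P
  have hUa : ∀ (n : Fin (N + 1)) j, 𝒯.Active N n j → U' n j = U n j := fun n j hj => if_pos hj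
  -- blind stages enter the sums with zero weights only
  have hsum : ∀ (n : Fin (N + 1)) i, ∑ j, 𝒯.Kn N n i j • f (Y n j, U' n j)
      = ∑ j, 𝒯.Kn N n i j • f (Y n j, U n j) := by
    intro n i
    refine Finset.sum_congr rfl fun j _ => ?_
    by_cases hj : 𝒯.Active N n j
    · rw [hUa n j hj]
    · have : 𝒯.Kn N n i j = 0 := by
        by_contra hne
        exact hj ⟨i, hne⟩
      rw [this, zero_smul, zero_smul]
  have hcol : ∀ (n : Fin (N + 1)) i (v : Vec m),
      (∑ j, 𝒯.Kn N n j i) • gradYT f (Y n i, U' n i) v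
        = (∑ j, 𝒯.Kn N n j i) • gradYT f (Y n i, U n i) v := by
    intro n i v
    by_cases hj : 𝒯.Active N n i
    · rw [hUa n i hj]
    · have : ∑ j, 𝒯.Kn N n j i = 0 := Finset.sum_eq_zero fun j _ => by
        by_contra hne
        exact hj ⟨j, hne⟩
      rw [this, zero_smul, zero_smul]
  refine Prod.ext (funext fun n => funext fun i => ?_)
    (Prod.ext (funext fun n => funext fun i => ?_) (funext fun n => funext fun j => ?_))
  · refine Fin.cases ?_ (fun n => ?_) n
    · rw [residual_state_zero, sub_sub]
      have := hsum 0 i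
      rw [Fin.val_zero] at this
      rw [this, ← hz.state_start i, sub_self]
      rfl
    · rw [residual_state_succ, sub_sub]
      have := hsum n.succ i
      rw [Fin.val_succ] at this
      rw [this, ← hz.state_step n i, sub_self]
      rfl
  · refine Fin.lastCases ?_ (fun n => ?_) n
    · rw [residual_adjoint_last, sub_sub]
      have h1 := hcol (Fin.last N) i
      have h2 := hm (Fin.last N) i
      rw [Fin.val_last] at h1 h2
      rw [h1, ← gradYT_smul, ← h2, ← hz.adjoint_end i, sub_self]
      rfl
    · rw [residual_adjoint_castSucc, sub_sub]
      have h1 := hcol n.castSucc i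
      have h2 := hm n.castSucc i
      rw [Fin.val_castSucc] at h1 h2
      rw [h1, ← gradYT_smul, ← h2, ← hz.adjoint_step n i, sub_self]
      rfl
  · by_cases hj : 𝒯.Active N n j
    · rw [residual_control _ _ hj]
      have h1 := hz.control n j
      rw [hm n j, gradUT_smul] at h1
      have h2 := ((hK n).pos j hj).ne'
      have h3 := (smul_eq_zero.mp h1).resolve_left h2
      simp only [hUa n j hj]
      exact h3
    · rw [residual_control_blind _ _ hj]
      simp only [hU', if_neg hj, sub_self]
      rfl

end Grid

end PeerTriplet

end

noncomputable section

/-! ### Consistency -/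

namespace PeerTriplet

variable {s : ℕ} {𝒯 : PeerTriplet s} {q r : ℕ} {m d : ℕ} {f : Vec m × Vec d → Vec m}
  {C : Vec m → ℝ} {y₀ : Vec m} {T T' : ℝ} {y p : ℝ → Vec m} {u : ℝ → Vec d}

/-- Consistency: the residual of the exact solution is of order `h ^ (q + 1)` per step, and the
multipliers formed from the exact adjoint are accurate to the same order at active stages. -/
theorem exists_consistency (hord : 𝒯.OrderConditions r (q + 1)) (hqr : q + 1 ≤ r)
    (hC : IsQuadraticPoly C) (hT : 0 ≤ T) (hT' : 0 < T')
    (hKKT : IsKKTSolution f C y₀ T T' y p u)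
    (hy : ContDiffOn ℝ ((q + 1 : ℕ) : WithTop ℕ∞) y (Set.Icc 0 T'))
    (hp : ContDiffOn ℝ ((q + 1 : ℕ) : WithTop ℕ∞) p (Set.Icc 0 T'))
    {Λ₁ : ℝ} (hΛ₁ : 0 ≤ Λ₁)
    (hgY : ∀ t ∈ Set.Icc 0 T', ∀ v, ‖gradYT f (y t, u t) v‖ ≤ Λ₁ * ‖v‖)
    (hgU : ∀ t ∈ Set.Icc 0 T', ∀ v, ‖gradUT f (y t, u t) v‖ ≤ Λ₁ * ‖v‖) :
    ∃ M : ℝ, 0 ≤ M ∧ ∀ (N : ℕ) (h : ℝ), 2 ≤ N → 0 ≤ h → h ≤ 1 → (N + 1) * h = T → T ≤ T' →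
      (∀ n ≤ N, ∀ j, ((n : ℝ) + 𝒯.c j) * h ∈ Set.Icc 0 T') →
      (∀ (n : Fin (N + 1)) j, 𝒯.Active N n j →
        ‖(𝒯.gridProblem f C y₀ T y p u N h).mult (𝒯.gridProblem f C y₀ T y p u N h).ps n j
          - p (((n : ℕ) + 𝒯.c j) * h)‖ ≤ M * h ^ (q + 1)) ∧
      (∀ n i, ‖((𝒯.gridProblem f C y₀ T y p u N h).residual
        (𝒯.gridProblem f C y₀ T y p u N h).ref).1 n i‖ ≤ M * h ^ (q + 1)) ∧
      (∀ n i, ‖((𝒯.gridProblem f C y₀ T y p u N h).residual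
        (𝒯.gridProblem f C y₀ T y p u N h).ref).2.1 n i‖ ≤ M * h ^ (q + 1)) ∧
      (∀ n j, ‖((𝒯.gridProblem f C y₀ T y p u N h).residual
        (𝒯.gridProblem f C y₀ T y p u N h).ref).2.2 n j‖ ≤ M * h ^ (q + 1)) := by
  obtain ⟨hκ1, hκa, hκw, hκA, hκB, hκK, hκn⟩ := 𝒯.coeffBound_spec
  set κ := 𝒯.coeffBound
  have hκ : 0 ≤ κ := by linarith
  set Γ := ‖fderiv ℝ (gradient C) (y T)‖ with hΓ
  have hΓ0 : 0 ≤ Γ := norm_nonneg _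
  obtain ⟨My, hMy, Hy⟩ := exists_two_term_residual_bound hT' q y (fun t => f (y t, u t)) hy
    hKKT.state hκ 𝒯.one_le_nodeBound
  obtain ⟨Mp, hMp, Hp⟩ := exists_two_term_residual_bound hT' q p
    (fun t => -gradYT f (y t, u t) (p t)) hp hKKT.adjoint hκ 𝒯.one_le_nodeBound
  have hrow : ∀ {A : Matrix (Fin s) (Fin s) ℝ}, entrySum A ≤ κ → ∀ i, ∑ j, |A i j| ≤ κ :=
    fun hA i => (sum_abs_row_le_entrySum _ i).trans hA
  have hcolm : ∀ {A : Matrix (Fin s) (Fin s) ℝ}, entrySum A ≤ κ → ∀ i, ∑ j, |A j i| ≤ κ :=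
    fun {A} hA i => (sum_abs_row_le_entrySum Aᵀ i).trans (by rwa [entrySum_transpose])
  have hc0 : ∀ i, |𝒯.c i| ≤ 𝒯.nodeBound := fun i => by
    rw [abs_of_nonneg (𝒯.c_nonneg i)]
    linarith [𝒯.le_nodeBound i]
  have hc1 : ∀ i, |1 + 𝒯.c i| ≤ 𝒯.nodeBound := fun i => by
    rw [abs_of_nonneg (by linarith [𝒯.c_nonneg i])]
    exact 𝒯.le_nodeBound i
  have hn0 : |(0 : ℝ)| ≤ 𝒯.nodeBound := by
    rw [abs_zero]
    linarith [𝒯.one_le_nodeBound]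
  have hn1 : |(1 : ℝ)| ≤ 𝒯.nodeBound := by
    rw [abs_one]
    exact 𝒯.one_le_nodeBound
  have hκ1' : |(1 : ℝ)| ≤ κ := by rwa [abs_one]
  have habsle : ∀ (x : Fin s → ℝ), ∑ i, |x i| ≤ κ → ∀ i, |x i| ≤ κ := fun x hx i =>
    (Finset.single_le_sum (f := fun i => |x i|) (fun _ _ => abs_nonneg _)
      (Finset.mem_univ i)).trans hx
  refine ⟨My + Mp + κ * Λ₁ * Mp + κ * Γ * My + Λ₁ * Mp, by positivity, ?_⟩
  intro N h hN hh0 hh1 hNT hTT hgrid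
  set 𝒢 := 𝒯.gridProblem f C y₀ T y p u N h with h𝒢
  set H := h ^ (q + 1) with hH
  have hH0 : 0 ≤ H := by positivity
  have e1 : 0 ≤ My * H := by positivity
  have e2 : 0 ≤ Mp * H := by positivity
  have e3 : 0 ≤ κ * Λ₁ * Mp * H := by positivity
  have e4 : 0 ≤ κ * Γ * My * H := by positivity
  have e5 : 0 ≤ Λ₁ * Mp * H := by positivity
  have hbase : ∀ n ≤ N, (n : ℝ) * h ∈ Set.Icc 0 T' := fun n hn => by
    refine ⟨by positivity, ?_⟩
    have : (n : ℝ) ≤ N := by exact_mod_cast hn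
    nlinarith
  have hgc : ∀ n ≤ N, ∀ j, (n : ℝ) * h + 𝒯.c j * h ∈ Set.Icc 0 T' := fun n hn j => by
    rw [← add_mul]
    exact hgrid n hn j
  have hg1c : ∀ n < N, ∀ j, (n : ℝ) * h + (1 + 𝒯.c j) * h ∈ Set.Icc 0 T' := fun n hn j => by
    have := hgrid (n + 1) hn j
    push_cast at this
    rwa [add_assoc, add_mul] at this
  have hend : (N : ℝ) * h + 1 * h = T := by rw [← hNT]; ring
  have hendmem : (N : ℝ) * h + 1 * h ∈ Set.Icc 0 T' := by rw [hend]; exact ⟨hT, hTT⟩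
  have hnode : ∀ (n : ℕ) j, (n : ℝ) * h + 𝒯.c j * h = ((n : ℝ) + 𝒯.c j) * h := fun n j => by ring
  have hnode1 : ∀ (n : ℕ) j, (n : ℝ) * h + (1 + 𝒯.c j) * h = (((n + 1 : ℕ) : ℝ) + 𝒯.c j) * h :=
    fun n j => by push_cast; ring
  -- the one-leg weights reproduce low-degree monomials, so that the weighted mean of `p` over the
  -- stages differs from its value at the node by the residual of an interpolation formula
  have hmult : ∀ (n : Fin (N + 1)) j, 𝒯.Active N n j →
      ‖𝒢.mult 𝒢.ps n j - p (((n : ℕ) + 𝒯.c j) * h)‖ ≤ Mp * H := by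
    intro n j hj
    have key := Hp (Fin s) Unit Empty (fun i => normalizedCols (𝒯.Kn N n) i j) 𝒯.c (fun _ => 1)
      (fun _ => 𝒯.c j) Empty.elim Empty.elim
      (fun l hl => by
        have := (hord.oneLegWeights N n).normalizedCols_exact hj (l := l) (by omega)
        simpa using this)
      hc0 (fun _ => hc0 j) (fun k => k.elim) (hcolm (hκn N n) j) (by simpa using hκ1)
      (by simpa using hκ) _ (hbase n (Nat.lt_succ_iff.mp n.2)) h hh0
      (hgc n (Nat.lt_succ_iff.mp n.2)) (fun _ => hgc n (Nat.lt_succ_iff.mp n.2) j)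
      (fun k => k.elim)
    simp only [Finset.univ_unique, Finset.sum_singleton, one_smul, Finset.univ_eq_empty,
      Finset.sum_empty, smul_zero, sub_zero, hnode] at key
    refine le_trans (le_of_eq (congrArg _ ?_)) key
    simp [GridProblem.mult, h𝒢, gridProblem]
  -- in an adjoint row, the multiplier may be replaced by the value of `p` at the node; at a blind
  -- stage the multiplier has no meaning, but its factor vanishes
  have hgYdiff : ∀ (n : Fin (N + 1)) i (v : Vec m),
      ‖v - h • (∑ j, 𝒯.Kn N n j i) • gradYT f
        (y (((n : ℕ) + 𝒯.c i) * h), u (((n : ℕ) + 𝒯.c i) * h)) (p (((n : ℕ) + 𝒯.c i) * h))‖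
          ≤ Mp * H + κ * Γ * My * H →
      ‖v - h • (∑ j, 𝒯.Kn N n j i) • gradYT f
        (y (((n : ℕ) + 𝒯.c i) * h), u (((n : ℕ) + 𝒯.c i) * h)) (𝒢.mult 𝒢.ps n i)‖
          ≤ (My + Mp + κ * Λ₁ * Mp + κ * Γ * My + Λ₁ * Mp) * H := by
    intro n i v hv
    by_cases hj : 𝒯.Active N n i
    · set t := ((n : ℕ) + 𝒯.c i) * h with ht
      have hdiff : ‖h • (∑ j, 𝒯.Kn N n j i) • gradYT f (y t, u t) (𝒢.mult 𝒢.ps n i - p t)‖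
          ≤ κ * Λ₁ * Mp * H := by
        rw [norm_smul, norm_smul, Real.norm_eq_abs, Real.norm_eq_abs, abs_of_nonneg hh0]
        have h1 : |∑ j, 𝒯.Kn N n j i| ≤ κ := (abs_colSum_le_entrySum _ _).trans (hκK N n)
        have h2 := (hgY t (hgrid n (Nat.lt_succ_iff.mp n.2) i) (𝒢.mult 𝒢.ps n i - p t)).trans
          (mul_le_mul_of_nonneg_left (hmult n i hj) hΛ₁)
        have h3 := mul_le_mul h1 h2 (norm_nonneg _) hκ
        have h4 : 0 ≤ |∑ j, 𝒯.Kn N n j i| * ‖gradYT f (y t, u t) (𝒢.mult 𝒢.ps n i - p t)‖ := by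
          positivity
        refine (mul_le_of_le_one_left h4 hh1).trans (h3.trans (le_of_eq ?_))
        ring
      have e : v - h • (∑ j, 𝒯.Kn N n j i) • gradYT f (y t, u t) (𝒢.mult 𝒢.ps n i)
          = (v - h • (∑ j, 𝒯.Kn N n j i) • gradYT f (y t, u t) (p t))
            - h • (∑ j, 𝒯.Kn N n j i) • gradYT f (y t, u t) (𝒢.mult 𝒢.ps n i - p t) := by
        rw [gradYT_sub, smul_sub, smul_sub]
        abel
      rw [e]
      refine (norm_sub_le _ _).trans ((add_le_add hv hdiff).trans ?_)
      linarith
    · have h0 : ∑ j, 𝒯.Kn N n j i = 0 := Finset.sum_eq_zero fun j _ => by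
        by_contra hne
        exact hj ⟨j, hne⟩
      rw [h0, zero_smul, smul_zero, sub_zero] at hv ⊢
      linarith
  have hcolK : ∀ n i, |∑ j, 𝒯.Kn N n j i| ≤ κ := fun n i =>
    (abs_colSum_le_entrySum _ _).trans (hκK N n)
  refine ⟨fun n j hj => (hmult n j hj).trans (by linarith), ?_, ?_, ?_⟩
  · intro n i
    suffices hs : ‖(𝒢.residual 𝒢.ref).1 n i‖ ≤ My * H by linarith
    refine Fin.cases ?_ (fun n => ?_) n
    · have key := Hy (Fin s) Unit (Fin s) (𝒯.An N 0 i) 𝒯.c (fun _ => 𝒯.a i) (fun _ => 0)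
        (𝒯.Kn N 0 i) 𝒯.c
        (fun l hl => by
          have := hord.forward_start (N := N) (l := l) (by omega) i
          simpa using this)
        hc0 (fun _ => hn0) hc0 (hrow (hκA N 0) i) (by simpa using habsle _ hκa i)
        (hrow (hκK N 0) i) _ (hbase 0 (by omega)) h hh0 (hgc 0 (by omega))
        (fun _ => by rw [zero_mul, add_zero]; exact hbase 0 (by omega)) (hgc 0 (by omega))
      refine le_trans (le_of_eq (congrArg _ ?_)) key
      rw [h𝒢, residual_state_zero]
      simp only [Finset.univ_unique, Finset.sum_singleton, hnode]
      have hy0 : y (((0 : ℕ) : ℝ) * h + 0 * h) = y₀ := by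
        rw [← hKKT.init]
        congr 1
        simp
      rw [hy0]
      rfl
    · have key := Hy (Fin s) (Fin s) (Fin s) (𝒯.An N (n + 1) i) (fun j => 1 + 𝒯.c j)
        (𝒯.Bn N (n + 1) i) 𝒯.c (𝒯.Kn N (n + 1) i) (fun j => 1 + 𝒯.c j)
        (fun l hl => hord.forward_step (by omega) i)
        hc1 hc0 hc1 (hrow (hκA N _) i) (hrow (hκB N _) i) (hrow (hκK N _) i)
        _ (hbase n n.2.le) h hh0 (hg1c n n.2) (hgc n n.2.le) (hg1c n n.2)
      refine le_trans (le_of_eq (congrArg _ ?_)) key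
      rw [h𝒢, residual_state_succ]
      simp only [hnode, hnode1]
      rfl
  · intro n i
    refine Fin.lastCases ?_ (fun n => ?_) n
    · rw [h𝒢, residual_adjoint_last]
      refine hgYdiff (Fin.last N) i _ ?_
      have key := Hp (Fin s) Unit Unit (fun j => 𝒯.An N N j i) 𝒯.c (fun _ => 𝒯.w i) (fun _ => 1)
        (fun _ => -∑ j, 𝒯.Kn N N j i) (fun _ => 𝒯.c i)
        (fun l hl => by
          have := hord.adjoint_last (N := N) (by omega) (l := l) (by omega) i
          simpa [← sub_eq_add_neg] using this)
        hc0 (fun _ => hn1) (fun _ => hc0 i) (hcolm (hκA N N) i) (by simpa using habsle _ hκw i)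
        (by simpa using hcolK N i) _ (hbase N le_rfl) h hh0 (hgc N le_rfl) (fun _ => hendmem)
        (fun _ => hgc N le_rfl i)
      have keyw := Hy (Fin s) Unit Empty 𝒯.w 𝒯.c (fun _ => 1) (fun _ => 1) Empty.elim Empty.elim
        (fun l hl => by
          have := hord.end_value (l := l) (by omega)
          simpa using this)
        hc0 (fun _ => hn1) (fun k => k.elim) hκw (by simpa using hκ1) (by simpa using hκ)
        _ (hbase N le_rfl) h hh0 (hgc N le_rfl) (fun _ => hendmem) (fun k => k.elim)
      simp only [Finset.univ_unique, Finset.sum_singleton, one_smul, Finset.univ_eq_empty,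
        Finset.sum_empty, smul_zero, sub_zero, hnode, hend] at keyw
      simp only [Finset.univ_unique, Finset.sum_singleton, hnode, hend, smul_neg, neg_smul,
        neg_neg] at key
      -- the interpolated end value `Yw` of the state enters through the affine gradient of `C`
      set Yw := ∑ j, 𝒯.w j • y ((N + 𝒯.c j) * h) with hYw
      have hgrad : ‖𝒯.w i • (gradient C Yw - gradient C (y T))‖ ≤ κ * Γ * My * H := by
        rw [norm_smul, Real.norm_eq_abs, hC.gradient_sub (y T)]
        have h1 := ((fderiv ℝ (gradient C) (y T)).le_opNorm (Yw - y T)).trans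
          (mul_le_mul_of_nonneg_left keyw hΓ0)
        refine (mul_le_mul (habsle _ hκw i) h1 (norm_nonneg _) hκ).trans (le_of_eq ?_)
        ring
      refine le_trans ?_ ((norm_sub_le _ _).trans (add_le_add key hgrad))
      refine le_of_eq (congrArg _ ?_)
      have e : ∀ a b c e : Vec m, a - b - c = a - e - c - (b - e) := fun a b c e => by abel
      rw [smul_sub, ← hKKT.final]
      exact e _ _ _ _
    · rw [h𝒢, residual_adjoint_castSucc]
      refine hgYdiff n.castSucc i _ ?_
      have key := Hp (Fin s) (Fin s) Unit (fun j => 𝒯.An N n j i) 𝒯.c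
        (fun j => 𝒯.Bn N (n + 1) j i) (fun j => 1 + 𝒯.c j)
        (fun _ => -∑ j, 𝒯.Kn N n j i) (fun _ => 𝒯.c i)
        (fun l hl => by
          have := hord.adjoint_step (N := N) hN n.2 (l := l) (by omega) i
          simpa [← sub_eq_add_neg] using this)
        hc0 hc1 (fun _ => hc0 i) (hcolm (hκA N n) i) (hcolm (hκB N _) i)
        (by simpa using hcolK n i) _ (hbase n n.2.le) h hh0 (hgc n n.2.le) (hg1c n n.2)
        (fun _ => hgc n n.2.le i)
      simp only [Finset.univ_unique, Finset.sum_singleton, hnode, hnode1, smul_neg, neg_smul,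
        neg_neg] at key
      exact key.trans (by linarith)
  · intro n j
    by_cases hj : 𝒯.Active N n j
    · rw [h𝒢, residual_control _ _ hj]
      set t := ((n : ℕ) + 𝒯.c j) * h with ht
      have htm := hgrid n (Nat.lt_succ_iff.mp n.2) j
      change ‖gradUT f (y t, u t) (𝒢.mult 𝒢.ps n j)‖ ≤ _
      have e : gradUT f (y t, u t) (𝒢.mult 𝒢.ps n j)
          = gradUT f (y t, u t) (𝒢.mult 𝒢.ps n j - p t) := by
        rw [gradUT_sub, hKKT.control t htm, sub_zero]
      rw [e]
      refine ((hgU t htm _).trans (mul_le_mul_of_nonneg_left (hmult n j hj) hΛ₁)).trans ?_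
      linarith
    · rw [h𝒢, residual_control_blind _ _ hj]
      change ‖u _ - u _‖ ≤ _
      rw [sub_self, norm_zero]
      positivity

end PeerTriplet

end

noncomputable section

/-! ### Choice of the constants and convergence -/

/-- The smallness conditions of the fixed point argument follow from those on the time interval,
once the constants `ζ` are chosen as multiples of
`b = S² κ³ + S κ² + S κ`, where `S` is the stability constant and `κ` the coefficient bound. -/
theorem contraction_constants {S κ Λ₁ Λ₂ Γ T ω b : ℝ} (hS : 0 ≤ S) (hκ : 1 ≤ κ) (hΛ₁ : 0 ≤ Λ₁)
    (hΛ₂ : 0 ≤ Λ₂) (hΓ : 0 ≤ Γ) (hT : 0 ≤ T) (hω : 0 ≤ ω)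
    (hb : b = S ^ 2 * κ ^ 3 + S * κ ^ 2 + S * κ)
    (h1 : (2 * b * Λ₁ + 2 * b * Λ₂ + 2 * b * Γ * Λ₁) * T ≤ 2 / 3)
    (h2 : (4 * κ * b * (1 + Γ) * Λ₁ + 4 * κ * b * Λ₂) * Λ₁ * T * ω ≤ 1 / 3) :
    S * (T * (κ * Λ₁)) ≤ 1 / 2 ∧
    S * (κ ^ 2 * Γ * (S * (T * (κ * Λ₁))) + T * (κ * (κ * Λ₁ + Λ₂))) ≤ 1 / 2 ∧
    ω * (κ * Λ₁ * (S * (κ ^ 2 * Γ * (S * (T * (κ * Λ₁))) + T * (κ * (κ * Λ₁ + Λ₂))))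
      + Λ₂ * (S * (T * (κ * Λ₁)))) ≤ 1 / 6 := by
  have hκ0 : 0 ≤ κ := by linarith
  have hb0 : 0 ≤ b := by rw [hb]; positivity
  set α := S * (T * (κ * Λ₁)) with hα
  set β := S * (κ ^ 2 * Γ * α + T * (κ * (κ * Λ₁ + Λ₂))) with hβ
  set E := (Λ₁ + Λ₂ + Γ * Λ₁) * T with hE
  have hE0 : 0 ≤ E := by positivity
  have c1 : S * κ ≤ b := by
    rw [hb]
    have : 0 ≤ S ^ 2 * κ ^ 3 + S * κ ^ 2 := by positivity
    linarith
  have c2 : S * κ ^ 2 ≤ b := by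
    rw [hb]
    have : 0 ≤ S ^ 2 * κ ^ 3 + S * κ := by positivity
    linarith
  have c3 : S ^ 2 * κ ^ 3 ≤ b := by
    rw [hb]
    have : 0 ≤ S * κ ^ 2 + S * κ := by positivity
    linarith
  have hα' : α ≤ b * (Λ₁ * T) := by
    have := mul_le_mul_of_nonneg_right c1 (mul_nonneg hΛ₁ hT)
    calc α = S * κ * (Λ₁ * T) := by rw [hα]; ring
      _ ≤ _ := this
  have hβ' : β ≤ b * E := by
    have t1 := mul_le_mul_of_nonneg_right c3 (mul_nonneg (mul_nonneg hΓ hΛ₁) hT)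
    have t2 := mul_le_mul_of_nonneg_right c2 (mul_nonneg hΛ₁ hT)
    have t3 := mul_le_mul_of_nonneg_right c1 (mul_nonneg hΛ₂ hT)
    calc β = S ^ 2 * κ ^ 3 * (Γ * Λ₁ * T) + S * κ ^ 2 * (Λ₁ * T) + S * κ * (Λ₂ * T) := by
          rw [hβ, hα]; ring
      _ ≤ b * (Γ * Λ₁ * T) + b * (Λ₁ * T) + b * (Λ₂ * T) := by linarith
      _ = b * E := by rw [hE]; ring
  have hbE : b * E ≤ 1 / 3 := by
    have : (2 * b * Λ₁ + 2 * b * Λ₂ + 2 * b * Γ * Λ₁) * T = 2 * (b * E) := by rw [hE]; ring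
    linarith
  have hαE : b * (Λ₁ * T) ≤ b * E := by
    refine mul_le_mul_of_nonneg_left ?_ hb0
    have t1 : 0 ≤ Λ₂ * T := by positivity
    have t2 : 0 ≤ Γ * Λ₁ * T := by positivity
    rw [hE]
    linarith
  refine ⟨by linarith, by linarith, ?_⟩
  have t1 : κ * Λ₁ * β ≤ κ * Λ₁ * (b * E) := mul_le_mul_of_nonneg_left hβ' (by positivity)
  have t2 : Λ₂ * α ≤ κ * (Λ₂ * (b * (Λ₁ * T))) :=
    (mul_le_mul_of_nonneg_left hα' hΛ₂).trans (le_mul_of_one_le_left (by positivity) hκ)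
  have t3 : 0 ≤ κ * Λ₁ * b * ((1 + Γ) * Λ₁) * T * ω := by positivity
  have t4 := mul_le_mul_of_nonneg_left (add_le_add t1 t2) hω
  have e : (4 * κ * b * (1 + Γ) * Λ₁ + 4 * κ * b * Λ₂) * Λ₁ * T * ω
      = 2 * (ω * (κ * Λ₁ * (b * E) + κ * (Λ₂ * (b * (Λ₁ * T)))))
        + 2 * (κ * Λ₁ * b * ((1 + Γ) * Λ₁) * T * ω) := by
    rw [hE]; ring
  linarith

/-- The points of the grid lie in the interval on which the solution is given, for small steps. -/
theorem PeerTriplet.node_mem_Icc {s : ℕ} (𝒯 : PeerTriplet s) {T T' h : ℝ} {N : ℕ} (hh : 0 ≤ h)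
    (hN : (N + 1) * h = T) (hTT : T ≤ T') (hc : T + 𝒯.nodeBound * h ≤ T' ∨ ∀ i, 𝒯.c i ≤ 1)
    {n : ℕ} (hn : n ≤ N) (j : Fin s) : ((n : ℝ) + 𝒯.c j) * h ∈ Set.Icc 0 T' := by
  have hc0 := 𝒯.c_nonneg j
  have hn' : (n : ℝ) ≤ N := by exact_mod_cast hn
  refine ⟨by positivity, ?_⟩
  rcases hc with hc | hc
  · have h1 := mul_le_mul_of_nonneg_right hn' hh
    have h2 := mul_le_mul_of_nonneg_right (𝒯.le_nodeBound j) hh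
    linarith
  · have h1 := mul_le_mul_of_nonneg_right (add_le_add hn' (hc j)) hh
    linarith

set_option maxHeartbeats 2000000 in
theorem mainTheorem1 {s : ℕ} (𝒯 : PeerTriplet s) (q r : ℕ) (hq : 2 ≤ q) (hqr : q ≤ r) (hrs : r ≤ s)
    (hord : 𝒯.OrderConditions r q)
    (γ : ℝ) (hγ : γ < 1) (hlam : SecondEigLE (𝒯.A⁻¹ * 𝒯.B) γ)
    (hμ₀ : PosRealEigs 𝒯.K₀ 𝒯.A₀) (hμN : PosRealEigs 𝒯.K_N 𝒯.A_N) :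
    ∃ ζP₁ ζP₂ ζPc ζU₁ ζU₂ : ℝ, 0 < ζP₁ ∧ 0 < ζP₂ ∧ 0 < ζPc ∧ 0 < ζU₁ ∧ 0 < ζU₂ ∧
      ∀ (m d : ℕ) (f : Vec m × Vec d → Vec m) (C : Vec m → ℝ) (y₀ : Vec m) (T T' : ℝ)
        (y p : ℝ → Vec m) (u : ℝ → Vec d) (ρ ε ω Λ₁ Λ₂ Λ₃ Γ : ℝ),
        0 < T → T ≤ T' → (T < T' ∨ ∀ i, 𝒯.c i ≤ 1) →
        IsQuadraticPoly C → Γ = ‖fderiv ℝ (gradient C) (y T)‖ →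
        IsKKTSolution f C y₀ T T' y p u →
        ContDiffOn ℝ q y (Set.Icc 0 T') → ContDiffOn ℝ q p (Set.Icc 0 T') →
        ContDiffOn ℝ q u (Set.Icc 0 T') →
        0 < ε → ε < 1 → ControlHessianBound f T' y p u ε ω →
        0 < ρ → SmoothnessBounds f T' y p u ρ Λ₁ Λ₂ Λ₃ →
        (ζP₁ * Λ₁ + ζP₂ * Λ₂ + ζPc * Γ * Λ₁) * T ≤ 2 / 3 →
        (ζU₁ * (1 + Γ) * Λ₁ + ζU₂ * Λ₂) * Λ₁ * T * ω ≤ 1 / 3 →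
        ∃ δ h₀ M : ℝ, 0 < δ ∧ 0 < h₀ ∧
          ∀ (N : ℕ) (h : ℝ), h = T / (N + 1) → h ≤ h₀ →
            ∃ (Y P : Fin (N + 1) → Fin s → Vec m) (U : Fin (N + 1) → Fin s → Vec d),
              𝒯.IsDiscreteKKT f C y₀ N h Y P U ∧
              𝒯.ErrorLE y p u N h Y P U δ ∧
              𝒯.ErrorLE y p u N h Y P U (M * h ^ (q - 1)) ∧
              ∀ (Y' P' : Fin (N + 1) → Fin s → Vec m) (U' : Fin (N + 1) → Fin s → Vec d),
                𝒯.IsDiscreteKKT f C y₀ N h Y' P' U' → 𝒯.ErrorLE y p u N h Y' P' U' δ →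
                  Y' = Y ∧ P' = P ∧ ∀ (n : Fin (N + 1)) (j : Fin s), 𝒯.Active N n j → U' n j = U n j := by
  classical
  obtain ⟨q, rfl⟩ : ∃ k, q = k + 1 := ⟨q - 1, by omega⟩
  obtain ⟨S, hS, hstab⟩ := 𝒯.exists_stability
    (𝒯.exists_abs_pow_apply_le (by omega) (by omega) hord hγ hlam)
  obtain ⟨hκ1, -, hκw, -, -, hκK, hκn⟩ := 𝒯.coeffBound_spec
  set κ := 𝒯.coeffBound with hκdef
  have hκ0 : 0 < κ := by linarith
  set b := S ^ 2 * κ ^ 3 + S * κ ^ 2 + S * κ with hb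
  have hb0 : 0 < b := by positivity
  refine ⟨2 * b, 2 * b, 2 * b, 4 * κ * b, 4 * κ * b, by positivity, by positivity, by positivity,
    by positivity, by positivity, ?_⟩
  intro m d f C y₀ T T' y p u ρ ε ω Λ₁ Λ₂ Λ₃ Γ hT hTT hcT hC hΓ hKKT hy hp _ hε _ hH hρ hS3 hζP hζU
  have hT' : 0 < T' := hT.trans_le hTT
  have h0mem : (0 : ℝ) ∈ Set.Icc 0 T' := ⟨le_rfl, hT'.le⟩
  obtain ⟨hΛ₁, hΛ₂, hΛ₃⟩ := (hS3.pointSmoothness h0mem).nonneg hρ.le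
  have hΓ0 : 0 ≤ Γ := by rw [hΓ]; exact norm_nonneg _
  have hω : 0 ≤ ω := by
    obtain ⟨L, -, hL⟩ := hH 0 h0mem (p 0) (by rw [sub_self, norm_zero]; exact hε.le)
    exact (norm_nonneg (L.symm : Vec d →L[ℝ] Vec d)).trans hL
  obtain ⟨hα2, hβ2, hγ2⟩ := contraction_constants hS.le hκ1 hΛ₁ hΛ₂ hΓ0 hT.le hω hb hζP hζU
  set α := S * (T * (κ * Λ₁)) with hα
  set β := S * (κ ^ 2 * Γ * α + T * (κ * (κ * Λ₁ + Λ₂))) with hβ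
  -- the radius of the tube makes the nonlinear part of the control equations contractive
  set D := 3 * (1 + ω) * (1 + κ) * (Λ₂ + Λ₃ + 1) with hD
  have hD0 : 0 < D := by positivity
  set R := min ρ (1 / D) with hR
  have hR0 : 0 < R := lt_min hρ (by positivity)
  have hRρ : R ≤ ρ := min_le_left _ _
  set η := (Λ₂ + Λ₃) * R with hη
  have hη0 : 0 ≤ η := by positivity
  have hηs : (1 + ω) * (η * (1 + κ)) ≤ 1 / 3 := by
    have h1 : R * D ≤ 1 := by
      have := mul_le_mul_of_nonneg_right (min_le_right ρ (1 / D)) hD0.le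
      rwa [one_div_mul_cancel hD0.ne'] at this
    have h2 : 0 ≤ (1 + ω) * (1 + κ) * R := by positivity
    rw [hD] at h1
    rw [hη]
    nlinarith
  set δ := R / (2 * κ) with hδ
  have hδ0 : 0 < δ := by positivity
  have hκδ : κ * δ = R / 2 := by rw [hδ]; field_simp
  have hδR : δ ≤ R := by nlinarith
  have hloc : ∀ t ∈ Set.Icc 0 T', _ := fun t ht => localEstimates hS3 hH hε.le hR0.le hRρ ht
  have hgU : ∀ t ∈ Set.Icc 0 T', ∀ v, ‖gradUT f (y t, u t) v‖ ≤ Λ₁ * ‖v‖ := fun t ht v =>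
    (hloc t ht).gU_le v
  have hgY : ∀ t ∈ Set.Icc 0 T', ∀ v, ‖gradYT f (y t, u t) v‖ ≤ Λ₁ * ‖v‖ := fun t ht v => by
    have hz : ‖(y t, u t) - (y t, u t)‖ ≤ ρ := by rw [sub_self, norm_zero]; exact hρ.le
    have hpp : ‖p t - p t‖ ≤ ρ := by rw [sub_self, norm_zero]; exact hρ.le
    exact (norm_adjointEval_inl_le _ v).trans (mul_le_mul_of_nonneg_right
      (hS3.pointSmoothness ht _ _ hz hpp).2.2.1 (norm_nonneg _))
  obtain ⟨Mc, hMc, hcons⟩ := PeerTriplet.exists_consistency hord hqr hC hT.le hT' hKKT hy hp hΛ₁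
    hgY hgU
  set M₀ := S * T + S * (κ ^ 2 * Γ * (S * T) + T)
      + (ω * (κ * Λ₁ * (S * (κ ^ 2 * Γ * (S * T) + T)) + Λ₂ * (S * T)) + (1 + ω)) with hM₀
  have hM₀0 : 0 ≤ M₀ := by positivity
  obtain ⟨h₁, hh₁, hh₁c⟩ : ∃ h₁ : ℝ, 0 < h₁ ∧
      ∀ h ≤ h₁, T + 𝒯.nodeBound * h ≤ T' ∨ ∀ i, 𝒯.c i ≤ 1 := by
    have hnb : 0 < 𝒯.nodeBound := zero_lt_one.trans_le 𝒯.one_le_nodeBound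
    rcases hcT with hlt | hle
    · refine ⟨(T' - T) / 𝒯.nodeBound, div_pos (by linarith) hnb, fun h hh => Or.inl ?_⟩
      rw [le_div_iff₀ hnb] at hh
      linarith
    · exact ⟨1, one_pos, fun _ _ => Or.inr hle⟩
  -- small steps: the grid stays inside the interval, there are at least three steps, and the
  -- residual at the exact solution keeps the zero inside the ball of radius `δ`
  set h₀ := min (min 1 (T / 3)) (min h₁ (min (R / (2 * (Mc + 1))) (δ / (2 * (M₀ * Mc + 1))))) with hh₀
  refine ⟨δ, h₀, 2 * (M₀ * Mc), hδ0, ?_, ?_⟩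
  · refine lt_min (lt_min one_pos (by positivity)) (lt_min hh₁ (lt_min ?_ ?_)) <;> positivity
  intro N h hhN hhle
  have hN1 : (0 : ℝ) < (N : ℝ) + 1 := by positivity
  have hpos : 0 < h := by rw [hhN]; positivity
  have hNT : ((N : ℝ) + 1) * h = T := by rw [hhN]; field_simp
  obtain ⟨⟨hle1, hleT⟩, hleh₁, hleR, hleδ⟩ : (h ≤ 1 ∧ h ≤ T / 3) ∧ h ≤ h₁ ∧
      h ≤ R / (2 * (Mc + 1)) ∧ h ≤ δ / (2 * (M₀ * Mc + 1)) := by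
    simpa only [hh₀, le_min_iff] using hhle
  have hN2 : 2 ≤ N := by
    have h3 : (3 : ℝ) ≤ (N : ℝ) + 1 := by
      by_contra hcon
      push Not at hcon
      nlinarith
    have : (2 : ℝ) ≤ N := by linarith
    exact_mod_cast this
  have hgrid : ∀ n ≤ N, ∀ j, ((n : ℝ) + 𝒯.c j) * h ∈ Set.Icc 0 T' := fun n hn j =>
    𝒯.node_mem_Icc hpos.le hNT hTT (hh₁c h hleh₁) hn j
  have hpow : h ^ (q + 1) = h * h ^ q := pow_succ' h q
  have hpowq : h ^ q ≤ h := by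
    have := pow_le_pow_of_le_one hpos.le hle1 (show 1 ≤ q by omega)
    rwa [pow_one] at this
  have hpowq1 : h ^ (q + 1) ≤ h ^ q := pow_le_pow_of_le_one hpos.le hle1 (Nat.le_succ q)
  have hpowq0 : 0 ≤ h ^ q := by positivity
  obtain ⟨hcm, hcY, hcP, hcU⟩ := hcons N h hN2 hpos.le hle1 hNT hTT hgrid
  set 𝒢 := 𝒯.gridProblem f C y₀ T y p u N h with h𝒢
  have hB : 𝒢.Bounds S κ Λ₁ Λ₂ Γ η ω R δ :=
    { S_pos := hS
      κ_nonneg := hκ0.le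
      Λ₁_nonneg := hΛ₁
      Λ₂_nonneg := hΛ₂
      Γ_nonneg := hΓ0
      η_nonneg := hη0
      ω_nonneg := hω
      h_nonneg := hpos.le
      LY_stable := fun x => (hstab (Vec m) N hN2 x).1
      LP_stable := fun x => (hstab (Vec m) N hN2 x).2
      entrySum_K := fun n => hκK N n
      entrySum_normalizedCols := fun n => hκn N n
      sum_w := hκw
      grad_sub := fun x x' => hC.gradient_sub (y T) x x'
      norm_gradLin := hΓ.ge
      δ_le := hδR
      mult_mem := by
        intro P hP n j hj
        have h1 := GridProblem.norm_mult_le (𝒢 := 𝒢) hκ0.le (fun n => hκn N n) (P - 𝒢.ps) n j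
        rw [𝒢.mult_sub] at h1
        have h2 := hcm n j hj
        have h3 : κ * ‖P - 𝒢.ps‖ ≤ R / 2 := by
          rw [← hκδ]
          exact mul_le_mul_of_nonneg_left hP hκ0.le
        have h4 : Mc * h ^ (q + 1) ≤ R / 2 := by
          rw [le_div_iff₀ (by positivity)] at hleR
          have : Mc * h ^ (q + 1) ≤ Mc * h :=
            mul_le_mul_of_nonneg_left (hpowq1.trans hpowq) hMc
          linarith
        have e : 𝒢.mult P n j - 𝒢.ps n j
            = (𝒢.mult P n - 𝒢.mult 𝒢.ps n) j + (𝒢.mult 𝒢.ps n j - 𝒢.ps n j) := by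
          rw [Pi.sub_apply]
          abel
        rw [e]
        refine (norm_add_le _ _).trans ?_
        change ‖𝒢.mult 𝒢.ps n j - 𝒢.ps n j‖ ≤ _ at h2
        linarith
      loc := fun n j => hloc _ (hgrid n (Nat.lt_succ_iff.mp n.2) j) }
  have hMτ : M₀ * (Mc * h ^ q) ≤ δ / 2 := by
    rw [le_div_iff₀ (by positivity)] at hleδ
    have h1 : M₀ * Mc * h ^ q ≤ M₀ * Mc * h := mul_le_mul_of_nonneg_left hpowq (by positivity)
    linarith
  have hstep : ∀ x : ℝ, x ≤ Mc * h ^ (q + 1) → x ≤ h * (Mc * h ^ q) := fun x hx => by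
    refine hx.trans (le_of_eq ?_)
    rw [hpow]
    ring
  obtain ⟨⟨Y, P, U⟩, hzδ, hzM, hz0, huniq⟩ := hB.exists_unique_zero (T := T) hNT.symm le_rfl le_rfl
    hα2 hβ2 (by linarith) (τ := Mc * h ^ q) (by positivity) (fun n i => hstep _ (hcY n i))
    (fun n i => hstep _ (hcP n i))
    (fun n j => (hcU n j).trans (mul_le_mul_of_nonneg_left hpowq1 hMc)) hM₀ hMτ
  have hK := fun n => hord.oneLegWeights N n
  have herr : ∀ e, ‖(Y, P, U) - 𝒢.ref‖ ≤ e → 𝒯.ErrorLE y p u N h Y P U e := by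
    intro e he n i
    have h1 : ‖Y - 𝒢.ys‖ ≤ e := (norm_fst_le ((Y, P, U) - 𝒢.ref)).trans he
    have h2 : ‖(P, U) - (𝒢.ps, 𝒢.us)‖ ≤ e := (norm_snd_le ((Y, P, U) - 𝒢.ref)).trans he
    have h3 : ‖P - 𝒢.ps‖ ≤ e := (norm_fst_le ((P, U) - (𝒢.ps, 𝒢.us))).trans h2
    have h4 : ‖U - 𝒢.us‖ ≤ e := (norm_snd_le ((P, U) - (𝒢.ps, 𝒢.us))).trans h2
    exact ⟨((norm_le_pi_norm _ i).trans (norm_le_pi_norm (Y - 𝒢.ys) n)).trans h1,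
      ((norm_le_pi_norm _ i).trans (norm_le_pi_norm (P - 𝒢.ps) n)).trans h3,
      fun _ => ((norm_le_pi_norm _ i).trans (norm_le_pi_norm (U - 𝒢.us) n)).trans h4⟩
  refine ⟨Y, P, U, PeerTriplet.isDiscreteKKT_of_residual_eq_zero hK hz0, herr δ hzδ, ?_, ?_⟩
  · refine herr _ (hzM.trans (le_of_eq ?_))
    rw [Nat.add_sub_cancel]
    ring
  · intro Y' P' U' hKKT' herr'
    -- the discarded controls of blind stages are replaced by the exact ones, as in the residual map
    set V : Fin (N + 1) → Fin s → Vec d := fun n j =>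
      if 𝒯.Active N n j then U' n j else u (((n : ℕ) + 𝒯.c j) * h) with hV
    have hres := PeerTriplet.residual_eq_zero_of_isDiscreteKKT (T := T) (y := y) (p := p) (u := u)
      hK hKKT'
    have hball : ‖(Y', P', V) - 𝒢.ref‖ ≤ δ := by
      have hpi : ∀ {E : Type} [NormedAddCommGroup E] (x x' : Fin (N + 1) → Fin s → E),
          (∀ n i, ‖x n i - x' n i‖ ≤ δ) → ‖x - x'‖ ≤ δ := fun x x' hx =>
        (pi_norm_le_iff_of_nonneg hδ0.le).mpr fun n =>
          (pi_norm_le_iff_of_nonneg hδ0.le).mpr fun i => hx n i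
      refine norm_prod_le_iff.mpr ⟨hpi Y' 𝒢.ys fun n i => (herr' n i).1,
        norm_prod_le_iff.mpr ⟨hpi P' 𝒢.ps fun n i => (herr' n i).2.1, hpi V 𝒢.us fun n i => ?_⟩⟩
      by_cases hi : 𝒯.Active N n i
      · simp only [hV, if_pos hi]
        exact (herr' n i).2.2 hi
      · simp only [hV, if_neg hi]
        change ‖u _ - u _‖ ≤ _
        rw [sub_self, norm_zero]
        exact hδ0.le
    have heq := huniq (Y', P', V) hball hres
    obtain ⟨hY, hP, hU⟩ := by simpa only [Prod.mk.injEq] using heq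
    refine ⟨hY, hP, fun n j hj => ?_⟩
    rw [← hU]
    simp only [hV, if_pos hj]

end
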